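/- Fix $q\in\mathbb C$ with $0<|q|<1$ and an integer $M\ge 1$. Write $(a)_\infty=\prod_{i\ge0}(1-aq^i)$, $(a)_l=\prod_{i=0}^{l-1}(1-aq^i)$, $(a_1,\dots,a_r)_l=(a_1)_l\cdots(a_r)_l$ (also for $l=\infty$), and $${}_{r+1}\varphi_r\left(\begin{matrix}\alpha_1,\dots,\alpha_{r+1}\\ \beta_1,\dots,\beta_r\end{matrix};z\right)=\sum_{l\ge0}\frac{(\alpha_1,\dots,\alpha_{r+1})_l}{(q,\beta_1,\dots,\beta_r)_l}z^l,$$ $$\int_0^{\tau}f(t)\,d_qt=(1-q)\sum_{n\ge0}f(\tau q^n)\tau q^n,\qquad \int_{\tau_1}^{\tau_2}=\int_0^{\tau_2}-\int_0^{\tau_1}.$$ For $l\in\mathbb Z_{\ge0}^M$ put $|l|=l_1+\cdots+l_M$, and let $\Delta(x)=\prod_{1\le i<j\le M}(x_i-x_j)$. Kajihara's series is $$W^{M,2}(\{x_i\}_{i\le M};a;\{u_j\}_{j\le M+2};v_1,v_2;z)=\sum_{l\in\mathbb Z_{\ge0}^M}z^{|l|}\frac{\Delta(\{x_iq^{l_i}\})}{\Delta(x)}\prod_{i=1}^M\left(\frac{1-ax_iq^{|l|+l_i}}{1-ax_i}\cdot\frac{(ax_i)_{|l|}\prod_{j=1}^{M+2}(x_iu_j)_{l_i}}{\prod_{j=1}^M(qx_i/x_j)_{l_i}\,(aqx_i/v_1,aqx_i/v_2)_{l_i}}\right)\frac{(v_1,v_2)_{|l|}}{\prod_{j=1}^{M+2}(aq/u_j)_{|l|}}.$$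 All parameters are complex, and in each of the two parts it is assumed that none of the denominators occurring there vanishes. (1) Let $d=a^2q^2/(c_1c_2b_1\cdots b_{M+2}x_1\cdots x_M)$ and suppose $|d|<1$. Then all the series below converge absolutely and $$W^{M,2}(\{x_i\}_{i\le M};a;\{b_j\}_{j\le M+2};c_1,c_2;d)=\prod_{i=1}^M\frac{(aqx_i)_\infty}{(aqx_i/c_1)_\infty}\prod_{j=1}^{M+2}\frac{(aq/(c_1b_j))_\infty}{(aq/b_j)_\infty}\cdot\frac{(c_1d,c_2)_\infty}{(d,c_2/c_1)_\infty}\;{}_{M+3}\varphi_{M+2}\left(\begin{matrix}c_1,\{aq/(c_2b_j)\}_{1\le j\le M+2}\\ qc_1/c_2,\,c_1d,\,\{aqx_i/c_2\}_{1\le i\le M}\end{matrix};q\right)+\mathrm{idem}(c_1;c_2),$$ where $\mathrm{idem}(c_1;c_2)$ denotes the preceding expression with $c_1$ and $c_2$ interchanged. (2) (Equivalent integral form.) Let $a_1\cdots a_{M+3}=q^2b_1\cdots b_{M+3}$ and $|a_{M+1}/b_{M+3}|<1$. Then all the series below (including those defining the Jackson integral) converge absolutely and $$\begin{aligned}\i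nt_{q/a_{M+2}}^{q/a_{M+3}}\prod_{k=1}^{M+3}\frac{(a_kt)_\infty}{(b_kt)_\infty}\,d_qt={}&\prod_{i=1}^M\frac{(qa_i/a_{M+2},qa_i/a_{M+3})_\infty}{(q^2a_ib_{M+3}/(a_{M+2}a_{M+3}))_\infty}\prod_{j=1}^{M+2}\left(\frac{q^2b_jb_{M+3}}{a_{M+2}a_{M+3}}\right)_\infty\prod_{j=1}^{M+3}\frac1{(qb_j/a_{M+2},qb_j/a_{M+3})_\infty}\\&\times\left(q,\frac{a_{M+1}}{b_{M+3}},\frac{a_{M+2}}{a_{M+3}},\frac{a_{M+3}}{a_{M+2}}\right)_\infty\frac{(1-q)q}{a_{M+3}-a_{M+2}}\\&\times W^{M,2}\left(\{a_i\}_{i\le M};\frac{qb_{M+3}}{a_{M+2}a_{M+3}};\left\{\frac1{b_j}\right\}_{j\le M+2};\frac{qb_{M+3}}{a_{M+2}},\frac{qb_{M+3}}{a_{M+3}};\frac{a_{M+1}}{b_{M+3}}\right).\end{aligned}$$ -/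

import Mathlib

noncomputable section

namespace QSeries

/-- The infinite `q`-shifted factorial `(a)_∞ = ∏_{i ≥ 0} (1 - a q^i)`. -/
def qInf (q a : ℂ) : ℂ := ∏' i : ℕ, (1 - a * q ^ i)

/-- The finite `q`-shifted factorial `(a)_l = ∏_{0 ≤ i < l} (1 - a q^i)`, which is
`(a)_∞ / (a q^l)_∞` whenever the latter denominator is nonzero. -/
def qPoch (q a : ℂ) (l : ℕ) : ℂ := ∏ i ∈ Finset.range l, (1 - a * q ^ i)

/-- No factor of `(a)_∞` vanishes: `a q^n ≠ 1` for every `n ≥ 0`. This says that `(a)_∞` and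
all the `(a)_l` may stand in a denominator. -/
def NoZeroFactor (q a : ℂ) : Prop := ∀ n : ℕ, a * q ^ n ≠ 1

/-- The `l`-th term of the basic hypergeometric series `_rφ_s(a; b; z)`. -/
def phiTerm (q : ℂ) {r s : ℕ} (a : Fin r → ℂ) (b : Fin s → ℂ) (z : ℂ) (l : ℕ) : ℂ :=
  (∏ i, qPoch q (a i) l) / (qPoch q q l * ∏ j, qPoch q (b j) l)
    * ((-1) ^ l * q ^ (l.choose 2)) ^ (1 + (s : ℤ) - (r : ℤ)) * z ^ l

/-- The basic hypergeometric series `_rφ_s(a; b; z)`. -/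
def phi (q : ℂ) {r s : ℕ} (a : Fin r → ℂ) (b : Fin s → ℂ) (z : ℂ) : ℂ :=
  ∑' l : ℕ, phiTerm q a b z l

/-- The Vandermonde product `Δ(x) = ∏_{i < j} (x_i - x_j)`. -/
def vandermondeProd {M : ℕ} (x : Fin M → ℂ) : ℂ :=
  ∏ i, ∏ j ∈ Finset.Ioi i, (x i - x j)

/-- The term of index `l ∈ ℕ^M` of Kajihara's series `W^{M,N}(x; a; u; v; z)`. -/
def kajiharaTerm (q : ℂ) {M N : ℕ} (x : Fin M → ℂ) (a : ℂ) (u : Fin (M + N) → ℂ)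
    (v : Fin N → ℂ) (z : ℂ) (l : Fin M → ℕ) : ℂ :=
  z ^ (∑ i, l i)
    * (vandermondeProd (fun i => x i * q ^ l i) / vandermondeProd x)
    * (∏ i, ((1 - a * x i * q ^ ((∑ m, l m) + l i)) / (1 - a * x i)
        * ((qPoch q (a * x i) (∑ m, l m) * ∏ j, qPoch q (x i * u j) (l i))
          / ((∏ j, qPoch q (q * x i / x j) (l i)) * ∏ k, qPoch q (a * q * x i / v k) (l i)))))
    * ((∏ k, qPoch q (v k) (∑ m, l m)) / ∏ j, qPoch q (a * q / u j) (∑ m, l m))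

/-- Kajihara's very well-poised series `W^{M,N}(x; a; u; v; z)`. -/
def kajiharaW (q : ℂ) {M N : ℕ} (x : Fin M → ℂ) (a : ℂ) (u : Fin (M + N) → ℂ)
    (v : Fin N → ℂ) (z : ℂ) : ℂ :=
  ∑' l : Fin M → ℕ, kajiharaTerm q x a u v z l

/-- The `n`-th term `f(τ q^n) τ q^n` of the Jackson integral of `f` from `0` to `τ`. -/
def jacksonTerm (q τ : ℂ) (f : ℂ → ℂ) (n : ℕ) : ℂ := f (τ * q ^ n) * (τ * q ^ n)

/-- The Jackson integral `∫_0^τ f(t) d_q t`. -/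
def jacksonZero (q τ : ℂ) (f : ℂ → ℂ) : ℂ := (1 - q) * ∑' n : ℕ, jacksonTerm q τ f n

/-- The Jackson integral `∫_{τ₁}^{τ₂} f(t) d_q t`. -/
def jackson (q τ₁ τ₂ : ℂ) (f : ℂ → ℂ) : ℂ := jacksonZero q τ₂ f - jacksonZero q τ₁ f

/-- `∏_i (aqx_i)_∞/(aqx_i/c₁)_∞ ∏_j (aq/(c₁b_j))_∞/(aq/b_j)_∞ · (c₁d, c₂)_∞/(d, c₂/c₁)_∞` times
`_{M+3}φ_{M+2}(c₁, {aq/(c₂b_j)}; qc₁/c₂, c₁d, {aqx_i/c₂}; q)`. Exchanging `c₁` and `c₂` in it gives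
the term `idem(c₁; c₂)`. -/
def phiPart (q : ℂ) {M : ℕ} (x : Fin M → ℂ) (a : ℂ) (b : Fin (M + 2) → ℂ) (c₁ c₂ d : ℂ) : ℂ :=
  (∏ i, qInf q (a * q * x i) / qInf q (a * q * x i / c₁))
    * (∏ j, qInf q (a * q / (c₁ * b j)) / qInf q (a * q / b j))
    * ((qInf q (c₁ * d) * qInf q c₂) / (qInf q d * qInf q (c₂ / c₁)))
    * phi q (r := M + 3) (s := M + 2)
        (Fin.cons c₁ (fun j : Fin (M + 2) => a * q / (c₂ * b j)))
        (Fin.cons (q * c₁ / c₂) (Fin.cons (c₁ * d) (fun i : Fin M => a * q * x i / c₂))) q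

end QSeries

end

open QSeries

noncomputable section

namespace QSeries

open Filter Topology

/-! Up to constants, the two `φ` series of part (1) are the sums over `t = q^(n+1)/r` and `t =
q^(n+1)/s` that make up the Jackson integral of part (2). Both parts are therefore one identity.
After multiplication by denominators and rescaling by `a`, it equates the normalised integral
`jDiff` with a constant times the sum of `kTerm`. Here every term is entire in the parameters `b_j`
and in an auxiliary parameter `α`, finally set to `1`. The difference of the two sides is `defect`,
and the task is to show `defect = 0`.

Contiguity. Replace one of three parameters `b₁, b₂, b₃` by `q` times itself. The three resulting
values of either side satisfy the same linear relation. For the integral this holds term by term,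
because `(b₂ - b₃)(1 - b₁t)` has cyclic sum zero (`jTerm_three_term`). For the multiple series it
holds up to a discrete divergence. Lagrange interpolation in the variable `b`, with nodes `x_i
q^(l_i - 1)` and one extra node, writes the combination of terms as residues (`kTerm_three_term`).
The residue at the extra node is a flux attached to `l`, and the others are fluxes attached to the
neighbours `l - e_i`. A second interpolation identity says that the fluxes attached to one cell
balance (`sum_fluxDir`), so the total vanishes. Hence `defect` satisfies the relation
(`defect_three_term`).

Induction on the number of variables. With no variable the identity is the nonterminating
`q`-Saalschütz sum (`jDiff₃_eq_prod`). If `b_0 = x_0`, all terms with `l_0 > 0` vanish and the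
identity reduces to one variable fewer (`defect_cons`). The three-term relation carries it from `b_0
= x_0 q^n` to `b_0 = x_0 q^(n+1)`, since two of its three members have the smaller exponent. The
points `x_0 q^n` accumulate at `0`, inside the disc of convergence in `b_0`, so the identity theorem
gives every admissible `b_0` (`defect_eq_zero_of_generic`). Continuity in `α` then removes the
genericity imposed on `α` (`defect_eq_zero`). -/

/-! ### Shifted factorials: limits, bounds, zeros, analyticity. -/

lemma summable_norm_mul_pow {q : ℂ} (hq : ‖q‖ < 1) (a : ℂ) :
    Summable fun i : ℕ => ‖-(a * q ^ i)‖ := by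
  simpa [norm_mul, norm_pow] using
    (summable_geometric_of_lt_one (norm_nonneg q) hq).mul_left ‖a‖

lemma tendsto_qPoch {q : ℂ} (hq : ‖q‖ < 1) (a : ℂ) :
    Tendsto (qPoch q a) atTop (𝓝 (qInf q a)) := by
  have h := (multipliable_one_add_of_summable (summable_norm_mul_pow hq a)).hasProd.tendsto_prod_nat
  simp only [← sub_eq_add_neg] at h
  exact h

lemma norm_qPoch_le {q : ℂ} (hq : ‖q‖ < 1) (a : ℂ) (n : ℕ) :
    ‖qPoch q a n‖ ≤ Real.exp (‖a‖ / (1 - ‖q‖)) := by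
  have h1 : ‖qPoch q a n‖ ≤ ∏ i ∈ Finset.range n, Real.exp (‖a‖ * ‖q‖ ^ i) := by
    rw [qPoch, norm_prod]
    refine Finset.prod_le_prod (fun _ _ => norm_nonneg _) fun i _ => ?_
    calc ‖1 - a * q ^ i‖ ≤ ‖(1 : ℂ)‖ + ‖a * q ^ i‖ := norm_sub_le _ _
      _ = ‖a‖ * ‖q‖ ^ i + 1 := by rw [norm_one, norm_mul, norm_pow, add_comm]
      _ ≤ _ := Real.add_one_le_exp _
  refine h1.trans ?_
  rw [← Real.exp_sum, ← Finset.mul_sum, div_eq_mul_inv]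
  gcongr
  rw [← tsum_geometric_of_lt_one (norm_nonneg q) hq]
  exact (summable_geometric_of_lt_one (norm_nonneg q) hq).sum_le_tsum _
    (fun _ _ => by positivity)

lemma norm_qInf_le {q : ℂ} (hq : ‖q‖ < 1) (a : ℂ) :
    ‖qInf q a‖ ≤ Real.exp (‖a‖ / (1 - ‖q‖)) :=
  le_of_tendsto (tendsto_qPoch hq a).norm (Eventually.of_forall fun n => norm_qPoch_le hq a n)

@[simp] lemma qPoch_zero (q a : ℂ) : qPoch q a 0 = 1 := by simp [qPoch]

lemma qPoch_succ (q a : ℂ) (n : ℕ) : qPoch q a (n + 1) = qPoch q a n * (1 - a * q ^ n) := by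
  simp [qPoch, Finset.prod_range_succ]

lemma qPoch_succ' (q a : ℂ) (n : ℕ) : qPoch q a (n + 1) = (1 - a) * qPoch q (a * q) n := by
  simp only [qPoch, Finset.prod_range_succ', pow_zero, mul_one, pow_succ']
  rw [mul_comm]
  simp only [mul_assoc]

@[simp] lemma qPoch_zero_left (q : ℂ) (n : ℕ) : qPoch q 0 n = 1 := by simp [qPoch]

@[simp] lemma qInf_zero (q : ℂ) : qInf q 0 = 1 := by simp [qInf]

lemma qInf_eq_mul {q : ℂ} (hq : ‖q‖ < 1) (a : ℂ) : qInf q a = (1 - a) * qInf q (a * q) := by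
  refine tendsto_nhds_unique ((tendsto_qPoch hq a).comp (tendsto_add_atTop_nat 1)) ?_
  have := (tendsto_qPoch hq (a * q)).const_mul (1 - a)
  exact this.congr fun n => (qPoch_succ' q a n).symm

lemma qInf_eq_qPoch_mul {q : ℂ} (hq : ‖q‖ < 1) (a : ℂ) (n : ℕ) :
    qInf q a = qPoch q a n * qInf q (a * q ^ n) := by
  induction n with
  | zero => simp
  | succ n ih => rw [ih, qPoch_succ, qInf_eq_mul hq (a * q ^ n), pow_succ]; ring_nf

@[simp] lemma qInf_one {q : ℂ} (hq : ‖q‖ < 1) : qInf q 1 = 0 := by simp [qInf_eq_mul hq 1]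

lemma qPoch_ne_zero {q a : ℂ} (h : NoZeroFactor q a) (n : ℕ) : qPoch q a n ≠ 0 :=
  Finset.prod_ne_zero_iff.2 fun i _ => sub_ne_zero.2 (h i).symm

lemma qInf_ne_zero {q a : ℂ} (hq : ‖q‖ < 1) (h : NoZeroFactor q a) : qInf q a ≠ 0 := by
  have := tprod_one_add_ne_zero_of_summable (f := fun i : ℕ => -(a * q ^ i))
    (fun i => by rw [← sub_eq_add_neg]; exact sub_ne_zero.2 (h i).symm) (summable_norm_mul_pow hq a)
  simp only [← sub_eq_add_neg] at this
  exact this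

lemma noZeroFactor_of_norm_lt_one {q a : ℂ} (hq : ‖q‖ < 1) (ha : ‖a‖ < 1) : NoZeroFactor q a := by
  intro n h
  have h1 : ‖a * q ^ n‖ < 1 := by
    rw [norm_mul, norm_pow]
    exact mul_lt_one_of_nonneg_of_lt_one_left (norm_nonneg _) ha (pow_le_one₀ (norm_nonneg _) hq.le)
  rw [h, norm_one] at h1
  exact lt_irrefl _ h1

lemma NoZeroFactor.mul_pow {q a : ℂ} (h : NoZeroFactor q a) (k : ℕ) :
    NoZeroFactor q (a * q ^ k) := fun n => by
  rw [mul_assoc, ← pow_add]; exact h _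

lemma NoZeroFactor.mul_q {q a : ℂ} (h : NoZeroFactor q a) : NoZeroFactor q (a * q) := by
  simpa using h.mul_pow 1

lemma differentiable_qInf {q : ℂ} (hq : ‖q‖ < 1) : Differentiable ℂ (qInf q) := by
  have hloc : HasProdLocallyUniformlyOn (fun (n : ℕ) (a : ℂ) => 1 + -(a * q ^ n))
      (fun a => ∏' n : ℕ, (1 + -(a * q ^ n))) Set.univ := by
    apply hasProdLocallyUniformlyOn_of_forall_compact isOpen_univ
    intro K _ hcK
    obtain ⟨R, hR⟩ := hcK.isBounded.exists_norm_le
    refine Summable.hasProdUniformlyOn_nat_one_add hcK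
      ((summable_geometric_of_lt_one (norm_nonneg q) hq).mul_left R)
      (.of_forall fun n a ha => ?_) (fun _ => by fun_prop)
    rw [norm_neg, norm_mul, norm_pow]
    gcongr
    exact hR a ha
  have h := hloc.differentiableOn (.of_forall fun s => by
    simpa [Finset.prod_fn] using DifferentiableOn.finsetProd (fun _ _ => by fun_prop)) isOpen_univ
  simp only [← sub_eq_add_neg, differentiableOn_univ] at h
  exact h

@[fun_prop] lemma differentiable_qInf_comp {q : ℂ} (hq : ‖q‖ < 1) {f : ℂ → ℂ}
    (hf : Differentiable ℂ f) : Differentiable ℂ fun w => qInf q (f w) :=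
  (differentiable_qInf hq).comp hf

@[fun_prop] lemma differentiable_qPoch_comp (q : ℂ) {f : ℂ → ℂ}
    (hf : Differentiable ℂ f) (n : ℕ) : Differentiable ℂ fun w => qPoch q (f w) n := by
  unfold qPoch
  exact Differentiable.fun_finsetProd fun i _ => by fun_prop

lemma exists_norm_inv_qPoch_le {q a : ℂ} (hq : ‖q‖ < 1) (h : NoZeroFactor q a) :
    ∃ C, ∀ n, ‖(qPoch q a n)⁻¹‖ ≤ C := by
  have := ((tendsto_qPoch hq a).inv₀ (qInf_ne_zero hq h))
  obtain ⟨C, hC⟩ := (Metric.isBounded_range_of_tendsto _ this).exists_norm_le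
  exact ⟨C, fun n => hC _ ⟨n, rfl⟩⟩

/-! ### Shifted products that remain defined at `b = 0`. -/

/-- The product `∏_{0 ≤ k < l} (b - x q^k)`, which is `b^l (x/b)_l` when `b ≠ 0`. -/
def shiftProd (q b x : ℂ) (l : ℕ) : ℂ := ∏ k ∈ Finset.range l, (b - x * q ^ k)

@[simp] lemma shiftProd_zero (q b x : ℂ) : shiftProd q b x 0 = 1 := by simp [shiftProd]

@[fun_prop] lemma differentiable_shiftProd_comp (q x : ℂ) {f : ℂ → ℂ}
    (hf : Differentiable ℂ f) (l : ℕ) : Differentiable ℂ fun w => shiftProd q (f w) x l := by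
  unfold shiftProd
  exact Differentiable.fun_finsetProd fun i _ => by fun_prop

lemma shiftProd_succ (q b x : ℂ) (l : ℕ) :
    shiftProd q b x (l + 1) = shiftProd q b x l * (b - x * q ^ l) := by
  simp [shiftProd, Finset.prod_range_succ]

lemma shiftProd_eq {b : ℂ} (hb : b ≠ 0) (q x : ℂ) (l : ℕ) :
    shiftProd q b x l = b ^ l * qPoch q (x / b) l := by
  induction l with
  | zero => simp
  | succ l ih => rw [shiftProd_succ, qPoch_succ, ih, pow_succ]; field_simp

/-- Each factor `q b - x q^k` is `q (b - x q^(k-1))`; the one with `k = 0` gives the new factor `b -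
x / q`. -/
lemma shiftProd_mul_left {q : ℂ} (hq : q ≠ 0) (b x : ℂ) (l : ℕ) :
    shiftProd q (q * b) x (l + 1) = q ^ (l + 1) * (b - x / q) * shiftProd q b x l := by
  induction l with
  | zero => simp [shiftProd_succ]; field_simp
  | succ l ih => rw [shiftProd_succ, ih, shiftProd_succ]; ring

/-- A radius `ρ > 0` stands in for `‖b‖` so that the bound also covers `b = 0` and is uniform on
discs. -/
lemma norm_shiftProd_le {q b x : ℂ} (hq : ‖q‖ < 1) {ρ K : ℝ} (hρ : 0 < ρ) (hb : ‖b‖ ≤ ρ)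
    (hx : ‖x‖ ≤ K) (l : ℕ) :
    ‖shiftProd q b x l‖ ≤ ρ ^ l * Real.exp (K / ρ / (1 - ‖q‖)) := by
  have h1 : ‖shiftProd q b x l‖ ≤ ∏ i ∈ Finset.range l, ρ * Real.exp (K / ρ * ‖q‖ ^ i) := by
    rw [shiftProd, norm_prod]
    refine Finset.prod_le_prod (fun _ _ => norm_nonneg _) fun i _ => ?_
    calc ‖b - x * q ^ i‖ ≤ ‖b‖ + ‖x * q ^ i‖ := norm_sub_le _ _
      _ ≤ ρ + K * ‖q‖ ^ i := by rw [norm_mul, norm_pow]; gcongr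
      _ = ρ * (K / ρ * ‖q‖ ^ i + 1) := by field_simp; ring
      _ ≤ _ := by gcongr; exact Real.add_one_le_exp _
  refine h1.trans ?_
  have hK : 0 ≤ K := (norm_nonneg _).trans hx
  rw [Finset.prod_mul_distrib, Finset.prod_const, Finset.card_range, ← Real.exp_sum,
    ← Finset.mul_sum, div_eq_mul_inv (K / ρ)]
  gcongr
  rw [← tsum_geometric_of_lt_one (norm_nonneg q) hq]
  exact (summable_geometric_of_lt_one (norm_nonneg q) hq).sum_le_tsum _
    (fun _ _ => by positivity)

lemma summable_pow_sum {ρ : ℝ} (h0 : 0 ≤ ρ) (h1 : ρ < 1) (M : ℕ) :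
    Summable fun l : Fin M → ℕ => ρ ^ (∑ i, l i) := by
  induction M with
  | zero => exact (hasSum_fintype _).summable
  | succ M ih =>
    rw [← (Fin.consEquiv fun _ => ℕ).summable_iff]
    have := (summable_geometric_of_lt_one h0 h1).mul_of_nonneg ih (fun _ => by positivity)
      (fun _ => by positivity)
    refine this.congr fun p => ?_
    simp [Fin.sum_univ_succ, pow_add, Fin.consEquiv]

/-! ### Lagrange interpolation identities. -/

open Polynomial in
-- Division by the nodal polynomial: the degree bound makes the quotient linear, and the remainder
-- is the Lagrange interpolant of `A`.
lemma exists_eval_eq_sum_erase {ι : Type*} [DecidableEq ι] (S : Finset ι) (v : ι → ℂ)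
    (hv : Set.InjOn v S) (A : ℂ[X]) (hA : A.natDegree ≤ S.card + 1) :
    ∃ α γ : ℂ, ∀ b : ℂ, A.eval b = (∏ i ∈ S, (b - v i)) * (α * b + γ)
      + ∑ i ∈ S, A.eval (v i) / (∏ j ∈ S.erase i, (v i - v j)) * ∏ j ∈ S.erase i, (b - v j) := by
  have hmon := Lagrange.nodal_monic (R := ℂ) (s := S) (v := v)
  have hmod : A %ₘ Lagrange.nodal S v = Lagrange.interpolate S v (fun i => A.eval (v i)) := by
    refine Lagrange.eq_interpolate_of_eval_eq _ hv ?_ fun i hi => ?_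
    · rw [← Lagrange.degree_nodal (R := ℂ) (s := S) (v := v)]
      exact degree_modByMonic_lt _ hmon
    · have := congrArg (eval (v i)) (modByMonic_add_div A (Lagrange.nodal S v))
      simpa [Lagrange.eval_nodal_at_node hi] using this
  have hdeg : (A /ₘ Lagrange.nodal S v).natDegree ≤ 1 := by
    rw [natDegree_divByMonic _ hmon, Lagrange.natDegree_nodal]
    omega
  obtain ⟨α, γ, hαγ⟩ := exists_eq_X_add_C_of_natDegree_le_one hdeg
  refine ⟨α, γ, fun b => ?_⟩
  have := congrArg (eval b) (modByMonic_add_div A (Lagrange.nodal S v))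
  rw [hmod, hαγ, Lagrange.interpolate_eq_sum] at this
  rw [← this]
  simp only [eval_add, eval_mul, eval_finsetSum, eval_C, eval_prod, eval_sub, eval_X,
    Lagrange.eval_nodal]
  ring

open Polynomial in
-- The linear quotient drops out because `(b₂ - b₃)(α b₁ + γ)` has cyclic sum zero. Each node
-- contributes through the identity that the cyclic sum of `(b₂ - b₃)/(b₁ - v)` is `-(b₁ - b₂)(b₂ -
-- b₃)(b₃ - b₁)` divided by `(b₁ - v)(b₂ - v)(b₃ - v)`.
lemma cyclic_sum_eq {ι : Type*} [DecidableEq ι] (S : Finset ι) (v : ι → ℂ)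
    (hv : Set.InjOn v S) (A : ℂ[X]) (hA : A.natDegree ≤ S.card + 1) (b₁ b₂ b₃ : ℂ) :
    (b₂ - b₃) * A.eval b₁ * (∏ i ∈ S, (b₂ - v i)) * (∏ i ∈ S, (b₃ - v i))
      + (b₃ - b₁) * A.eval b₂ * (∏ i ∈ S, (b₃ - v i)) * (∏ i ∈ S, (b₁ - v i))
      + (b₁ - b₂) * A.eval b₃ * (∏ i ∈ S, (b₁ - v i)) * (∏ i ∈ S, (b₂ - v i))
    = -((b₁ - b₂) * (b₂ - b₃) * (b₃ - b₁)) *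
      ∑ i ∈ S, A.eval (v i) / (∏ j ∈ S.erase i, (v i - v j)) *
        ((∏ j ∈ S.erase i, (b₁ - v j)) * (∏ j ∈ S.erase i, (b₂ - v j)) *
          ∏ j ∈ S.erase i, (b₃ - v j)) := by
  obtain ⟨α, γ, h⟩ := exists_eval_eq_sum_erase S v hv A hA
  have hsum : ∑ i ∈ S, A.eval (v i) / (∏ j ∈ S.erase i, (v i - v j)) *
        (((b₂ - b₃) * (∏ j ∈ S.erase i, (b₁ - v j)) * (∏ i ∈ S, (b₂ - v i)) * (∏ i ∈ S, (b₃ - v i))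
          + (b₃ - b₁) * (∏ j ∈ S.erase i, (b₂ - v j)) * (∏ i ∈ S, (b₃ - v i)) * (∏ i ∈ S, (b₁ - v i))
          + (b₁ - b₂) * (∏ j ∈ S.erase i, (b₃ - v j)) * (∏ i ∈ S, (b₁ - v i)) *
            (∏ i ∈ S, (b₂ - v i))))
      = -((b₁ - b₂) * (b₂ - b₃) * (b₃ - b₁)) *
      ∑ i ∈ S, A.eval (v i) / (∏ j ∈ S.erase i, (v i - v j)) *
        ((∏ j ∈ S.erase i, (b₁ - v j)) * (∏ j ∈ S.erase i, (b₂ - v j)) *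
          ∏ j ∈ S.erase i, (b₃ - v j)) := by
    rw [Finset.mul_sum]
    refine Finset.sum_congr rfl fun i hi => ?_
    simp only [← Finset.mul_prod_erase S _ hi]
    ring
  rw [← hsum, h b₁, h b₂, h b₃]
  simp only [mul_add, Finset.sum_add_distrib, add_mul]
  simp only [Finset.mul_sum, mul_assoc, mul_left_comm, mul_comm]
  ring_nf

/-- The polynomial `∏ k, (b k - Y)` has degree one less than the number of nodes, so it equals its
interpolant at the `X i`. Evaluation at `Y = ρ⁻¹`, cleared of powers of `ρ`, gives the identity. It
will express the balance of the fluxes. -/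
lemma sum_prod_erase_eq {ι κ : Type*} [Fintype ι] [DecidableEq ι] [Fintype κ]
    (hcard : Fintype.card ι = Fintype.card κ + 1) {X : ι → ℂ} (hX : Function.Injective X)
    (b : κ → ℂ) {ρ : ℂ} (hρ : ρ ≠ 0) :
    ∑ i, (∏ j ∈ Finset.univ.erase i, (1 - ρ * X j) / (X j - X i)) * ∏ k, (b k - X i)
      = ∏ k, (1 - ρ * b k) := by
  classical
  have hdeg : (∏ k : κ, (Polynomial.C (b k) - Polynomial.X)).degree
      < ((Finset.univ : Finset ι).card : WithBot ℕ) := by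
    refine (Polynomial.degree_prod_le _ _).trans_lt ?_
    refine (Finset.sum_le_sum fun k _ => (Polynomial.degree_sub_le _ _).trans
      (max_le (Polynomial.degree_C_le.trans zero_le_one) Polynomial.degree_X_le)).trans_lt ?_
    simp only [Finset.sum_const, Finset.card_univ, hcard, nsmul_eq_mul, mul_one]
    exact_mod_cast Nat.lt_succ_self _
  have h := congrArg (Polynomial.eval ρ⁻¹) (Lagrange.eq_interpolate hX.injOn hdeg)
  rw [Lagrange.interpolate_eq_sum] at h
  simp only [Polynomial.eval_finsetSum, Polynomial.eval_mul, Polynomial.eval_C,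
    Polynomial.eval_prod, Polynomial.eval_sub, Polynomial.eval_X] at h
  have h1 : ∏ k, (1 - ρ * b k) = (-ρ) ^ Fintype.card κ * ∏ k, (b k - ρ⁻¹) := by
    rw [← Finset.card_univ, ← Finset.prod_const, ← Finset.prod_mul_distrib]
    refine Finset.prod_congr rfl fun k _ => ?_
    field_simp
    ring
  rw [h1, h, Finset.mul_sum]
  refine Finset.sum_congr rfl fun i _ => ?_
  have hc : (Finset.univ.erase i).card = Fintype.card κ := by
    rw [Finset.card_erase_of_mem (Finset.mem_univ i), Finset.card_univ, hcard]; simp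
  have h2 : (∏ j ∈ Finset.univ.erase i, (1 - ρ * X j) / (X j - X i))
      = (-ρ) ^ Fintype.card κ * ((∏ j ∈ Finset.univ.erase i, (ρ⁻¹ - X j))
        / ∏ j ∈ Finset.univ.erase i, (X i - X j)) := by
    rw [← hc, ← Finset.prod_const, ← Finset.prod_div_distrib, ← Finset.prod_mul_distrib]
    refine Finset.prod_congr rfl fun j hj => ?_
    have h3 : X j - X i ≠ 0 := sub_ne_zero.2 fun h => Finset.ne_of_mem_erase hj (hX h)
    have h4 : X i - X j ≠ 0 := sub_ne_zero.2 fun h => Finset.ne_of_mem_erase hj (hX h.symm)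
    field_simp
    ring
  rw [h2]
  ring

/-! ### Vandermonde products. -/

/-- The cofactor of `∏_{j ≠ i} (X_j - X_i)` in the Vandermonde product. -/
def vandermondeCofactor {M : ℕ} (X : Fin M → ℂ) (i : Fin M) : ℂ :=
  (∏ _j ∈ Finset.Ioi i, (-1)) *
    ∏ k ∈ Finset.univ.erase i, ∏ j ∈ (Finset.Ioi k).erase i, (X k - X j)

/-- This isolates the dependence on `X i`: when a single index `l_i` is raised, only the first
factor changes. -/
lemma vandermondeProd_eq_mul_cofactor {M : ℕ} (X : Fin M → ℂ) (i : Fin M) :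
    vandermondeProd X = (∏ j ∈ Finset.univ.erase i, (X j - X i)) * vandermondeCofactor X i := by
  have h1 : ∀ k ∈ Finset.univ.erase i, ∏ j ∈ Finset.Ioi k, (X k - X j)
      = (if k < i then X k - X i else 1) * ∏ j ∈ (Finset.Ioi k).erase i, (X k - X j) := by
    intro k _
    split_ifs with h
    · rw [Finset.mul_prod_erase (Finset.Ioi k) (fun j => X k - X j) (Finset.mem_Ioi.2 h)]
    · rw [one_mul, Finset.erase_eq_of_notMem (by simpa using h)]
  have h2 : ∏ j ∈ Finset.Ioi i, (X i - X j)
      = (∏ _j ∈ Finset.Ioi i, (-1)) *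
        ∏ j ∈ Finset.univ.erase i, (if i < j then X j - X i else 1) := by
    have : ∏ j ∈ Finset.univ.erase i, (if i < j then X j - X i else 1)
        = ∏ j ∈ Finset.Ioi i, (X j - X i) := by
      rw [← Finset.prod_filter]
      refine Finset.prod_congr ?_ fun _ _ => rfl
      ext j
      simp only [Finset.mem_filter, Finset.mem_erase, Finset.mem_univ, and_true, Finset.mem_Ioi]
      exact ⟨fun h => h.2, fun h => ⟨h.ne', h⟩⟩
    rw [this, ← Finset.prod_mul_distrib]
    exact Finset.prod_congr rfl fun _ _ => by ring
  have h3 : (∏ j ∈ Finset.univ.erase i, (if i < j then X j - X i else 1)) *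
      (∏ j ∈ Finset.univ.erase i, (if j < i then X j - X i else 1))
      = ∏ j ∈ Finset.univ.erase i, (X j - X i) := by
    rw [← Finset.prod_mul_distrib]
    refine Finset.prod_congr rfl fun j hj => ?_
    rcases lt_or_gt_of_ne (Finset.ne_of_mem_erase hj) with h | h
    · simp [h, h.not_gt]
    · simp [h, h.not_gt]
  rw [vandermondeProd, ← Finset.mul_prod_erase _ _ (Finset.mem_univ i), Finset.prod_congr rfl h1,
    Finset.prod_mul_distrib, h2, vandermondeCofactor, ← h3]
  ring

lemma vandermondeCofactor_update {M : ℕ} (X : Fin M → ℂ) (i : Fin M) (y : ℂ) :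
    vandermondeCofactor (Function.update X i y) i = vandermondeCofactor X i := by
  unfold vandermondeCofactor
  congr 1
  refine Finset.prod_congr rfl fun k hk => Finset.prod_congr rfl fun j hj => ?_
  rw [Function.update_of_ne (Finset.ne_of_mem_erase hk),
    Function.update_of_ne (Finset.ne_of_mem_erase hj)]

lemma vandermondeProd_ne_zero {M : ℕ} {X : Fin M → ℂ} (hX : Function.Injective X) :
    vandermondeProd X ≠ 0 :=
  Finset.prod_ne_zero_iff.2 fun _ _ => Finset.prod_ne_zero_iff.2 fun _ hj =>
    sub_ne_zero.2 fun h => (Finset.mem_Ioi.1 hj).ne (hX h)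

lemma vandermondeProd_cons {M : ℕ} (y : ℂ) (X : Fin M → ℂ) :
    vandermondeProd (Fin.cons y X : Fin (M + 1) → ℂ) = (∏ j, (y - X j)) * vandermondeProd X := by
  simp only [vandermondeProd, Fin.prod_univ_succ, Fin.prod_Ioi_zero, Fin.prod_Ioi_succ,
    Fin.cons_zero, Fin.cons_succ]

/-! ### The normalised Jackson integral and its three-term relation. -/

/-- The factor contributed by `1 / (b t)_∞` to the normalised Jackson integral. -/
def jFactor (q r s b : ℂ) (n : ℕ) : ℂ := qPoch q (q * b / r) n * qInf q (q * b / s)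

/-- The terms of the Jackson integral from `0` to `q / r`, multiplied by the values at `q / r` and
`q / s` of the denominators of the integrand. -/
def jTerm (q : ℂ) {ι κ : Type*} [Fintype ι] [Fintype κ] (x : ι → ℂ) (α r s : ℂ) (b : κ → ℂ) (p : ℂ)
    (n : ℕ) : ℂ :=
  q ^ n * (∏ i, qInf q (x i * q ^ (n + 1) / r)) * qInf q (p * q ^ (n + 1) / r)
    * qInf q (q ^ (n + 1)) * qInf q (s * q ^ (n + 1) / r)
    * (qPoch q (α * s) n * qInf q (α * r)) * ∏ j, jFactor q r s (b j) n

/-- The normalised Jackson integral from `q / r` to `q / s`. -/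
def jDiff (q : ℂ) {ι κ : Type*} [Fintype ι] [Fintype κ] (x : ι → ℂ) (α r s : ℂ) (b : κ → ℂ)
    (p : ℂ) : ℂ :=
  (∑' n, jTerm q x α s r b p n) / s - (∑' n, jTerm q x α r s b p n) / r

/-- A bound for the `q`-shifted factorials with parameter `a`. -/
def expBound (q a : ℂ) : ℝ := Real.exp (‖a‖ / (1 - ‖q‖))

lemma expBound_pos (q a : ℂ) : 0 < expBound q a := Real.exp_pos _

lemma norm_qInf_mul_pow_le {q : ℂ} (hq : ‖q‖ < 1) (a : ℂ) (n : ℕ) :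
    ‖qInf q (a * q ^ n)‖ ≤ expBound q a := by
  refine (norm_qInf_le hq _).trans (Real.exp_le_exp.2 ?_)
  have : 0 < 1 - ‖q‖ := sub_pos.2 hq
  gcongr
  rw [norm_mul, norm_pow]
  exact mul_le_of_le_one_right (norm_nonneg _) (pow_le_one₀ (norm_nonneg _) hq.le)

lemma norm_jTerm_le {q : ℂ} (hq : ‖q‖ < 1) {ι κ : Type*} [Fintype ι] [Fintype κ] (x : ι → ℂ)
    (α r s : ℂ) (b : κ → ℂ) (p : ℂ) (n : ℕ) :
    ‖jTerm q x α r s b p n‖ ≤ ‖q‖ ^ n * ((∏ i, expBound q (x i / r)) * expBound q (p / r)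
      * expBound q 1 * expBound q (s / r) * (expBound q (α * s) * expBound q (α * r))
      * ∏ j, (expBound q (q * b j / r) * expBound q (q * b j / s))) := by
  have e : ∀ a : ℂ, ‖qInf q (a * q ^ (n + 1) / r)‖ ≤ expBound q (a / r) := fun a => by
    rw [mul_div_right_comm]; exact norm_qInf_mul_pow_le hq _ _
  have e1 : ‖qInf q (q ^ (n + 1))‖ ≤ expBound q 1 := by
    simpa using norm_qInf_mul_pow_le hq 1 (n + 1)
  have hp : ∀ a, 0 ≤ expBound q a := fun a => (expBound_pos q a).le
  have e2 : ∀ a, ‖qPoch q a n‖ ≤ expBound q a := fun a => norm_qPoch_le hq a n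
  have e3 : ∀ a, ‖qInf q a‖ ≤ expBound q a := norm_qInf_le hq
  simp only [jTerm, jFactor, norm_mul, norm_pow, norm_prod, mul_assoc]
  gcongr <;> with_reducible first
    | exact hp _
    | exact Finset.prod_nonneg fun _ _ => hp _
    | exact e1
    | exact e2 _
    | exact e _
    | exact e3 _

lemma summable_jTerm {q : ℂ} (hq : ‖q‖ < 1) {ι κ : Type*} [Fintype ι] [Fintype κ] (x : ι → ℂ)
    (α r s : ℂ) (b : κ → ℂ) (p : ℂ) : Summable (jTerm q x α r s b p) :=
  Summable.of_norm_bounded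
    ((summable_geometric_of_lt_one (norm_nonneg q) hq).mul_right _) (norm_jTerm_le hq x α r s b p)

/-- Both sides are `(qb/r)_{n+1} (qb/s)_∞`. -/
lemma jFactor_shift {q : ℂ} (hq : ‖q‖ < 1) (r s b : ℂ) (n : ℕ) :
    (1 - q * b / r) * (1 - q * b / s) * jFactor q r s (q * b) n
      = (1 - b * q ^ (n + 1) / r) * jFactor q r s b n := by
  have h1 : (1 - q * b / r) * qPoch q (q * (q * b) / r) n
      = qPoch q (q * b / r) n * (1 - b * q ^ (n + 1) / r) := by
    have := (qPoch_succ' q (q * b / r) n).symm.trans (qPoch_succ q (q * b / r) n)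
    rw [show q * (q * b) / r = q * b / r * q by ring, this, pow_succ]
    ring_nf
  have h2 := qInf_eq_mul hq (q * b / s)
  rw [show q * b / s * q = q * (q * b) / s by ring] at h2
  unfold jFactor
  rw [h2]
  linear_combination (1 - q * b / s) * qInf q (q * (q * b) / s) * h1

/-- Three values of `b` inserted before a given family of values. -/
abbrev cons₃ {N : ℕ} (b₁ b₂ b₃ : ℂ) (b : Fin N → ℂ) : Fin (N + 3) → ℂ :=
  Fin.cons b₁ (Fin.cons b₂ (Fin.cons b₃ b))

/-- By `jFactor_shift`, after removal of common factors this is the vanishing of the cyclic sum of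
`(b₂ - b₃)(1 - b₁ t)` at `t = q^(n+1)/r`. The parameter `p` may be kept fixed: in the application it
depends on the parameters only through their product, which is the same in all three members. -/
lemma jTerm_three_term {q : ℂ} (hq : ‖q‖ < 1) {ι : Type*} [Fintype ι] {N : ℕ} (x : ι → ℂ)
    (α r s : ℂ) (b : Fin N → ℂ) (p b₁ b₂ b₃ : ℂ) (n : ℕ) :
    (b₂ - b₃) * ((1 - q * b₁ / r) * (1 - q * b₁ / s)) *
        jTerm q x α r s (cons₃ (q * b₁) b₂ b₃ b) p n
      + (b₃ - b₁) * ((1 - q * b₂ / r) * (1 - q * b₂ / s)) *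
        jTerm q x α r s (cons₃ b₁ (q * b₂) b₃ b) p n
      + (b₁ - b₂) * ((1 - q * b₃ / r) * (1 - q * b₃ / s)) *
        jTerm q x α r s (cons₃ b₁ b₂ (q * b₃) b) p n = 0 := by
  simp only [jTerm, cons₃, Fin.prod_univ_succ (n := N + 2), Fin.prod_univ_succ (n := N + 1),
    Fin.prod_univ_succ (n := N), Fin.cons_zero, Fin.cons_succ]
  have h1 := jFactor_shift hq r s b₁ n
  have h2 := jFactor_shift hq r s b₂ n
  have h3 := jFactor_shift hq r s b₃ n
  set J₁ := jFactor q r s b₁ n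
  set J₂ := jFactor q r s b₂ n
  set J₃ := jFactor q r s b₃ n
  set P := ∏ j, jFactor q r s (b j) n
  generalize q ^ n * (∏ i, qInf q (x i * q ^ (n + 1) / r)) * qInf q (p * q ^ (n + 1) / r)
    * qInf q (q ^ (n + 1)) * qInf q (s * q ^ (n + 1) / r)
    * (qPoch q (α * s) n * qInf q (α * r)) = C
  linear_combination C * P * ((b₂ - b₃) * J₂ * J₃ * h1 + (b₃ - b₁) * J₃ * J₁ * h2
    + (b₁ - b₂) * J₁ * J₂ * h3)

lemma jDiff_three_term {q : ℂ} (hq : ‖q‖ < 1) {ι : Type*} [Fintype ι] {N : ℕ} (x : ι → ℂ)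
    (α r s : ℂ) (b : Fin N → ℂ) (p b₁ b₂ b₃ : ℂ) :
    (b₂ - b₃) * ((1 - q * b₁ / r) * (1 - q * b₁ / s)) * jDiff q x α r s (cons₃ (q * b₁) b₂ b₃ b) p
      + (b₃ - b₁) * ((1 - q * b₂ / r) * (1 - q * b₂ / s)) *
        jDiff q x α r s (cons₃ b₁ (q * b₂) b₃ b) p
      + (b₁ - b₂) * ((1 - q * b₃ / r) * (1 - q * b₃ / s)) *
        jDiff q x α r s (cons₃ b₁ b₂ (q * b₃) b) p = 0 := by
  have key : ∀ r s : ℂ, (b₂ - b₃) * ((1 - q * b₁ / r) * (1 - q * b₁ / s)) *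
        (∑' n, jTerm q x α r s (cons₃ (q * b₁) b₂ b₃ b) p n)
      + (b₃ - b₁) * ((1 - q * b₂ / r) * (1 - q * b₂ / s)) *
        (∑' n, jTerm q x α r s (cons₃ b₁ (q * b₂) b₃ b) p n)
      + (b₁ - b₂) * ((1 - q * b₃ / r) * (1 - q * b₃ / s)) *
        (∑' n, jTerm q x α r s (cons₃ b₁ b₂ (q * b₃) b) p n) = 0 := fun r s => by
    have hs := fun b : Fin (N + 3) → ℂ => summable_jTerm hq x α r s b p
    rw [← tsum_mul_left, ← tsum_mul_left, ← tsum_mul_left,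
      ← ((hs _).mul_left _).tsum_add ((hs _).mul_left _),
      ← (((hs _).mul_left _).add ((hs _).mul_left _)).tsum_add ((hs _).mul_left _)]
    simp only [jTerm_three_term hq, tsum_zero]
  unfold jDiff
  linear_combination (1 / s) * key s r - (1 / r) * key r s

/-! ### The normalised Kajihara series and its residues. -/

/-- The factor of a term of Kajihara's series that depends on the parameter `1 / b`. -/
def kFactor (q : ℂ) {M : ℕ} (x : Fin M → ℂ) (α b : ℂ) (l : Fin M → ℕ) : ℂ :=
  qInf q (α * q * b * q ^ (∑ i, l i)) * ∏ i, shiftProd q b (x i) (l i)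

/-- The quotient of `kFactor` by its factor `1 - α b q^(|l| + 1)`. -/
def kShift (q : ℂ) {M : ℕ} (x : Fin M → ℂ) (α b : ℂ) (l : Fin M → ℕ) : ℂ :=
  qInf q (α * q * b * q ^ (∑ i, l i + 1)) * ∏ i, shiftProd q b (x i) (l i)

/-- The part of a term of the normalised Kajihara series independent of the parameters `1 / b`. -/
def kWeight (q : ℂ) {M : ℕ} (x : Fin M → ℂ) (α r s : ℂ) (l : Fin M → ℕ) : ℂ :=
  (q ^ 2 / (r * s * ∏ i, x i)) ^ (∑ i, l i)
    * (vandermondeProd (fun i => x i * q ^ l i) / vandermondeProd x)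
    / (∏ i, ∏ j, qPoch q (q * x i / x j) (l i))
    * (∏ i, (1 - α * x i * q ^ (∑ m, l m + l i))) * (∏ i, qPoch q (α * x i) (∑ m, l m))
    * (qPoch q (α * s) (∑ m, l m) * qPoch q (α * r) (∑ m, l m))
    * ∏ i, (qInf q (q * (x i * q ^ l i) / r) * qInf q (q * (x i * q ^ l i) / s))

/-- The terms of the normalised Kajihara series. -/
def kTerm (q : ℂ) {M N : ℕ} (x : Fin M → ℂ) (α r s : ℂ) (b : Fin N → ℂ) (l : Fin M → ℕ) : ℂ :=
  kWeight q x α r s l * ∏ j, kFactor q x α (b j) l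

/-- The weight of the telescoping terms in the three-term relation. -/
def fluxWeight (q : ℂ) {M : ℕ} (x : Fin M → ℂ) (α r s : ℂ) (l : Fin M → ℕ) : ℂ :=
  q ^ (∑ i, l i) * (q ^ 2 / (r * s)) * (q ^ 2 / (r * s * ∏ i, x i)) ^ (∑ i, l i)
    * (vandermondeProd (fun i => x i * q ^ l i) / vandermondeProd x)
    / (∏ i, ∏ j, qPoch q (q * x i / x j) (l i))
    * (∏ i, qPoch q (α * x i) (∑ m, l m + 1))
    * (qPoch q (α * s) (∑ m, l m + 1) * qPoch q (α * r) (∑ m, l m + 1))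
    * ∏ i, (qInf q (q * (x i * q ^ l i) / r) * qInf q (q * (x i * q ^ l i) / s))

/-- The Lagrange weights at the nodes `x_i q^(l_i)`. -/
def nodeWeight (q : ℂ) {M : ℕ} (x : Fin M → ℂ) (α : ℂ) (l : Fin M → ℕ) (i : Fin M) : ℂ :=
  ∏ k ∈ Finset.univ.erase i,
    (1 - α * q ^ (∑ m, l m + 1) * (x k * q ^ l k)) / (x k * q ^ l k - x i * q ^ l i)

lemma prod_update_succ {M : ℕ} (g : Fin M → ℕ → ℂ) (m : Fin M → ℕ) (i : Fin M) :
    ∏ k, g k (Function.update m i (m i + 1) k)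
      = g i (m i + 1) * ∏ k ∈ Finset.univ.erase i, g k (m k) := by
  rw [← Finset.mul_prod_erase _ _ (Finset.mem_univ i), Function.update_self]
  congr 1
  exact Finset.prod_congr rfl fun k hk => by
    rw [Function.update_of_ne (Finset.ne_of_mem_erase hk)]

lemma sum_update_succ {M : ℕ} (m : Fin M → ℕ) (i : Fin M) :
    ∑ k, Function.update m i (m i + 1) k = ∑ k, m k + 1 := by
  rw [Finset.sum_update_of_mem (Finset.mem_univ i), ← Finset.add_sum_erase _ m (Finset.mem_univ i),
    Finset.sdiff_singleton_eq_erase]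
  ring

lemma kFactor_eq {q : ℂ} (hq : ‖q‖ < 1) {M : ℕ} (x : Fin M → ℂ) (α b : ℂ) (l : Fin M → ℕ) :
    kFactor q x α b l = (1 - α * q ^ (∑ i, l i + 1) * b) * kShift q x α b l := by
  rw [kFactor, kShift, qInf_eq_mul hq (α * q * b * q ^ (∑ i, l i))]
  ring_nf

/-- Compared with `kFactor_eq`, raising `m i` by one exchanges the factor `1 - α q^(|m|+1) b` for `b
- x_i q^(m_i)`. So `kShift` is common to a cell and all its upper neighbours. -/
lemma kFactor_update (q : ℂ) {M : ℕ} (x : Fin M → ℂ) (α b : ℂ) (m : Fin M → ℕ) (i : Fin M) :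
    kFactor q x α b (Function.update m i (m i + 1))
      = kShift q x α b m * (b - x i * q ^ m i) := by
  rw [kFactor, kShift, sum_update_succ, prod_update_succ (fun k n => shiftProd q b (x k) n),
    shiftProd_succ, ← Finset.mul_prod_erase _ (fun k => shiftProd q b (x k) (m k))
      (Finset.mem_univ i)]
  ring

section Local

variable (q : ℂ) {M : ℕ} (x : Fin M → ℂ) (l : Fin M → ℕ)

/-- The part of `kShift` common to the parameters `b` and `q b`. -/
def kReduced (α b : ℂ) : ℂ :=
  qInf q (α * q * b * q ^ (∑ i, l i + 1)) * ∏ k, shiftProd q b (x k) (l k - 1)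

/-- The last factor of each nonempty product is split off. Where `l k = 0`, the truncated `l k - 1`
is again `0` and nothing is split off, so only indices with `l k ≠ 0` give nodes. -/
lemma prod_shiftProd_eq (b : ℂ) : ∏ k, shiftProd q b (x k) (l k)
    = (∏ k, shiftProd q b (x k) (l k - 1)) *
      ∏ k with l k ≠ 0, (b - x k * q ^ (l k - 1)) := by
  rw [Finset.prod_filter, ← Finset.prod_mul_distrib]
  refine Finset.prod_congr rfl fun k _ => ?_
  rcases Nat.eq_zero_or_pos (l k) with h | h
  · simp [h]
  · obtain ⟨n, hn⟩ := Nat.exists_eq_succ_of_ne_zero h.ne'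
    simp [hn, shiftProd_succ]

lemma prod_shiftProd_mul_left (hq : q ≠ 0) (b : ℂ) : ∏ k, shiftProd q (q * b) (x k) (l k)
    = q ^ (∑ k, l k) * (∏ k, shiftProd q b (x k) (l k - 1)) *
      ∏ k with l k ≠ 0, (b - x k / q) := by
  rw [Finset.prod_filter, ← Finset.prod_pow_eq_pow_sum, ← Finset.prod_mul_distrib,
    ← Finset.prod_mul_distrib]
  refine Finset.prod_congr rfl fun k _ => ?_
  rcases Nat.eq_zero_or_pos (l k) with h | h
  · simp [h]
  · obtain ⟨n, hn⟩ := Nat.exists_eq_succ_of_ne_zero h.ne'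
    simp only [hn, Nat.succ_eq_add_one, shiftProd_mul_left hq, Nat.add_sub_cancel]
    simp
    ring

lemma kShift_eq (α b : ℂ) : kShift q x α b l
    = kReduced q x l α b * ∏ k with l k ≠ 0, (b - x k * q ^ (l k - 1)) := by
  rw [kShift, kReduced, prod_shiftProd_eq]; ring

lemma kFactor_mul_left (hq : q ≠ 0) (α b : ℂ) : kFactor q x α (q * b) l
    = q ^ (∑ k, l k) * kReduced q x l α b * ∏ k with l k ≠ 0, (b - x k / q) := by
  rw [kFactor, kReduced, prod_shiftProd_mul_left q x l hq,
    show α * q * (q * b) * q ^ (∑ i, l i) = α * q * b * q ^ (∑ i, l i + 1) by ring]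
  ring

end Local

open Polynomial in
-- This is `cyclic_sum_eq` with the node `ρ⁻¹` adjoined as `none`, multiplied by `ρ ^ 2`. Each `b -
-- ρ⁻¹` is rewritten as a multiple of `1 - ρ b`, the form in which it occurs in `kFactor_eq`.
lemma cyclic_sum_eq_of_extra_node {ι : Type*} [DecidableEq ι] (S : Finset ι) (v : ι → ℂ)
    (hv : Set.InjOn v S) {ρ : ℂ} (hρ : ρ ≠ 0) (hvρ : ∀ i ∈ S, ρ * v i ≠ 1)
    (A : ℂ[X]) (hA : A.natDegree ≤ S.card + 2) (b₁ b₂ b₃ : ℂ) :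
    (b₂ - b₃) * A.eval b₁ * ((1 - ρ * b₂) * ∏ i ∈ S, (b₂ - v i))
          * ((1 - ρ * b₃) * ∏ i ∈ S, (b₃ - v i))
      + (b₃ - b₁) * A.eval b₂ * ((1 - ρ * b₃) * ∏ i ∈ S, (b₃ - v i))
          * ((1 - ρ * b₁) * ∏ i ∈ S, (b₁ - v i))
      + (b₁ - b₂) * A.eval b₃ * ((1 - ρ * b₁) * ∏ i ∈ S, (b₁ - v i))
          * ((1 - ρ * b₂) * ∏ i ∈ S, (b₂ - v i))
    = -((b₁ - b₂) * (b₂ - b₃) * (b₃ - b₁)) *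
      (ρ ^ 2 * A.eval ρ⁻¹ / (∏ i ∈ S, (ρ⁻¹ - v i)) *
          ((∏ i ∈ S, (b₁ - v i)) * (∏ i ∈ S, (b₂ - v i)) * ∏ i ∈ S, (b₃ - v i))
        + ∑ i ∈ S, A.eval (v i) / ((1 - ρ * v i) * ∏ j ∈ S.erase i, (v i - v j)) *
          (((1 - ρ * b₁) * ∏ j ∈ S.erase i, (b₁ - v j)) *
            ((1 - ρ * b₂) * ∏ j ∈ S.erase i, (b₂ - v j)) *
            ((1 - ρ * b₃) * ∏ j ∈ S.erase i, (b₃ - v j)))) := by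
  have h := cyclic_sum_eq (Finset.insertNone S) (fun o : Option ι => o.elim ρ⁻¹ v) ?_ A
    (by rw [Finset.card_insertNone]; omega) b₁ b₂ b₃
  · have e1 : (Finset.insertNone S).erase none = S.map Function.Embedding.some := by
      ext o; cases o <;> simp
    have e2 : ∀ i, (Finset.insertNone S).erase (some i) = Finset.insertNone (S.erase i) := by
      intro i; ext o; cases o <;> simp
    simp only [Finset.sum_insertNone, Finset.prod_insertNone, e1, e2, Finset.prod_map,
      Function.Embedding.some_apply, Option.elim] at h
    have e3 : ∀ b, 1 - ρ * b = -ρ * (b - ρ⁻¹) := fun b => by field_simp; ring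
    simp only [e3]
    have e4 : ∀ i ∈ S, A.eval (v i) / ((-ρ * (v i - ρ⁻¹)) * ∏ j ∈ S.erase i, (v i - v j)) *
          (((-ρ * (b₁ - ρ⁻¹)) * ∏ j ∈ S.erase i, (b₁ - v j)) *
            ((-ρ * (b₂ - ρ⁻¹)) * ∏ j ∈ S.erase i, (b₂ - v j)) *
            ((-ρ * (b₃ - ρ⁻¹)) * ∏ j ∈ S.erase i, (b₃ - v j)))
        = ρ ^ 2 * (A.eval (v i) / ((v i - ρ⁻¹) * ∏ j ∈ S.erase i, (v i - v j)) *
          (((b₁ - ρ⁻¹) * ∏ j ∈ S.erase i, (b₁ - v j)) *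
            ((b₂ - ρ⁻¹) * ∏ j ∈ S.erase i, (b₂ - v j)) *
            ((b₃ - ρ⁻¹) * ∏ j ∈ S.erase i, (b₃ - v j)))) := by
      intro i _
      rw [mul_assoc (-ρ) (v i - ρ⁻¹), ← div_div]
      field_simp
    rw [Finset.sum_congr rfl e4, ← Finset.mul_sum]
    linear_combination ρ ^ 2 * h
  · intro o ho o' ho' hoo
    have e5 : ∀ i ∈ S, ρ⁻¹ ≠ v i := fun i hi h => hvρ i hi (by rw [← h, mul_inv_cancel₀ hρ])
    rw [Finset.mem_coe] at ho ho'
    rcases o with _ | i <;> rcases o' with _ | j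
    · rfl
    · exact absurd hoo (e5 j (by simpa using ho'))
    · exact absurd hoo.symm (e5 i (by simpa using ho))
    · exact congrArg some (hv (by simpa using ho) (by simpa using ho') hoo)

/-- The conditions on the variables `x` under which Kajihara's series is defined. -/
structure GenericNodes (q : ℂ) {M : ℕ} (x : Fin M → ℂ) : Prop where
  ne_zero : ∀ i, x i ≠ 0
  injective : Function.Injective x
  noZero : ∀ i j, NoZeroFactor q (q * x i / x j)

/-- For equal exponents this is injectivity; for different ones a coincidence would make some `(q
x_j / x_i) q^d` equal to `1`. It keeps the interpolation nodes distinct. -/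
lemma GenericNodes.mul_pow_ne {q : ℂ} (hq : q ≠ 0) {M : ℕ} {x : Fin M → ℂ}
    (hx : GenericNodes q x) {i j : Fin M} (hij : i ≠ j) (m n : ℕ) :
    x i * q ^ m ≠ x j * q ^ n := by
  have key : ∀ i j : Fin M, ∀ m d : ℕ, x i * q ^ m ≠ x j * q ^ (m + d + 1) := by
    intro i j m d h
    apply hx.noZero j i d
    have hi := hx.ne_zero i
    have h1 : x i = x j * q ^ (d + 1) := by
      apply mul_right_cancel₀ (pow_ne_zero m hq)
      rw [h]; ring
    rw [div_mul_eq_mul_div, div_eq_one_iff_eq hi, h1]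
    ring
  rcases lt_trichotomy m n with h | h | h
  · obtain ⟨d, rfl⟩ := Nat.exists_eq_add_of_lt h
    exact key i j m d
  · subst h
    exact fun h => hij (hx.injective (mul_right_cancel₀ (pow_ne_zero m hq) h))
  · obtain ⟨d, rfl⟩ := Nat.exists_eq_add_of_lt h
    exact (key j i n d).symm

lemma GenericNodes.prod_ne_zero {q : ℂ} {M : ℕ} {x : Fin M → ℂ} (hx : GenericNodes q x) :
    ∏ i, x i ≠ 0 := Finset.prod_ne_zero_iff.2 fun i _ => hx.ne_zero i

lemma GenericNodes.prod_qPoch_ne_zero {q : ℂ} {M : ℕ} {x : Fin M → ℂ} (hx : GenericNodes q x)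
    (l : Fin M → ℕ) : ∏ i, ∏ j, qPoch q (q * x i / x j) (l i) ≠ 0 :=
  Finset.prod_ne_zero_iff.2 fun i _ => Finset.prod_ne_zero_iff.2 fun j _ =>
    qPoch_ne_zero (hx.noZero i j) _

/-- The residue at the extra node `ρ⁻¹`. The quotient of nodal products there turns the
very-well-poised factors `1 - α x_k q^(|l| + l_k)` into `1 - α x_k q^|l|`, which lengthen each `(α
x_k)_|l|` by one factor. The two factors with `r` and `s` do the same for `(α s)_|l|` and `(α
r)_|l|`. -/
lemma kWeight_mul_eq_fluxWeight {q : ℂ} (hq0 : q ≠ 0) {M : ℕ} {x : Fin M → ℂ}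
    {α r s : ℂ} (hα : α ≠ 0) (hr : r ≠ 0) (hs : s ≠ 0)
    (hαx : ∀ i, NoZeroFactor q (α * x i)) (l : Fin M → ℕ) {ρ : ℂ}
    (hρ : ρ = α * q ^ (∑ i, l i + 1)) :
    kWeight q x α r s l * (q ^ (∑ i, l i) * (ρ ^ 2 *
        ((1 - q * ρ⁻¹ / r) * (1 - q * ρ⁻¹ / s) * ∏ k with l k ≠ 0, (ρ⁻¹ - x k / q)) /
          ∏ k with l k ≠ 0, (ρ⁻¹ - x k * q ^ (l k - 1))))
      = fluxWeight q x α r s l := by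
  have hρ0 : ρ ≠ 0 := by rw [hρ]; exact mul_ne_zero hα (pow_ne_zero _ hq0)
  have hne : ∀ k, 1 - α * x k * q ^ (∑ m, l m + l k) ≠ 0 := fun k =>
    sub_ne_zero.2 (hαx k _).symm
  have h1 : (∏ k with l k ≠ 0, (ρ⁻¹ - x k / q)) / (∏ k with l k ≠ 0, (ρ⁻¹ - x k * q ^ (l k - 1)))
      = (∏ k, (1 - α * x k * q ^ (∑ m, l m)))
        / ∏ k, (1 - α * x k * q ^ (∑ m, l m + l k)) := by
    rw [← Finset.prod_div_distrib, ← Finset.prod_div_distrib, Finset.prod_filter]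
    refine Finset.prod_congr rfl fun k _ => ?_
    rcases Nat.eq_zero_or_pos (l k) with h | h
    · have := hne k
      rw [h, add_zero] at this
      simp [h, div_self this]
    · rw [if_pos h.ne']
      have e1 : ρ⁻¹ - x k / q = ρ⁻¹ * (1 - α * x k * q ^ (∑ m, l m)) := by
        rw [mul_sub, mul_one]
        congr 1
        rw [hρ] at hρ0 ⊢
        field_simp
        ring
      have e2 : ρ⁻¹ - x k * q ^ (l k - 1) = ρ⁻¹ * (1 - α * x k * q ^ (∑ m, l m + l k)) := by
        rw [mul_sub, mul_one]
        congr 1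
        obtain ⟨n, hn⟩ := Nat.exists_eq_succ_of_ne_zero h.ne'
        rw [hρ] at hρ0 ⊢
        rw [show l k - 1 = n by omega, show ∑ m, l m + l k = (∑ m, l m + 1) + n by omega]
        field_simp
        ring
      rw [e1, e2, mul_div_mul_left _ _ (inv_ne_zero hρ0)]
  have h2 : ρ ^ 2 * ((1 - q * ρ⁻¹ / r) * (1 - q * ρ⁻¹ / s))
      = q ^ 2 / (r * s) * ((1 - α * s * q ^ (∑ m, l m)) * (1 - α * r * q ^ (∑ m, l m))) := by
    have hw : α * q ^ (∑ i, l i) ≠ 0 := mul_ne_zero hα (pow_ne_zero _ hq0)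
    have hρw : ρ = q * (α * q ^ (∑ i, l i)) := by rw [hρ]; ring
    rw [mul_right_comm α s, mul_right_comm α r, hρw]
    generalize α * q ^ (∑ i, l i) = w at hw
    field_simp
    ring
  have h3 : ∏ k, (1 - α * x k * q ^ (∑ m, l m + l k)) ≠ 0 :=
    Finset.prod_ne_zero_iff.2 fun k _ => hne k
  rw [← mul_assoc (ρ ^ 2), mul_div_assoc, h2, h1, kWeight, fluxWeight]
  simp only [qPoch_succ, Finset.prod_mul_distrib (f := fun i => qPoch q (α * x i) (∑ m, l m))]
  generalize ∏ k, (1 - α * x k * q ^ (∑ m, l m + l k)) = A at h3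
  generalize ∏ k, (1 - α * x k * q ^ (∑ m, l m)) = B
  generalize ∏ i, (qInf q (q * (x i * q ^ l i) / r) * qInf q (q * (x i * q ^ l i) / s)) = C
  generalize (∏ i, ∏ j, qPoch q (q * x i / x j) (l i)) = D
  generalize vandermondeProd (fun i => x i * q ^ l i) / vandermondeProd x = V
  generalize ∏ i, qPoch q (α * x i) (∑ m, l m) = P
  generalize q ^ 2 / (r * s) = c
  have hAA : A * (B / A) = B := mul_div_cancel₀ _ h3
  linear_combination (q ^ 2 / (r * s * ∏ i, x i)) ^ (∑ i, l i) * V / D * P *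
    (qPoch q (α * s) (∑ m, l m) * qPoch q (α * r) (∑ m, l m)) * C * q ^ (∑ i, l i) * c *
    ((1 - α * s * q ^ (∑ m, l m)) * (1 - α * r * q ^ (∑ m, l m))) * hAA

/-- The residue at the node `x_i q^(l_i - 1)`, expressed through the lower neighbour `m = l - e_i`.
Every ingredient of the weight at `l` is compared with its value at `m`; only factors involving the
index `i` or the total `|l|` differ. -/
lemma kWeight_update_mul_eq {q : ℂ} (hq : ‖q‖ < 1) (hq0 : q ≠ 0) {M : ℕ} {x : Fin M → ℂ}
    (hx : GenericNodes q x) {α r s : ℂ} (hr : r ≠ 0) (hs : s ≠ 0)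
    (hαx : ∀ i, NoZeroFactor q (α * x i)) (m l : Fin M → ℕ) (i : Fin M)
    (hl : l = Function.update m i (m i + 1)) :
    kWeight q x α r s l * (q ^ (∑ k, l k) *
        (((1 - q * (x i * q ^ (l i - 1)) / r) * (1 - q * (x i * q ^ (l i - 1)) / s) *
          ∏ k with l k ≠ 0, (x i * q ^ (l i - 1) - x k / q)) /
          ((1 - α * q ^ (∑ k, l k + 1) * (x i * q ^ (l i - 1))) *
            ∏ k ∈ (Finset.univ.filter fun k => l k ≠ 0).erase i,
              (x i * q ^ (l i - 1) - x k * q ^ (l k - 1)))))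
      = -(fluxWeight q x α r s m * nodeWeight q x α m i) := by
  have hli : l i = m i + 1 := by rw [hl, Function.update_self]
  have hlk : ∀ k ∈ Finset.univ.erase i, l k = m k := fun k hk => by
    rw [hl, Function.update_of_ne (Finset.ne_of_mem_erase hk)]
  have hsum : ∑ k, l k = ∑ k, m k + 1 := by rw [hl, sum_update_succ]
  have hpr : ∀ g : Fin M → ℕ → ℂ, ∏ k, g k (l k)
      = g i (m i + 1) * ∏ k ∈ Finset.univ.erase i, g k (m k) := fun g => by
    rw [hl, prod_update_succ]
  rw [hli, Nat.add_sub_cancel]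
  set Y := x i * q ^ m i with hY
  have hmemi : i ∈ Finset.univ.filter fun k => l k ≠ 0 := by simp [hli]
  -- the products over the nodes
  have h1 : (∏ k with l k ≠ 0, (Y - x k / q)) /
      (∏ k ∈ (Finset.univ.filter fun k => l k ≠ 0).erase i, (Y - x k * q ^ (l k - 1)))
      = (Y - x i / q) * ((∏ k ∈ Finset.univ.erase i, (x k - q * Y)) /
        ∏ k ∈ Finset.univ.erase i, (x k * q ^ m k - q * Y)) := by
    rw [← Finset.mul_prod_erase _ _ hmemi, mul_div_assoc, ← Finset.prod_div_distrib,
      ← Finset.prod_div_distrib]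
    congr 1
    rw [← Finset.filter_ne', ← Finset.filter_ne', Finset.filter_filter, Finset.prod_filter,
      Finset.prod_filter]
    refine Finset.prod_congr rfl fun k _ => ?_
    by_cases hk : k = i
    · simp [hk]
    have hlk' := hlk k (by simp [hk])
    rcases Nat.eq_zero_or_pos (m k) with h | h
    · have : x k - q * Y ≠ 0 := sub_ne_zero.2 fun h => by
        apply hx.mul_pow_ne hq0 hk 0 (m i + 1)
        rw [pow_zero, mul_one, h, hY]
        ring
      simp [hk, hlk', h, div_self this]
    · obtain ⟨n, hn⟩ := Nat.exists_eq_succ_of_ne_zero h.ne'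
      simp only [ne_eq, hlk', not_false_eq_true, hk, hn, Nat.succ_eq_add_one, Nat.add_sub_cancel]
      rw [if_pos ⟨Nat.succ_ne_zero n, trivial⟩, if_pos trivial]
      have e : Y - x k / q = -(x k - q * Y) / q := by field_simp; ring
      have e' : Y - x k * q ^ n = -(x k * q ^ (n + 1) - q * Y) / q := by field_simp; ring
      rw [e, e', div_div_div_cancel_right₀ hq0, neg_div_neg_eq]
  have hP1 : ∏ k ∈ Finset.univ.erase i, (x k * q ^ m k - q * Y) ≠ 0 :=
    Finset.prod_ne_zero_iff.2 fun k hk => sub_ne_zero.2 fun h =>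
      hx.mul_pow_ne hq0 (Finset.ne_of_mem_erase hk) (m k) (m i + 1) (by rw [h, hY]; ring)
  have hP2 : ∏ k ∈ Finset.univ.erase i, (x k * q ^ m k - Y) ≠ 0 :=
    Finset.prod_ne_zero_iff.2 fun k hk => sub_ne_zero.2
      (hx.mul_pow_ne hq0 (Finset.ne_of_mem_erase hk) (m k) (m i))
  -- Passing from `m` to `l` multiplies only the `i`-th entry, by `q`, so the cofactor is unchanged.
  have hV : vandermondeProd (fun k => x k * q ^ l k)
      = (∏ k ∈ Finset.univ.erase i, (x k * q ^ m k - q * Y)) *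
        vandermondeCofactor (fun k => x k * q ^ m k) i := by
    have : (fun k => x k * q ^ l k) = Function.update (fun k => x k * q ^ m k) i (q * Y) := by
      funext k
      by_cases hk : k = i
      · subst hk; rw [Function.update_self, hli, hY]; ring
      · rw [Function.update_of_ne hk, hlk k (by simp [hk])]
    rw [vandermondeProd_eq_mul_cofactor _ i, this, vandermondeCofactor_update]
    congr 1
    exact Finset.prod_congr rfl fun k hk => by rw [hlk k hk, hli, hY]; ring
  have hF : ∏ k, ∏ j, qPoch q (q * x k / x j) (l k)
      = (∏ k, ∏ j, qPoch q (q * x k / x j) (m k)) *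
        (((x i - q * Y) * ∏ k ∈ Finset.univ.erase i, (x k - q * Y)) / ∏ k, x k) := by
    rw [hpr (fun k n => ∏ j, qPoch q (q * x k / x j) n),
      ← Finset.mul_prod_erase _ (fun k => ∏ j, qPoch q (q * x k / x j) (m k)) (Finset.mem_univ i),
      Finset.mul_prod_erase _ (fun k => x k - q * Y) (Finset.mem_univ i), ← Finset.prod_div_distrib]
    simp only [qPoch_succ, Finset.prod_mul_distrib]
    have : ∀ j, 1 - q * x i / x j * q ^ m i = (x j - q * Y) / x j := fun j => by
      have := hx.ne_zero j
      rw [hY]; field_simp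
    simp only [this]
    ring
  have hA : ∏ k, (1 - α * x k * q ^ (∑ j, l j + l k))
      = (1 - α * q ^ (∑ k, m k + 1 + 1) * Y) *
        ∏ k ∈ Finset.univ.erase i, (1 - α * q ^ (∑ k, m k + 1) * (x k * q ^ m k)) := by
    rw [hpr (fun k n => 1 - α * x k * q ^ (∑ j, l j + n)), hsum]
    congr 1
    · rw [hY]; ring
    · exact Finset.prod_congr rfl fun k _ => by ring
  have hA0 : 1 - α * q ^ (∑ k, m k + 1 + 1) * Y ≠ 0 := by
    have := hαx i (∑ k, m k + 1 + 1 + m i)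
    refine sub_ne_zero.2 fun h => this ?_
    rw [h, hY]; ring
  have hI : (∏ k, (qInf q (q * (x k * q ^ l k) / r) * qInf q (q * (x k * q ^ l k) / s)))
        * ((1 - q * Y / r) * (1 - q * Y / s))
      = ∏ k, (qInf q (q * (x k * q ^ m k) / r) * qInf q (q * (x k * q ^ m k) / s)) := by
    rw [hpr (fun k n => qInf q (q * (x k * q ^ n) / r) * qInf q (q * (x k * q ^ n) / s)),
      ← Finset.mul_prod_erase _ (fun k => qInf q (q * (x k * q ^ m k) / r) *
        qInf q (q * (x k * q ^ m k) / s)) (Finset.mem_univ i), ← hY,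
      qInf_eq_mul hq (q * Y / r), qInf_eq_mul hq (q * Y / s),
      show q * (x i * q ^ (m i + 1)) / r = q * Y / r * q by rw [hY]; ring,
      show q * (x i * q ^ (m i + 1)) / s = q * Y / s * q by rw [hY]; ring]
    ring
  have hxi : x i - q * Y ≠ 0 := by
    have h := hx.noZero i i (m i)
    refine sub_ne_zero.2 fun h' => h ?_
    have := hx.ne_zero i
    rw [hY] at h'
    field_simp
    apply mul_left_cancel₀ this
    linear_combination -h'
  have hP3 : ∏ k ∈ Finset.univ.erase i, (x k - q * Y) ≠ 0 :=
    Finset.prod_ne_zero_iff.2 fun k hk => sub_ne_zero.2 fun h =>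
      hx.mul_pow_ne hq0 (Finset.ne_of_mem_erase hk) 0 (m i + 1)
        (by rw [pow_zero, mul_one, h, hY]; ring)
  have hF0 := hx.prod_qPoch_ne_zero m
  have hx0 := hx.prod_ne_zero
  have hV0 := vandermondeProd_ne_zero hx.injective
  have hYi : Y - x i / q = -(x i - q * Y) / q := by field_simp; ring
  rw [kWeight, fluxWeight, nodeWeight, hV, hF, hA, hsum, Finset.prod_div_distrib, ← hI,
    vandermondeProd_eq_mul_cofactor (fun k => x k * q ^ m k) i, ← hY,
    mul_div_mul_comm ((1 - q * Y / r) * (1 - q * Y / s)),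
    h1, hYi,
    pow_succ (q ^ 2 / _)]
  generalize ∏ k ∈ Finset.univ.erase i, (x k * q ^ m k - q * Y) = P₁ at *
  generalize ∏ k ∈ Finset.univ.erase i, (x k * q ^ m k - Y) = P₂ at *
  generalize ∏ k ∈ Finset.univ.erase i, (x k - q * Y) = P₃ at *
  generalize vandermondeCofactor (fun k => x k * q ^ m k) i = V
  generalize ∏ k, (qInf q (q * (x k * q ^ l k) / r) * qInf q (q * (x k * q ^ l k) / s)) = I
  generalize ∏ k, ∏ j, qPoch q (q * x k / x j) (m k) = F at *
  generalize vandermondeProd x = D at *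
  generalize 1 - α * q ^ (∑ k, m k + 1 + 1) * Y = A at *
  generalize (q ^ 2 / (r * s * ∏ i, x i)) ^ (∑ k, m k) = Z
  generalize ∏ i, x i = X at *
  generalize (1 - q * Y / r) = θ₁
  generalize (1 - q * Y / s) = θ₂
  generalize x i - q * Y = y at *
  generalize ∏ k ∈ Finset.univ.erase i, (1 - α * q ^ (∑ k, m k + 1) * (x k * q ^ m k)) = R
  generalize ∏ i, qPoch q (α * x i) (∑ k, m k + 1) = Q
  generalize qPoch q (α * s) (∑ k, m k + 1) * qPoch q (α * r) (∑ k, m k + 1) = T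
  field_simp
  ring

/-! ### Uniform bounds and convergence of the Kajihara series. -/

/-- The function `f` is bounded in norm on `S`. -/
def BddOn {T : Type*} (S : Set T) (f : T → ℂ) : Prop := ∃ C : ℝ, ∀ t ∈ S, ‖f t‖ ≤ C

namespace BddOn

variable {T : Type*} {S : Set T} {f g : T → ℂ}

lemma const (c : ℂ) : BddOn S fun _ => c := ⟨‖c‖, fun _ _ => le_rfl⟩

lemma mul (hf : BddOn S f) (hg : BddOn S g) : BddOn S fun t => f t * g t := by
  obtain ⟨C, hC⟩ := hf
  obtain ⟨D, hD⟩ := hg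
  refine ⟨C * D, fun t ht => ?_⟩
  rw [norm_mul]
  exact mul_le_mul (hC t ht) (hD t ht) (norm_nonneg _) ((norm_nonneg _).trans (hC t ht))

lemma sub (hf : BddOn S f) (hg : BddOn S g) : BddOn S fun t => f t - g t := by
  obtain ⟨C, hC⟩ := hf
  obtain ⟨D, hD⟩ := hg
  exact ⟨C + D, fun t ht => (norm_sub_le _ _).trans (add_le_add (hC t ht) (hD t ht))⟩

lemma div_const (hf : BddOn S f) (c : ℂ) : BddOn S fun t => f t / c := by
  simpa only [div_eq_mul_inv] using hf.mul (const c⁻¹)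

lemma prod {ι : Type*} {s : Finset ι} {F : ι → T → ℂ} (hF : ∀ i ∈ s, BddOn S (F i)) :
    BddOn S fun t => ∏ i ∈ s, F i t := by
  classical
  induction s using Finset.induction_on with
  | empty => simpa using const 1
  | insert i s hi ih =>
    simp only [Finset.prod_insert hi]
    exact (hF i (Finset.mem_insert_self _ _)).mul
      (ih fun j hj => hF j (Finset.mem_insert_of_mem hj))

lemma pow_of_norm_le_one {q : ℂ} (hq : ‖q‖ ≤ 1) (n : T → ℕ) : BddOn S fun t => q ^ n t :=
  ⟨1, fun t _ => by rw [norm_pow]; exact pow_le_one₀ (norm_nonneg _) hq⟩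

lemma qInf {q : ℂ} (hq : ‖q‖ < 1) (hf : BddOn S f) : BddOn S fun t => qInf q (f t) := by
  obtain ⟨C, hC⟩ := hf
  have h1 : 0 < 1 - ‖q‖ := sub_pos.2 hq
  refine ⟨Real.exp (C / (1 - ‖q‖)), fun t ht => (norm_qInf_le hq _).trans ?_⟩
  have := hC t ht
  gcongr

lemma qPoch {q : ℂ} (hq : ‖q‖ < 1) (hf : BddOn S f) (n : T → ℕ) :
    BddOn S fun t => qPoch q (f t) (n t) := by
  obtain ⟨C, hC⟩ := hf
  have h1 : 0 < 1 - ‖q‖ := sub_pos.2 hq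
  refine ⟨Real.exp (C / (1 - ‖q‖)), fun t ht => (norm_qPoch_le hq _ _).trans ?_⟩
  have := hC t ht
  gcongr

lemma inv_qPoch {q a : ℂ} (hq : ‖q‖ < 1) (ha : NoZeroFactor q a) (n : T → ℕ) :
    BddOn S fun t => (QSeries.qPoch q a (n t))⁻¹ := by
  obtain ⟨C, hC⟩ := exists_norm_inv_qPoch_le hq ha
  exact ⟨C, fun t _ => hC _⟩

lemma shiftProd_div {q : ℂ} (hq : ‖q‖ < 1) {ρ : ℝ} (hρ : 0 < ρ) (hf : ∀ t ∈ S, ‖f t‖ ≤ ρ) (x : ℂ)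
    (n : T → ℕ) : BddOn S fun t => shiftProd q (f t) x (n t) / (ρ : ℂ) ^ n t := by
  refine ⟨Real.exp (‖x‖ / ρ / (1 - ‖q‖)), fun t ht => ?_⟩
  rw [norm_div, norm_pow, Complex.norm_real, Real.norm_of_nonneg hρ.le,
    div_le_iff₀ (pow_pos hρ _), mul_comm]
  exact norm_shiftProd_le hq hρ (hf t ht) le_rfl _

end BddOn

section

variable {q : ℂ} (hq : ‖q‖ < 1) {M : ℕ} {x : Fin M → ℂ} {T : Type*} {S : Set T} {α : T → ℂ}
  (hα : BddOn S α) (l : T → Fin M → ℕ)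
include hq

lemma bddOn_mul_pow (c : ℂ) (n : T → ℕ) : BddOn S fun t => c * q ^ n t :=
  (BddOn.const c).mul (BddOn.pow_of_norm_le_one hq.le n)

lemma bddOn_inv_prod_qPoch (hx : GenericNodes q x) :
    BddOn S fun t => (∏ i, ∏ j, qPoch q (q * x i / x j) (l t i))⁻¹ := by
  simp only [← Finset.prod_inv_distrib]
  exact BddOn.prod fun i _ => BddOn.prod fun j _ => BddOn.inv_qPoch hq (hx.noZero i j) _

lemma bddOn_vandermondeProd : BddOn S fun t => vandermondeProd fun i => x i * q ^ l t i :=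
  BddOn.prod fun _ _ => BddOn.prod fun _ _ =>
    (bddOn_mul_pow hq _ _).sub (bddOn_mul_pow hq _ _)

lemma bddOn_vandermondeCofactor (i : Fin M) :
    BddOn S fun t => vandermondeCofactor (fun i => x i * q ^ l t i) i :=
  (BddOn.const _).mul (BddOn.prod fun _ _ => BddOn.prod fun _ _ =>
    (bddOn_mul_pow hq _ _).sub (bddOn_mul_pow hq _ _))

lemma bddOn_prod_qInf_mul_qInf (r s : ℂ) : BddOn S fun t =>
    ∏ i, (qInf q (q * (x i * q ^ l t i) / r) * qInf q (q * (x i * q ^ l t i) / s)) := by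
  refine BddOn.prod fun i _ => BddOn.mul ?_ ?_ <;>
  exact (((BddOn.const q).mul (bddOn_mul_pow hq _ _)).div_const _).qInf hq

include hα

lemma bddOn_kWeight_div (hx : GenericNodes q x) (r s : ℂ) : BddOn S fun t =>
    (vandermondeProd (fun i => x i * q ^ l t i) / vandermondeProd x)
    / (∏ i, ∏ j, qPoch q (q * x i / x j) (l t i))
    * (∏ i, (1 - α t * x i * q ^ (∑ m, l t m + l t i))) * (∏ i, qPoch q (α t * x i) (∑ m, l t m))
    * (qPoch q (α t * s) (∑ m, l t m) * qPoch q (α t * r) (∑ m, l t m))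
    * ∏ i, (qInf q (q * (x i * q ^ l t i) / r) * qInf q (q * (x i * q ^ l t i) / s)) := by
  refine BddOn.mul (BddOn.mul (BddOn.mul (BddOn.mul ?_ ?_) ?_) (BddOn.mul ?_ ?_))
    (bddOn_prod_qInf_mul_qInf hq l r s)
  · simp only [div_eq_mul_inv _ (∏ i, _)]
    exact ((bddOn_vandermondeProd hq l).div_const _).mul (bddOn_inv_prod_qPoch hq l hx)
  · exact BddOn.prod fun i _ => (BddOn.const 1).sub
      ((hα.mul (BddOn.const _)).mul (BddOn.pow_of_norm_le_one hq.le _))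
  · exact BddOn.prod fun i _ => (hα.mul (BddOn.const _)).qPoch hq _
  · exact (hα.mul (BddOn.const _)).qPoch hq _
  · exact (hα.mul (BddOn.const _)).qPoch hq _

lemma bddOn_qInf_mul_prod_div {ρ : ℝ} (hρ : 0 < ρ) {b : T → ℂ} (hb : ∀ t ∈ S, ‖b t‖ ≤ ρ)
    (n : T → ℕ) : BddOn S fun t =>
      qInf q (α t * q * b t * q ^ n t) * (∏ i, shiftProd q (b t) (x i) (l t i))
        / (ρ : ℂ) ^ (∑ i, l t i) := by
  simp only [mul_div_assoc, ← Finset.prod_pow_eq_pow_sum, ← Finset.prod_div_distrib]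
  exact ((((hα.mul (BddOn.const q)).mul ⟨ρ, hb⟩).mul
    (BddOn.pow_of_norm_le_one hq.le n)).qInf hq).mul
    (BddOn.prod fun i _ => BddOn.shiftProd_div hq hρ hb _ _)

end

/-- Each `kFactor` grows at most like `(ρ j)^|l|`, and what remains of the term besides its explicit
`|l|`-th power is bounded. The constant is uniform in `α` and `b`, as analytic dependence on the
parameters requires. -/
lemma exists_kTerm_bound {q : ℂ} (hq : ‖q‖ < 1) {M N : ℕ} {x : Fin M → ℂ} (hx : GenericNodes q x)
    (r s : ℂ) (K : ℝ) (ρ : Fin N → ℝ) (hρ : ∀ j, 0 < ρ j) :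
    ∃ C : ℝ, ∀ (l : Fin M → ℕ) (α : ℂ) (b : Fin N → ℂ), ‖α‖ ≤ K → (∀ j, ‖b j‖ ≤ ρ j) →
      ‖kTerm q x α r s b l‖ ≤
        C * (‖q ^ 2 / (r * s * ∏ i, x i)‖ * ∏ j, ρ j) ^ (∑ i, l i) := by
  -- Bundling the index with the parameters makes boundedness on `S` the required uniformity.
  let S : Set ((Fin M → ℕ) × ℂ × (Fin N → ℂ)) := {t | ‖t.2.1‖ ≤ K ∧ ∀ j, ‖t.2.2 j‖ ≤ ρ j}
  have hα : BddOn S fun t => t.2.1 := ⟨K, fun t ht => ht.1⟩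
  obtain ⟨C, hC⟩ := (bddOn_kWeight_div hq hα (fun t => t.1) hx r s).mul
    (BddOn.prod (s := Finset.univ) fun j _ => bddOn_qInf_mul_prod_div hq (x := x) hα (fun t => t.1)
      (hρ j) (b := fun t => t.2.2 j) (fun t ht => ht.2 j) (fun t => ∑ i, t.1 i))
  refine ⟨C, fun l α b hα hb => ?_⟩
  have h := hC (l, α, b) ⟨hα, hb⟩
  have hP : 0 < ∏ j, ρ j := Finset.prod_pos fun j _ => hρ j
  have hP' : ‖∏ j, (ρ j : ℂ)‖ = ∏ j, ρ j := by
    rw [← Complex.ofReal_prod, Complex.norm_real, Real.norm_of_nonneg hP.le]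
  have e : kTerm q x α r s b l = (q ^ 2 / (r * s * ∏ i, x i) * ∏ j, (ρ j : ℂ)) ^ (∑ i, l i) *
      (((vandermondeProd (fun i => x i * q ^ l i) / vandermondeProd x)
    / (∏ i, ∏ j, qPoch q (q * x i / x j) (l i))
    * (∏ i, (1 - α * x i * q ^ (∑ m, l m + l i))) * (∏ i, qPoch q (α * x i) (∑ m, l m))
    * (qPoch q (α * s) (∑ m, l m) * qPoch q (α * r) (∑ m, l m))
    * ∏ i, (qInf q (q * (x i * q ^ l i) / r) * qInf q (q * (x i * q ^ l i) / s))) *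
      ∏ j, (qInf q (α * q * b j * q ^ (∑ i, l i)) * (∏ i, shiftProd q (b j) (x i) (l i))
        / (ρ j : ℂ) ^ (∑ i, l i))) := by
    have hP0 : (∏ j, (ρ j : ℂ)) ≠ 0 := by
      rw [← norm_ne_zero_iff, hP']; exact hP.ne'
    rw [Finset.prod_div_distrib, Finset.prod_pow, mul_pow, kTerm, kWeight]
    have hF : ∏ j, kFactor q x α (b j) l = (∏ j, (ρ j : ℂ)) ^ (∑ i, l i) *
        ((∏ j, qInf q (α * q * b j * q ^ (∑ i, l i)) * ∏ i, shiftProd q (b j) (x i) (l i)) /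
          (∏ j, (ρ j : ℂ)) ^ (∑ i, l i)) := (mul_div_cancel₀ _ (pow_ne_zero _ hP0)).symm
    rw [hF]
    generalize (∏ j, qInf q (α * q * b j * q ^ (∑ i, l i)) * ∏ i, shiftProd q (b j) (x i) (l i)) /
          (∏ j, (ρ j : ℂ)) ^ (∑ i, l i) = F
    generalize (∏ j, (ρ j : ℂ)) ^ (∑ i, l i) = P
    generalize ∏ i, (qInf q (q * (x i * q ^ l i) / r) * qInf q (q * (x i * q ^ l i) / s)) = I
    generalize ∏ i, (1 - α * x i * q ^ (∑ m, l m + l i)) = A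
    generalize ∏ i, qPoch q (α * x i) (∑ m, l m) = B
    ring
  rw [e, norm_mul, norm_pow, norm_mul, hP', mul_comm]
  exact mul_le_mul_of_nonneg_right h (by positivity)

/-- The strict inequality survives enlarging every radius by a small `ε`. This also makes the radii
positive when some `b₀ j` is zero, and gives one summable bound near `b₀`. -/
lemma exists_summable_kTerm_bound {q : ℂ} (hq : ‖q‖ < 1) {M N : ℕ} {x : Fin M → ℂ}
    (hx : GenericNodes q x) (r s : ℂ) (K : ℝ) (b₀ : Fin N → ℂ)
    (hb₀ : ‖q ^ 2 * (∏ j, b₀ j) / (r * s * ∏ i, x i)‖ < 1) :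
    ∃ (u : (Fin M → ℕ) → ℝ) (ε : ℝ), Summable u ∧ 0 < ε ∧
      ∀ (l : Fin M → ℕ) (α : ℂ) (b : Fin N → ℂ), ‖α‖ ≤ K → (∀ j, ‖b j‖ ≤ ‖b₀ j‖ + ε) →
      ‖kTerm q x α r s b l‖ ≤ u l := by
  have hcont : ContinuousAt (fun ε : ℝ =>
      ‖q ^ 2 / (r * s * ∏ i, x i)‖ * ∏ j, (‖b₀ j‖ + ε)) 0 := by fun_prop
  have h0 : (fun ε : ℝ => ‖q ^ 2 / (r * s * ∏ i, x i)‖ * ∏ j, (‖b₀ j‖ + ε)) 0 < 1 := by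
    simp only [add_zero, ← norm_prod, ← norm_mul]
    rwa [div_mul_eq_mul_div]
  obtain ⟨ε, hε, hε0⟩ := (((hcont.eventually_lt_const h0).filter_mono nhdsWithin_le_nhds).and
    (self_mem_nhdsWithin (s := Set.Ioi (0 : ℝ)))).exists
  have hε0 : 0 < ε := hε0
  obtain ⟨C, hC⟩ := exists_kTerm_bound hq hx r s K (fun j => ‖b₀ j‖ + ε)
    (fun j => by positivity)
  exact ⟨_, ε, (summable_pow_sum (by positivity) hε M).mul_left C, hε0, hC⟩

lemma summable_kTerm {q : ℂ} (hq : ‖q‖ < 1) {M N : ℕ} {x : Fin M → ℂ}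
    (hx : GenericNodes q x) (α r s : ℂ) (b : Fin N → ℂ)
    (hb : ‖q ^ 2 * (∏ j, b j) / (r * s * ∏ i, x i)‖ < 1) : Summable (kTerm q x α r s b) := by
  obtain ⟨u, ε, hu, hε, h⟩ := exists_summable_kTerm_bound hq hx r s ‖α‖ b hb
  exact Summable.of_norm_bounded hu fun l => h l α b le_rfl fun j => by linarith

/-! ### The three-term relation for the terms of the Kajihara series. -/

/-- The flux through the origin side of the cell `m`. -/
def fluxZero (q : ℂ) {M N : ℕ} (x : Fin M → ℂ) (α r s : ℂ) (d : Fin 3 → ℂ) (b : Fin N → ℂ)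
    (m : Fin M → ℕ) : ℂ :=
  fluxWeight q x α r s m * ((∏ j, kShift q x α (d j) m) * ∏ j, kShift q x α (b j) m) *
    ∏ j, (1 - α * q ^ (∑ i, m i + 1) * b j)

/-- The flux through the side of the cell `m` in direction `i`. -/
def fluxDir (q : ℂ) {M N : ℕ} (x : Fin M → ℂ) (α r s : ℂ) (d : Fin 3 → ℂ) (b : Fin N → ℂ)
    (i : Fin M) (m : Fin M → ℕ) : ℂ :=
  fluxWeight q x α r s m * nodeWeight q x α m i *
    ((∏ j, kShift q x α (d j) m) * ∏ j, kShift q x α (b j) m) * ∏ j, (b j - x i * q ^ m i)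

/-- Balance of the fluxes at a cell: `sum_prod_erase_eq` with nodes `x_k q^(m_k)` and `ρ = α
q^(|m|+1)`. The count matters here: `M + 1` variables against `M` unshifted parameters. -/
lemma sum_fluxDir {q : ℂ} (hq0 : q ≠ 0) {M : ℕ} {x : Fin (M + 1) → ℂ} (hx : GenericNodes q x)
    {α : ℂ} (hα : α ≠ 0) (r s : ℂ) (d : Fin 3 → ℂ) (b : Fin M → ℂ) (m : Fin (M + 1) → ℕ) :
    ∑ i, fluxDir q x α r s d b i m = fluxZero q x α r s d b m := by
  have h := sum_prod_erase_eq (ι := Fin (M + 1)) (κ := Fin M) (by simp)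
    (X := fun k => x k * q ^ m k)
    (fun i j h => by_contra fun hij => hx.mul_pow_ne hq0 hij _ _ h) b
    (mul_ne_zero hα (pow_ne_zero (∑ i, m i + 1) hq0))
  rw [fluxZero, ← h, Finset.mul_sum]
  refine Finset.sum_congr rfl fun i _ => ?_
  rw [fluxDir, nodeWeight]
  ring

/-- Once the factors common to the three terms are removed, the left side is the cyclic sum of
`cyclic_sum_eq_of_extra_node`. The extra node yields `fluxZero` at `l`, and the node of index `i`
yields `-fluxDir` at `l - e_i`. There is no such node when `l i = 0`, hence the condition in the
sum. -/
lemma kTerm_three_term {q : ℂ} (hq : ‖q‖ < 1) (hq0 : q ≠ 0) {M N : ℕ} {x : Fin M → ℂ}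
    (hx : GenericNodes q x) {α r s : ℂ} (hα : α ≠ 0) (hr : r ≠ 0) (hs : s ≠ 0)
    (hαx : ∀ i, NoZeroFactor q (α * x i)) (b : Fin N → ℂ) (b₁ b₂ b₃ : ℂ) (l : Fin M → ℕ) :
    (b₂ - b₃) * ((1 - q * b₁ / r) * (1 - q * b₁ / s)) *
        kTerm q x α r s (cons₃ (q * b₁) b₂ b₃ b) l
      + (b₃ - b₁) * ((1 - q * b₂ / r) * (1 - q * b₂ / s)) *
        kTerm q x α r s (cons₃ b₁ (q * b₂) b₃ b) l
      + (b₁ - b₂) * ((1 - q * b₃ / r) * (1 - q * b₃ / s)) *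
        kTerm q x α r s (cons₃ b₁ b₂ (q * b₃) b) l
      = -((b₁ - b₂) * (b₂ - b₃) * (b₃ - b₁)) * (fluxZero q x α r s ![b₁, b₂, b₃] b l
        - ∑ i, if l i ≠ 0 then
          fluxDir q x α r s ![b₁, b₂, b₃] b i (Function.update l i (l i - 1)) else 0) := by
  classical
  set S := Finset.univ.filter fun k => l k ≠ 0 with hS
  set ρ := α * q ^ (∑ i, l i + 1) with hρ
  have hρ0 : ρ ≠ 0 := mul_ne_zero hα (pow_ne_zero _ hq0)
  let v : Fin M → ℂ := fun k => x k * q ^ (l k - 1)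
  have hv : Set.InjOn v S := fun i _ j _ h => by_contra fun hij => hx.mul_pow_ne hq0 hij _ _ h
  have hvρ : ∀ i ∈ S, ρ * v i ≠ 1 := fun i _ h =>
    hαx i (∑ i, l i + 1 + (l i - 1)) (by rw [← h, hρ, pow_add]; ring)
  -- Chosen so that `A` at `b_k` is, up to a factor common with the unshifted term, the coefficient
  -- times `kFactor` at `q b_k`; see `hk2`.
  let A : Polynomial ℂ := (1 - Polynomial.C (q / r) * Polynomial.X) *
    (1 - Polynomial.C (q / s) * Polynomial.X) * Lagrange.nodal S fun k => x k / q
  have hA : A.natDegree ≤ S.card + 2 := by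
    have h1 : ∀ c : ℂ, (1 - Polynomial.C c * Polynomial.X).natDegree ≤ 1 := fun c => by
      compute_degree
    refine (Polynomial.natDegree_mul_le).trans ?_
    rw [Lagrange.natDegree_nodal, add_comm]
    exact Nat.add_le_add_left ((Polynomial.natDegree_mul_le).trans
      (Nat.add_le_add (h1 _) (h1 _))) _
  have hAe : ∀ y, A.eval y
      = (1 - q * y / r) * (1 - q * y / s) * ∏ k ∈ S, (y - x k / q) := fun y => by
    simp only [A, Polynomial.eval_mul, Polynomial.eval_sub, Polynomial.eval_one,
      Polynomial.eval_C, Polynomial.eval_X, Lagrange.eval_nodal]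
    ring
  have key := cyclic_sum_eq_of_extra_node S v hv hρ0 hvρ A hA b₁ b₂ b₃
  set R : ℂ → ℂ := fun y => kReduced q x l α y with hR
  have hk1 : ∀ y, kFactor q x α y l = R y * ((1 - ρ * y) * ∏ k ∈ S, (y - v k)) := fun y => by
    rw [kFactor_eq hq, kShift_eq]; ring
  have hk2 : ∀ y, (1 - q * y / r) * (1 - q * y / s) * kFactor q x α (q * y) l
      = q ^ (∑ k, l k) * (R y * A.eval y) := fun y => by
    rw [kFactor_mul_left q x l hq0, hAe]; ring
  set Q := ∏ j, kFactor q x α (b j) l with hQ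
  have hzero : fluxZero q x α r s ![b₁, b₂, b₃] b l = kWeight q x α r s l * Q *
      (q ^ (∑ k, l k) * (R b₁ * R b₂ * R b₃) * (ρ ^ 2 * A.eval ρ⁻¹ / (∏ i ∈ S, (ρ⁻¹ - v i)) *
          ((∏ i ∈ S, (b₁ - v i)) * (∏ i ∈ S, (b₂ - v i)) * ∏ i ∈ S, (b₃ - v i)))) := by
    rw [fluxZero, ← kWeight_mul_eq_fluxWeight hq0 hα hr hs hαx l hρ, hAe, hQ]
    simp only [Fin.prod_univ_three, Matrix.cons_val, kShift_eq q x l α b₁, kShift_eq q x l α b₂,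
      kShift_eq q x l α b₃, kFactor_eq hq, Finset.prod_mul_distrib]
    ring
  have hdir : ∀ i ∈ S, fluxDir q x α r s ![b₁, b₂, b₃] b i (Function.update l i (l i - 1))
      = -(kWeight q x α r s l * Q * (q ^ (∑ k, l k) * (R b₁ * R b₂ * R b₃) *
        (A.eval (v i) / ((1 - ρ * v i) * ∏ j ∈ S.erase i, (v i - v j)) *
          (((1 - ρ * b₁) * ∏ j ∈ S.erase i, (b₁ - v j)) *
            ((1 - ρ * b₂) * ∏ j ∈ S.erase i, (b₂ - v j)) *
            ((1 - ρ * b₃) * ∏ j ∈ S.erase i, (b₃ - v j)))))) := by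
    intro i hi
    set m := Function.update l i (l i - 1) with hm
    have hli : l i ≠ 0 := by simpa [hS] using hi
    have hl : l = Function.update m i (m i + 1) := by
      rw [hm, Function.update_self, Function.update_idem, Nat.sub_add_cancel (by omega),
        Function.update_eq_self]
    have hsum : ∑ k, l k = ∑ k, m k + 1 := by
      conv_lhs => rw [hl]
      exact sum_update_succ m i
    have hw := kWeight_update_mul_eq hq hq0 hx hr hs hαx m l i hl
    have hvi : v i = x i * q ^ m i := by rw [hm, Function.update_self]
    have hQm : Q = (∏ j, kShift q x α (b j) m) * ∏ j, (b j - x i * q ^ m i) := by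
      rw [hQ, ← Finset.prod_mul_distrib]
      refine Finset.prod_congr rfl fun j _ => ?_
      conv_lhs => rw [hl]
      exact kFactor_update q x α (b j) m i
    -- Since `|m| + 1 = |l|`, the infinite product in `kShift` at `m` starts one factor earlier than
    -- in `R`, which produces `1 - ρ y`.
    have hkm : ∀ y, kShift q x α y m = R y * ((1 - ρ * y) * ∏ j ∈ S.erase i, (y - v j)) := by
      intro y
      have h1 : ∏ k, shiftProd q y (x k) (m k)
          = (∏ k, shiftProd q y (x k) (l k - 1)) * ∏ j ∈ S.erase i, (y - v j) := by
        rw [← Finset.mul_prod_erase _ _ (Finset.mem_univ i),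
          ← Finset.mul_prod_erase _ (fun k => shiftProd q y (x k) (l k - 1)) (Finset.mem_univ i),
          mul_assoc]
        have hmi : m i = l i - 1 := by rw [hm, Function.update_self]
        rw [hmi]
        congr 1
        rw [hS, ← Finset.filter_erase, Finset.prod_filter, ← Finset.prod_mul_distrib]
        refine Finset.prod_congr rfl fun k hk => ?_
        have hmk : m k = l k := by rw [hm, Function.update_of_ne (Finset.ne_of_mem_erase hk)]
        rw [hmk]
        rcases Nat.eq_zero_or_pos (l k) with h | h
        · simp [h]
        · rw [if_pos h.ne']
          conv_lhs => rw [← Nat.sub_add_cancel h, shiftProd_succ]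
      rw [kShift, h1, hR]
      simp only [kReduced]
      rw [qInf_eq_mul hq, ← hsum,
        show α * q * y * q ^ (∑ k, l k) = ρ * y by rw [hρ]; ring,
        show ρ * y * q = α * q * y * q ^ (∑ i, l i + 1) by rw [hρ]; ring]
      ring
    have hw' : fluxWeight q x α r s m * nodeWeight q x α m i = -(kWeight q x α r s l *
        (q ^ (∑ k, l k) * (A.eval (v i) / ((1 - ρ * v i) * ∏ j ∈ S.erase i, (v i - v j))))) := by
      rw [hAe, hw, neg_neg]
    rw [fluxDir, hw', hQm]
    simp only [Fin.prod_univ_three, Matrix.cons_val, hkm b₁, hkm b₂, hkm b₃]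
    ring
  have hsumdir : (∑ i, if l i ≠ 0 then
      fluxDir q x α r s ![b₁, b₂, b₃] b i (Function.update l i (l i - 1)) else 0)
      = -(kWeight q x α r s l * Q * (q ^ (∑ k, l k) * (R b₁ * R b₂ * R b₃) *
        ∑ i ∈ S, (A.eval (v i) / ((1 - ρ * v i) * ∏ j ∈ S.erase i, (v i - v j)) *
          (((1 - ρ * b₁) * ∏ j ∈ S.erase i, (b₁ - v j)) *
            ((1 - ρ * b₂) * ∏ j ∈ S.erase i, (b₂ - v j)) *
            ((1 - ρ * b₃) * ∏ j ∈ S.erase i, (b₃ - v j)))))) := by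
    rw [← Finset.sum_filter, Finset.sum_congr rfl hdir, Finset.sum_neg_distrib, Finset.mul_sum,
      Finset.mul_sum]
  rw [hzero, hsumdir]
  simp only [kTerm, cons₃, Fin.prod_univ_succ (n := N + 2), Fin.prod_univ_succ (n := N + 1),
    Fin.prod_univ_succ (n := N), Fin.cons_zero, Fin.cons_succ]
  rw [← hQ, hk1 b₁, hk1 b₂, hk1 b₃]
  generalize (∑ i ∈ S, (A.eval (v i) / ((1 - ρ * v i) * ∏ j ∈ S.erase i, (v i - v j)) *
          (((1 - ρ * b₁) * ∏ j ∈ S.erase i, (b₁ - v j)) *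
            ((1 - ρ * b₂) * ∏ j ∈ S.erase i, (b₂ - v j)) *
            ((1 - ρ * b₃) * ∏ j ∈ S.erase i, (b₃ - v j))))) = D at *
  have h1 := hk2 b₁
  have h2 := hk2 b₂
  have h3 := hk2 b₃
  generalize kFactor q x α (q * b₁) l = F₁ at *
  generalize kFactor q x α (q * b₂) l = F₂ at *
  generalize kFactor q x α (q * b₃) l = F₃ at *
  generalize ∏ k ∈ S, (b₁ - v k) = V₁ at *
  generalize ∏ k ∈ S, (b₂ - v k) = V₂ at *
  generalize ∏ k ∈ S, (b₃ - v k) = V₃ at *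
  generalize kWeight q x α r s l = W at *
  generalize q ^ (∑ k, l k) = μ at *
  linear_combination W * Q * ((b₂ - b₃) * (R b₂ * ((1 - ρ * b₂) * V₂)) *
      (R b₃ * ((1 - ρ * b₃) * V₃)) * h1
    + (b₃ - b₁) * (R b₃ * ((1 - ρ * b₃) * V₃)) * (R b₁ * ((1 - ρ * b₁) * V₁)) * h2
    + (b₁ - b₂) * (R b₁ * ((1 - ρ * b₁) * V₁)) * (R b₂ * ((1 - ρ * b₂) * V₂)) * h3
    + μ * (R b₁ * R b₂ * R b₃) * key)

/-! ### Summability of the fluxes and the summed three-term relation. -/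

/-- The function `f` is `c^|m|` times a bounded function. -/
def GeomBdd {M : ℕ} (c : ℂ) (f : (Fin M → ℕ) → ℂ) : Prop :=
  ∃ g : (Fin M → ℕ) → ℂ, BddOn Set.univ g ∧ ∀ m, f m = c ^ (∑ i, m i) * g m

namespace GeomBdd

variable {M : ℕ} {c d : ℂ} {f g : (Fin M → ℕ) → ℂ}

lemma mul (hf : GeomBdd c f) (hg : GeomBdd d g) : GeomBdd (c * d) fun m => f m * g m := by
  obtain ⟨f', hf', hf⟩ := hf
  obtain ⟨g', hg', hg⟩ := hg
  exact ⟨_, hf'.mul hg', fun m => by simp only [hf, hg, mul_pow]; ring⟩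

lemma mul_bdd (hf : GeomBdd c f) (hg : BddOn Set.univ g) : GeomBdd c fun m => f m * g m := by
  obtain ⟨f', hf', hf⟩ := hf
  exact ⟨_, hf'.mul hg, fun m => by simp only [hf]; ring⟩

lemma prod {ι : Type*} [Fintype ι] {C : ι → ℂ} {F : ι → (Fin M → ℕ) → ℂ}
    (hF : ∀ i, GeomBdd (C i) (F i)) : GeomBdd (∏ i, C i) fun m => ∏ i, F i m := by
  choose G hG hF using hF
  refine ⟨_, BddOn.prod (s := Finset.univ) fun i _ => hG i, fun m => ?_⟩
  simp only [hF, Finset.prod_mul_distrib, Finset.prod_pow]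

lemma summable (hf : GeomBdd c f) (hc : ‖c‖ < 1) : Summable f := by
  obtain ⟨g, ⟨C, hC⟩, hf⟩ := hf
  refine Summable.of_norm_bounded ((summable_pow_sum (norm_nonneg c) hc M).mul_right C)
    fun m => ?_
  rw [hf, norm_mul, norm_pow]
  gcongr
  exact hC m (Set.mem_univ m)

end GeomBdd

section

variable {q : ℂ} (hq : ‖q‖ < 1) {M : ℕ} {x : Fin M → ℂ}
include hq

lemma geomBdd_kShift (α b : ℂ) {ρ : ℝ} (hρ : 0 < ρ) (hb : ‖b‖ ≤ ρ) :
    GeomBdd (ρ : ℂ) (kShift q x α b) := by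
  refine ⟨_, bddOn_qInf_mul_prod_div hq (x := x) (BddOn.const α) (fun m => m) hρ (b := fun _ => b)
    (fun _ _ => hb) (fun m => ∑ i, m i + 1), fun m => ?_⟩
  have : (ρ : ℂ) ^ (∑ i, m i) ≠ 0 := pow_ne_zero _ (by exact_mod_cast hρ.ne')
  rw [kShift, mul_div_cancel₀ _ this]

lemma geomBdd_fluxWeight_mul (hx : GenericNodes q x) (α r s : ℂ) {g : (Fin M → ℕ) → ℂ}
    (hg : BddOn Set.univ fun m => vandermondeProd (fun i => x i * q ^ m i) * g m) :
    GeomBdd (q * (q ^ 2 / (r * s * ∏ i, x i))) fun m => fluxWeight q x α r s m * g m := by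
  have hP : ∀ c : ℂ, BddOn Set.univ fun m : Fin M → ℕ => qPoch q c (∑ i, m i + 1) := fun c =>
    (BddOn.const c).qPoch hq _
  refine ⟨_, ((((((BddOn.const (q ^ 2 / (r * s))).mul (hg.div_const (vandermondeProd x))).mul
    (bddOn_inv_prod_qPoch hq (fun m => m) hx)).mul
    (BddOn.prod (s := Finset.univ) fun i _ => hP (α * x i))).mul ((hP (α * s)).mul (hP (α * r)))).mul
    (bddOn_prod_qInf_mul_qInf hq (x := x) (fun m => m) r s)), fun m => ?_⟩
  beta_reduce
  rw [fluxWeight, mul_pow, div_eq_mul_inv _ (∏ i, ∏ j, _)]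
  ring

lemma geomBdd_fluxWeight (hx : GenericNodes q x) (α r s : ℂ) :
    GeomBdd (q * (q ^ 2 / (r * s * ∏ i, x i))) (fluxWeight q x α r s) := by
  simpa using geomBdd_fluxWeight_mul hq hx α r s (g := fun _ => 1)
    (by simpa using bddOn_vandermondeProd hq fun m => m)

lemma bddOn_one_sub_mul (α : ℂ) {b : (Fin M → ℕ) → ℂ} (hb : BddOn Set.univ b) :
    BddOn Set.univ fun m : Fin M → ℕ => 1 - α * q ^ (∑ i, m i + 1) * b m :=
  (BddOn.const 1).sub ((bddOn_mul_pow hq _ _).mul hb)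

/-- The denominators of `nodeWeight` may tend to zero, but they divide the Vandermonde product in
`fluxWeight`, and the quotient is the bounded cofactor. -/
lemma geomBdd_fluxWeight_mul_nodeWeight (hq0 : q ≠ 0) (hx : GenericNodes q x) (α r s : ℂ)
    (i : Fin M) : GeomBdd (q * (q ^ 2 / (r * s * ∏ i, x i)))
      fun m => fluxWeight q x α r s m * nodeWeight q x α m i := by
  refine geomBdd_fluxWeight_mul hq hx α r s ?_
  have : ∀ m : Fin M → ℕ, vandermondeProd (fun i => x i * q ^ m i) * nodeWeight q x α m i
      = vandermondeCofactor (fun i => x i * q ^ m i) i *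
        ∏ k ∈ Finset.univ.erase i, (1 - α * q ^ (∑ m_1, m m_1 + 1) * (x k * q ^ m k)) := by
    intro m
    have hP : ∏ k ∈ Finset.univ.erase i, (x k * q ^ m k - x i * q ^ m i) ≠ 0 :=
      Finset.prod_ne_zero_iff.2 fun k hk => sub_ne_zero.2
        (hx.mul_pow_ne hq0 (Finset.ne_of_mem_erase hk) (m k) (m i))
    rw [vandermondeProd_eq_mul_cofactor _ i, nodeWeight, Finset.prod_div_distrib]
    field_simp
  simp only [this]
  exact (bddOn_vandermondeCofactor hq (fun m => m) i).mul
    (BddOn.prod fun k _ => bddOn_one_sub_mul hq α (bddOn_mul_pow hq _ _))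

variable {N : ℕ} (d : Fin 3 → ℂ) (b : Fin N → ℂ)

omit hq in
lemma exists_radius_lt_one (c : ℂ) (h : ‖c * ((∏ j, d j) * ∏ j, b j)‖ < 1) :
    ∃ ε : ℝ, 0 < ε ∧ ‖c * ((∏ j, ((‖d j‖ + ε : ℝ) : ℂ)) * ∏ j, ((‖b j‖ + ε : ℝ) : ℂ))‖ < 1 := by
  have hcont : ContinuousAt (fun ε : ℝ =>
      ‖c * ((∏ j, ((‖d j‖ + ε : ℝ) : ℂ)) * ∏ j, ((‖b j‖ + ε : ℝ) : ℂ))‖) 0 := by fun_prop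
  have h0 : (fun ε : ℝ =>
      ‖c * ((∏ j, ((‖d j‖ + ε : ℝ) : ℂ)) * ∏ j, ((‖b j‖ + ε : ℝ) : ℂ))‖) 0 < 1 := by
    simpa [norm_mul, norm_prod] using h
  obtain ⟨ε, hε, hε0⟩ := (((hcont.eventually_lt_const h0).filter_mono nhdsWithin_le_nhds).and
    (self_mem_nhdsWithin (s := Set.Ioi (0 : ℝ)))).exists
  exact ⟨ε, hε0, hε⟩

lemma summable_fluxZero (hx : GenericNodes q x) (α r s : ℂ)
    (h : ‖q * (q ^ 2 / (r * s * ∏ i, x i)) * ((∏ j, d j) * ∏ j, b j)‖ < 1) :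
    Summable (fluxZero q x α r s d b) := by
  obtain ⟨ε, hε, hlt⟩ := exists_radius_lt_one d b _ h
  exact (((geomBdd_fluxWeight hq hx α r s).mul
    ((GeomBdd.prod fun j => geomBdd_kShift hq α (d j) (ρ := ‖d j‖ + ε) (by positivity)
      (by linarith)).mul (GeomBdd.prod fun j => geomBdd_kShift hq α (b j) (ρ := ‖b j‖ + ε)
      (by positivity) (by linarith)))).mul_bdd (BddOn.prod fun j _ =>
        bddOn_one_sub_mul hq α (BddOn.const _))).summable hlt

lemma summable_fluxDir (hq0 : q ≠ 0) (hx : GenericNodes q x) (α r s : ℂ) (i : Fin M)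
    (h : ‖q * (q ^ 2 / (r * s * ∏ i, x i)) * ((∏ j, d j) * ∏ j, b j)‖ < 1) :
    Summable (fluxDir q x α r s d b i) := by
  obtain ⟨ε, hε, hlt⟩ := exists_radius_lt_one d b _ h
  exact (((geomBdd_fluxWeight_mul_nodeWeight hq hq0 hx α r s i).mul
    ((GeomBdd.prod fun j => geomBdd_kShift hq α (d j) (ρ := ‖d j‖ + ε) (by positivity)
      (by linarith)).mul (GeomBdd.prod fun j => geomBdd_kShift hq α (b j) (ρ := ‖b j‖ + ε)
      (by positivity) (by linarith)))).mul_bdd (BddOn.prod fun j _ =>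
        (BddOn.const _).sub (bddOn_mul_pow hq _ _))).summable hlt

end

/-- Reindexing along the injection `m ↦ m + e_i`, whose range is `l i ≠ 0`. -/
lemma hasSum_pred {M : ℕ} {f : (Fin M → ℕ) → ℂ} {a : ℂ} (hf : HasSum f a) (i : Fin M) :
    HasSum (fun l => if l i ≠ 0 then f (Function.update l i (l i - 1)) else 0) a := by
  have hinj : Function.Injective fun m : Fin M → ℕ => Function.update m i (m i + 1) := by
    intro m m' h
    funext k
    have := congrFun h k
    by_cases hk : k = i
    · subst hk; simpa using this
    · simpa [hk] using this
  refine (hinj.hasSum_iff fun l hl => ?_).1 (hf.congr_fun fun m => ?_)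
  · rw [if_neg]
    intro h0
    refine hl ⟨Function.update l i (l i - 1), ?_⟩
    simp only [Function.update_self, Function.update_idem]
    rw [Nat.sub_add_cancel (Nat.pos_of_ne_zero h0), Function.update_eq_self]
  · simp

lemma tsum_kTerm_three_term {q : ℂ} (hq : ‖q‖ < 1) (hq0 : q ≠ 0) {M : ℕ} {x : Fin (M + 1) → ℂ}
    (hx : GenericNodes q x) {α r s : ℂ} (hα : α ≠ 0) (hr : r ≠ 0) (hs : s ≠ 0)
    (hαx : ∀ i, NoZeroFactor q (α * x i)) (b : Fin M → ℂ) (b₁ b₂ b₃ : ℂ)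
    (h : ‖q ^ 2 * (∏ j, cons₃ (q * b₁) b₂ b₃ b j) / (r * s * ∏ i, x i)‖ < 1) :
    (b₂ - b₃) * ((1 - q * b₁ / r) * (1 - q * b₁ / s)) *
        ∑' l, kTerm q x α r s (cons₃ (q * b₁) b₂ b₃ b) l
      + (b₃ - b₁) * ((1 - q * b₂ / r) * (1 - q * b₂ / s)) *
        ∑' l, kTerm q x α r s (cons₃ b₁ (q * b₂) b₃ b) l
      + (b₁ - b₂) * ((1 - q * b₃ / r) * (1 - q * b₃ / s)) *
        ∑' l, kTerm q x α r s (cons₃ b₁ b₂ (q * b₃) b) l = 0 := by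
  have e : ∀ c₁ c₂ c₃ : ℂ, ∏ j, cons₃ c₁ c₂ c₃ b j = c₁ * c₂ * c₃ * ∏ j, b j := fun c₁ c₂ c₃ => by
    simp only [cons₃, Fin.prod_univ_succ (n := M + 2), Fin.prod_univ_succ (n := M + 1),
      Fin.prod_univ_succ (n := M), Fin.cons_zero, Fin.cons_succ]
    ring
  rw [e] at h
  have hs1 := summable_kTerm hq hx α r s (cons₃ (q * b₁) b₂ b₃ b) (by rwa [e])
  have hs2 := summable_kTerm hq hx α r s (cons₃ b₁ (q * b₂) b₃ b) (by
    rw [e]; convert h using 3; ring)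
  have hs3 := summable_kTerm hq hx α r s (cons₃ b₁ b₂ (q * b₃) b) (by
    rw [e]; convert h using 3; ring)
  have h' : ‖q * (q ^ 2 / (r * s * ∏ i, x i)) * ((∏ j, ![b₁, b₂, b₃] j) * ∏ j, b j)‖ < 1 := by
    rw [Fin.prod_univ_three]
    convert h using 2
    simp only [Matrix.cons_val]
    ring
  have hZ := summable_fluxZero hq _ b hx α r s h'
  have hD := fun i => summable_fluxDir hq _ b hq0 hx α r s i h'
  have hsum : HasSum (fun l => fluxZero q x α r s ![b₁, b₂, b₃] b l
        - ∑ i, if l i ≠ 0 then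
          fluxDir q x α r s ![b₁, b₂, b₃] b i (Function.update l i (l i - 1)) else 0) 0 := by
    have h1 := hZ.hasSum.sub (hasSum_sum (s := Finset.univ)
      fun i _ => hasSum_pred (hD i).hasSum i)
    -- The fluxes balance cell by cell, and the shifts by `e_i` do not change their sums.
    have h2 : (∑' m, fluxZero q x α r s ![b₁, b₂, b₃] b m)
        = ∑ i, ∑' m, fluxDir q x α r s ![b₁, b₂, b₃] b i m := by
      rw [← Summable.tsum_finsetSum fun i _ => hD i]
      exact tsum_congr fun m => (sum_fluxDir hq0 hx hα r s _ b m).symm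
    rwa [h2, sub_self] at h1
  rw [← tsum_mul_left, ← tsum_mul_left, ← tsum_mul_left,
    ← (hs1.mul_left _).tsum_add (hs2.mul_left _),
    ← ((hs1.mul_left _).add (hs2.mul_left _)).tsum_add (hs3.mul_left _)]
  simp only [kTerm_three_term hq hq0 hx hα hr hs hαx]
  rw [tsum_mul_left, hsum.tsum_eq, mul_zero]

/-! ### Analytic dependence on the parameters. -/

lemma differentiableAt_tsum {ι : Type*} {F : ι → ℂ → ℂ} (hF : ∀ i, Differentiable ℂ (F i)) {w₀ : ℂ}
    {u : ι → ℝ} (hu : Summable u) (hb : ∀ᶠ w in 𝓝 w₀, ∀ i, ‖F i w‖ ≤ u i) :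
    DifferentiableAt ℂ (fun w => ∑' i, F i w) w₀ := by
  obtain ⟨U, hU, hUo, hwU⟩ := eventually_nhds_iff.1 hb
  exact (Complex.differentiableOn_tsum_of_summable_norm hu
    (fun i => (hF i).differentiableOn) hUo (fun i w hw => hU w hw i)).differentiableAt
    (hUo.mem_nhds hwU)

lemma differentiable_jDiff {q : ℂ} (hq : ‖q‖ < 1) {ι κ : Type*} [Fintype ι] [Fintype κ] (x : ι → ℂ)
    (r s : ℂ) {α p : ℂ → ℂ} {b : ℂ → κ → ℂ} (hα : Differentiable ℂ α) (hp : Differentiable ℂ p)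
    (hb : ∀ j, Differentiable ℂ fun w => b w j) :
    Differentiable ℂ fun w => jDiff q x (α w) r s (b w) (p w) := by
  have key : ∀ r s : ℂ, Differentiable ℂ fun w => ∑' n, jTerm q x (α w) r s (b w) (p w) n := by
    intro r s w₀
    let h : ℂ → ℝ := fun w => (∏ i, expBound q (x i / r)) * expBound q (p w / r)
      * expBound q 1 * expBound q (s / r) * (expBound q (α w * s) * expBound q (α w * r))
      * ∏ j, (expBound q (q * b w j / r) * expBound q (q * b w j / s))
    have hαc := hα.continuous
    have hpc := hp.continuous
    have hbc := fun j => (hb j).continuous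
    have hc : Continuous h := by unfold h expBound; fun_prop
    refine differentiableAt_tsum (u := fun n => ‖q‖ ^ n * (h w₀ + 1)) (fun n => ?_)
      ((summable_geometric_of_lt_one (norm_nonneg q) hq).mul_right _) ?_
    · unfold jTerm jFactor
      fun_prop (disch := assumption)
    · filter_upwards [hc.continuousAt.eventually_lt_const (lt_add_one (h w₀))] with w hw n
      refine (norm_jTerm_le hq x _ r s _ _ n).trans ?_
      gcongr
  unfold jDiff
  exact ((key s r).div_const s).sub ((key r s).div_const r)

/-! ### The case of no variables: the nonterminating `q`-Saalschütz sum. -/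

/-- The normalised Jackson integral with three parameters in the denominator. -/
def jDiff₃ (q r s b₁ b₂ b₃ : ℂ) : ℂ :=
  jDiff q (fun i : Fin 0 => i.elim0) (q * b₃ / (r * s)) r s ![b₁, b₂]
    (q ^ 2 * b₁ * b₂ * b₃ / (r * s))

/-- The terms of the series in `jDiff₃`. -/
def jTerm₃ (q r s b₁ b₂ b₃ : ℂ) (n : ℕ) : ℂ :=
  q ^ n * qInf q (q ^ 2 * b₁ * b₂ * b₃ / (r * s) * q ^ (n + 1) / r) * qInf q (q ^ (n + 1))
    * qInf q (s * q ^ (n + 1) / r) * jFactor q r s b₁ n * jFactor q r s b₂ n * jFactor q r s b₃ n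

section

variable {q r s : ℂ} (hr : r ≠ 0) (hs : s ≠ 0)
include hr hs

lemma jTerm_eq_jTerm₃ (b₁ b₂ b₃ : ℂ) (n : ℕ) :
    jTerm q (fun i : Fin 0 => i.elim0) (q * b₃ / (r * s)) r s ![b₁, b₂]
      (q ^ 2 * b₁ * b₂ * b₃ / (r * s)) n = jTerm₃ q r s b₁ b₂ b₃ n := by
  have h1 : q * b₃ / (r * s) * s = q * b₃ / r := by field_simp
  have h2 : q * b₃ / (r * s) * r = q * b₃ / s := by field_simp
  simp only [jTerm, jTerm₃, Finset.univ_eq_empty, Finset.prod_empty, Fin.prod_univ_two,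
    Matrix.cons_val, h1, h2, jFactor]
  ring

lemma jDiff₃_eq (b₁ b₂ b₃ : ℂ) : jDiff₃ q r s b₁ b₂ b₃
    = (∑' n, jTerm₃ q s r b₁ b₂ b₃ n) / s - (∑' n, jTerm₃ q r s b₁ b₂ b₃ n) / r := by
  rw [jDiff₃, jDiff]
  simp only [← jTerm_eq_jTerm₃ hr hs, ← jTerm_eq_jTerm₃ hs hr, mul_comm s r]

lemma summable_jTerm₃ (hq : ‖q‖ < 1) (b₁ b₂ b₃ : ℂ) : Summable (jTerm₃ q r s b₁ b₂ b₃) :=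
  (summable_jTerm hq _ _ _ _ _ _).congr fun n => (jTerm_eq_jTerm₃ hr hs b₁ b₂ b₃ n)

lemma jDiff₃_swap₁₂ (b₁ b₂ b₃ : ℂ) : jDiff₃ q r s b₁ b₂ b₃ = jDiff₃ q r s b₂ b₁ b₃ := by
  have : ∀ r s n, jTerm₃ q r s b₁ b₂ b₃ n = jTerm₃ q r s b₂ b₁ b₃ n := fun r s n => by
    rw [jTerm₃, jTerm₃, mul_right_comm (q ^ 2)]; ring
  simp only [jDiff₃_eq hr hs, this]

/-- The choice `α = q b₃ / (r s)` makes the `α`-factor equal to `jFactor` of `b₃`, so all three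
parameters enter alike. -/
lemma jDiff₃_swap₁₃ (b₁ b₂ b₃ : ℂ) : jDiff₃ q r s b₁ b₂ b₃ = jDiff₃ q r s b₃ b₂ b₁ := by
  have : ∀ r s n, jTerm₃ q r s b₁ b₂ b₃ n = jTerm₃ q r s b₃ b₂ b₁ n := fun r s n => by
    rw [jTerm₃, jTerm₃, show q ^ 2 * b₁ * b₂ * b₃ = q ^ 2 * b₃ * b₂ * b₁ by ring]; ring
  simp only [jDiff₃_eq hr hs, this]

end

/-- The telescoping sequence for the first-order recurrence of `jDiff₃`. -/
def jFlux (q r s b₁ b₂ b₃ : ℂ) (n : ℕ) : ℂ :=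
  qInf q (q ^ 2 * b₁ * b₂ * b₃ / (r * s) * q / r * q ^ (n + 1)) * qInf q (q ^ (n + 1))
    * qInf q (s / r * q ^ (n + 1)) * jFactor q r s (q * b₁) n * jFactor q r s b₂ (n + 1)
    * jFactor q r s b₃ (n + 1)

lemma jFactor_zero (q r s b : ℂ) : jFactor q r s b 0 = qInf q (q * b / s) := by simp [jFactor]

lemma jFactor_succ (q r s b : ℂ) (n : ℕ) :
    jFactor q r s b (n + 1) = (1 - b * q ^ (n + 1) / r) * jFactor q r s b n := by
  rw [jFactor, jFactor, qPoch_succ]; ring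

lemma jFactor_succ' {q : ℂ} (hq : ‖q‖ < 1) (r s b : ℂ) (n : ℕ) : jFactor q r s b (n + 1)
    = (1 - q * b / r) * (1 - q * b / s) * jFactor q r s (q * b) n := by
  rw [jFactor_shift hq, jFactor_succ]

lemma sum_jTerm₃_sub {q r s : ℂ} (hq : ‖q‖ < 1) (hr : r ≠ 0) (hs : s ≠ 0) (b₁ b₂ b₃ : ℂ) (N : ℕ) :
    ∑ n ∈ Finset.range (N + 1), (jTerm₃ q r s b₁ b₂ b₃ n
      - (1 - q ^ 2 * b₁ * b₂ / (r * s)) * (1 - q ^ 2 * b₁ * b₃ / (r * s))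
        * jTerm₃ q r s (q * b₁) b₂ b₃ n) / r = -(q * b₁ / (r * s)) * jFlux q r s b₁ b₂ b₃ N := by
  set p := q ^ 2 * b₁ * b₂ * b₃ / (r * s) with hp
  have hp' : q ^ 2 * (q * b₁) * b₂ * b₃ / (r * s) = p * q := by rw [hp]; ring
  induction N with
  | zero =>
    have h1 := qInf_eq_mul hq (p * q / r)
    have h2 := qInf_eq_mul hq (q * b₁ / s)
    rw [show q * b₁ / s * q = q * (q * b₁) / s by ring] at h2
    simp only [zero_add, Finset.sum_range_one, jTerm₃, jFlux, ← hp, hp', jFactor_succ, jFactor_zero,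
      pow_zero, pow_one, h1, h2]
    rw [show p * q * q / r = p * q / r * q by ring, mul_div_right_comm s q r]
    generalize qInf q (p * q / r * q) = P
    generalize qInf q (q * (q * b₁) / s) = B₁
    generalize qInf q (q * b₂ / s) = B₂
    generalize qInf q (q * b₃ / s) = B₃
    generalize qInf q (s / r * q) = S
    generalize qInf q q = Q
    rw [hp]
    field_simp
    ring
  | succ n ih =>
    rw [Finset.sum_range_succ, ih]
    have h1 := qInf_eq_mul hq (p * q / r * q ^ (n + 1))
    have h2 := qInf_eq_mul hq (q ^ (n + 1))
    have h3 := qInf_eq_mul hq (s / r * q ^ (n + 1))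
    rw [mul_assoc, ← pow_succ] at h1 h3
    rw [← pow_succ] at h2
    simp only [jTerm₃, jFlux, ← hp, hp']
    rw [show p * q ^ (n + 1 + 1) / r = p * q / r * q ^ (n + 1) by ring,
      show p * q * q ^ (n + 1 + 1) / r = p * q / r * q ^ (n + 1 + 1) by ring,
      mul_div_right_comm s, h1, h2, h3, jFactor_succ' hq r s b₁, jFactor_succ q r s (q * b₁),
      jFactor_succ q r s b₂ (n + 1), jFactor_succ q r s b₃ (n + 1)]
    generalize qInf q (p * q / r * q ^ (n + 1 + 1)) = P
    generalize qInf q (q ^ (n + 1 + 1)) = Q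
    generalize qInf q (s / r * q ^ (n + 1 + 1)) = S
    generalize jFactor q r s (q * b₁) n = B₁
    generalize jFactor q r s b₂ (n + 1) = B₂
    generalize jFactor q r s b₃ (n + 1) = B₃
    rw [pow_succ q (n + 1)]
    generalize q ^ (n + 1) = w
    rw [hp]
    field_simp
    ring

lemma tendsto_pow_atTop_zero {q : ℂ} (hq : ‖q‖ < 1) : Tendsto (fun n : ℕ => q ^ n) atTop (𝓝 0) :=
  tendsto_pow_atTop_nhds_zero_of_norm_lt_one hq

lemma tendsto_jFactor {q : ℂ} (hq : ‖q‖ < 1) (r s b : ℂ) : Tendsto (jFactor q r s b) atTop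
    (𝓝 (qInf q (q * b / r) * qInf q (q * b / s))) :=
  (tendsto_qPoch hq _).mul_const _

lemma tendsto_jFlux {q : ℂ} (hq : ‖q‖ < 1) (r s b₁ b₂ b₃ : ℂ) :
    Tendsto (jFlux q r s b₁ b₂ b₃) atTop
      (𝓝 (qInf q (q * (q * b₁) / r) * qInf q (q * (q * b₁) / s) *
        (qInf q (q * b₂ / r) * qInf q (q * b₂ / s)) *
        (qInf q (q * b₃ / r) * qInf q (q * b₃ / s)))) := by
  have h0 : ∀ c : ℂ, Tendsto (fun n : ℕ => qInf q (c * q ^ (n + 1))) atTop (𝓝 1) := fun c => by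
    have h1 := ((tendsto_pow_atTop_zero hq).comp (tendsto_add_atTop_nat 1)).const_mul c
    rw [mul_zero] at h1
    have h2 := (differentiable_qInf hq).continuous.tendsto 0
    rw [qInf_zero] at h2
    exact h2.comp h1
  have h := (((((h0 (q ^ 2 * b₁ * b₂ * b₃ / (r * s) * q / r)).mul (h0 1)).mul (h0 (s / r))).mul
    (tendsto_jFactor hq r s (q * b₁))).mul ((tendsto_jFactor hq r s b₂).comp
      (tendsto_add_atTop_nat 1))).mul ((tendsto_jFactor hq r s b₃).comp (tendsto_add_atTop_nat 1))
  simp only [one_mul] at h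
  exact h

/-- Each of the two series satisfies the recurrence up to the limit of its telescoping sequence.
That limit is symmetric in `r` and `s`, so it cancels in the difference. -/
lemma jDiff₃_recurrence {q r s : ℂ} (hq : ‖q‖ < 1) (hr : r ≠ 0) (hs : s ≠ 0) (b₁ b₂ b₃ : ℂ) :
    jDiff₃ q r s b₁ b₂ b₃ = (1 - q ^ 2 * b₁ * b₂ / (r * s)) * (1 - q ^ 2 * b₁ * b₃ / (r * s))
      * jDiff₃ q r s (q * b₁) b₂ b₃ := by
  have key : ∀ r s : ℂ, r ≠ 0 → s ≠ 0 → (∑' n, jTerm₃ q r s b₁ b₂ b₃ n) / r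
      - (1 - q ^ 2 * b₁ * b₂ / (r * s)) * (1 - q ^ 2 * b₁ * b₃ / (r * s))
        * ((∑' n, jTerm₃ q r s (q * b₁) b₂ b₃ n) / r) = -(q * b₁ / (r * s)) *
      (qInf q (q * (q * b₁) / r) * qInf q (q * (q * b₁) / s) *
        (qInf q (q * b₂ / r) * qInf q (q * b₂ / s)) *
        (qInf q (q * b₃ / r) * qInf q (q * b₃ / s))) := by
    intro r s hr hs
    have h1 := (((summable_jTerm₃ hr hs hq b₁ b₂ b₃).hasSum.sub
      ((summable_jTerm₃ hr hs hq (q * b₁) b₂ b₃).hasSum.mul_left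
        ((1 - q ^ 2 * b₁ * b₂ / (r * s)) * (1 - q ^ 2 * b₁ * b₃ / (r * s))))).div_const r)
    have h2 := (h1.tendsto_sum_nat).comp (tendsto_add_atTop_nat 1)
    have h3 := tendsto_nhds_unique h2 (((tendsto_jFlux hq r s b₁ b₂ b₃).const_mul
      (-(q * b₁ / (r * s)))).congr fun N => (sum_jTerm₃_sub hq hr hs b₁ b₂ b₃ N).symm)
    rw [← h3]
    ring
  have k1 := key r s hr hs
  have k2 := key s r hs hr
  rw [mul_comm s r] at k2
  rw [jDiff₃_eq hr hs, jDiff₃_eq hr hs]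
  linear_combination k2 - k1

/-- The recurrence is iterated `N` times; then `b₁ q^N` tends to `0` and continuity in the first
parameter gives the limit. -/
lemma jDiff₃_eq_mul_zero {q r s : ℂ} (hq : ‖q‖ < 1) (hr : r ≠ 0) (hs : s ≠ 0) (b₁ b₂ b₃ : ℂ) :
    jDiff₃ q r s b₁ b₂ b₃ = qInf q (q ^ 2 * b₁ * b₂ / (r * s)) * qInf q (q ^ 2 * b₁ * b₃ / (r * s))
      * jDiff₃ q r s 0 b₂ b₃ := by
  have h1 : ∀ N : ℕ, jDiff₃ q r s b₁ b₂ b₃ = qPoch q (q ^ 2 * b₁ * b₂ / (r * s)) N *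
      qPoch q (q ^ 2 * b₁ * b₃ / (r * s)) N * jDiff₃ q r s (b₁ * q ^ N) b₂ b₃ := by
    intro N
    induction N with
    | zero => simp
    | succ N ih =>
      rw [ih, jDiff₃_recurrence hq hr hs (b₁ * q ^ N), qPoch_succ, qPoch_succ, pow_succ]
      ring_nf
  have hd : Differentiable ℂ fun w => jDiff₃ q r s w b₂ b₃ := by
    unfold jDiff₃
    refine differentiable_jDiff hq _ r s (by fun_prop) (by fun_prop) fun j => ?_
    fin_cases j <;> simp
  have h2 := hd.continuous.tendsto 0
  have h3 := (tendsto_pow_atTop_zero hq).const_mul b₁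
  rw [mul_zero] at h3
  exact tendsto_nhds_unique (tendsto_const_nhds.congr h1) (((tendsto_qPoch hq _).mul
    (tendsto_qPoch hq _)).mul (h2.comp h3))

lemma jDiff₃_zero_zero {q r s : ℂ} (hq : ‖q‖ < 1) (hq0 : q ≠ 0) (hr : r ≠ 0) (hs : s ≠ 0)
    (hrs : r ≠ s) (b₃ : ℂ) : jDiff₃ q r s 0 0 b₃
      = qInf q q * qInf q (r / s) * qInf q (s / r) / (s - r) := by
  have h1 : ∀ b, jDiff₃ q r s 0 0 b = jDiff₃ q r s 0 0 0 := fun b => by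
    rw [jDiff₃_swap₁₃ hr hs, jDiff₃_eq_mul_zero hq hr hs]; simp
  -- The value does not depend on the third parameter. With `r / q` one has `q b / r = 1`: one
  -- series vanishes identically through `(1)_∞`, and the other stops after its first term through
  -- `(1)_n`.
  rw [h1, ← h1 (r / q), jDiff₃_eq hr hs]
  have h2 : ∀ n, jTerm₃ q s r 0 0 (r / q) n = 0 := fun n => by
    have : q * (r / q) / r = 1 := by field_simp
    simp [jTerm₃, jFactor, this, qInf_one hq]
  have h3 : ∀ n, n ≠ 0 → jTerm₃ q r s 0 0 (r / q) n = 0 := fun n hn => by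
    obtain ⟨k, rfl⟩ := Nat.exists_eq_succ_of_ne_zero hn
    have : q * (r / q) / r = 1 := by field_simp
    simp [jTerm₃, jFactor, this, qPoch_succ']
  have h4 : q * (r / q) / s = r / s := by field_simp
  rw [tsum_eq_single 0 h3]
  simp only [h2, tsum_zero]
  simp only [jTerm₃, jFactor, h4]
  rw [qInf_eq_mul hq (s / r)]
  have : s - r ≠ 0 := sub_ne_zero.2 hrs.symm
  simp only [mul_zero, zero_mul, zero_div, pow_zero, zero_add, pow_one, qInf_zero, qPoch_zero,
    mul_one, one_mul, zero_sub]
  rw [mul_div_right_comm s q r]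
  field_simp
  ring

/-- The nonterminating `q`-Saalschütz sum. -/
lemma jDiff₃_eq_prod {q r s : ℂ} (hq : ‖q‖ < 1) (hq0 : q ≠ 0) (hr : r ≠ 0) (hs : s ≠ 0)
    (hrs : r ≠ s) (b₁ b₂ b₃ : ℂ) : jDiff₃ q r s b₁ b₂ b₃
      = qInf q q * qInf q (r / s) * qInf q (s / r) / (s - r) * (qInf q (q ^ 2 * b₁ * b₂ / (r * s)) *
        qInf q (q ^ 2 * b₁ * b₃ / (r * s)) * qInf q (q ^ 2 * b₂ * b₃ / (r * s))) := by
  rw [jDiff₃_eq_mul_zero hq hr hs, jDiff₃_swap₁₂ hr hs, jDiff₃_eq_mul_zero hq hr hs b₂,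
    jDiff₃_zero_zero hq hq0 hr hs hrs]
  simp only [mul_zero, zero_div, qInf_zero]
  ring

/-! ### The defect: analyticity and three-term relation. -/

/-- The difference of the two sides of the transformation formula. -/
def defect (q : ℂ) {M N : ℕ} (x : Fin M → ℂ) (α r s : ℂ) (b : Fin N → ℂ) : ℂ :=
  (∏ i, qInf q (α * x i)) * jDiff q x α r s b (α * q * (∏ j, b j) / ∏ i, x i)
    - qInf q q * qInf q (r / s) * qInf q (s / r) / (s - r)
      * qInf q (q ^ 2 * (∏ j, b j) / (r * s * ∏ i, x i)) * ∑' l, kTerm q x α r s b l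

lemma differentiable_kTerm {q : ℂ} (hq : ‖q‖ < 1) {M N : ℕ} (x : Fin M → ℂ) (r s : ℂ) {α : ℂ → ℂ}
    {b : ℂ → Fin N → ℂ} (hα : Differentiable ℂ α) (hb : ∀ j, Differentiable ℂ fun w => b w j)
    (l : Fin M → ℕ) : Differentiable ℂ fun w => kTerm q x (α w) r s (b w) l := by
  unfold kTerm kWeight kFactor
  fun_prop (disch := assumption)

lemma differentiableAt_defect {q : ℂ} (hq : ‖q‖ < 1) {M N : ℕ} {x : Fin M → ℂ}
    (hx : GenericNodes q x) (r s : ℂ) {α : ℂ → ℂ} {b : ℂ → Fin N → ℂ} (hα : Differentiable ℂ α)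
    (hb : ∀ j, Differentiable ℂ fun w => b w j) {w₀ : ℂ}
    (h : ‖q ^ 2 * (∏ j, b w₀ j) / (r * s * ∏ i, x i)‖ < 1) :
    DifferentiableAt ℂ (fun w => defect q x (α w) r s (b w)) w₀ := by
  obtain ⟨u, ε, hu, hε, hbound⟩ := exists_summable_kTerm_bound hq hx r s (‖α w₀‖ + 1) (b w₀) h
  have hk : DifferentiableAt ℂ (fun w => ∑' l, kTerm q x (α w) r s (b w) l) w₀ := by
    refine differentiableAt_tsum (differentiable_kTerm hq x r s hα hb) hu ?_
    have h1 := hα.continuous.norm.continuousAt.eventually_lt_const (lt_add_one ‖α w₀‖)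
    have h2 := eventually_all.2 fun j =>
      (hb j).continuous.norm.continuousAt.eventually_lt_const (lt_add_of_pos_right ‖b w₀ j‖ hε)
    filter_upwards [h1, h2] with w hw1 hw2 l
    exact hbound l _ _ hw1.le fun j => (hw2 j).le
  have hj := differentiable_jDiff hq x r s hα (b := b)
    (p := fun w => α w * q * (∏ j, b w j) / ∏ i, x i) (by fun_prop) hb
  have h1 : Differentiable ℂ fun w => ∏ i, qInf q (α w * x i) := by fun_prop (disch := assumption)
  have h2 : Differentiable ℂ fun w => qInf q q * qInf q (r / s) * qInf q (s / r) / (s - r)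
      * qInf q (q ^ 2 * (∏ j, b w j) / (r * s * ∏ i, x i)) := by fun_prop (disch := assumption)
  unfold defect
  exact ((h1 w₀).mul (hj w₀)).sub ((h2 w₀).mul hk)

lemma prod_cons₃ {N : ℕ} (b₁ b₂ b₃ : ℂ) (b : Fin N → ℂ) :
    ∏ j, cons₃ b₁ b₂ b₃ b j = b₁ * b₂ * b₃ * ∏ j, b j := by
  simp only [cons₃, Fin.prod_univ_succ (n := N + 2), Fin.prod_univ_succ (n := N + 1),
    Fin.prod_univ_succ (n := N), Fin.cons_zero, Fin.cons_succ]
  ring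

/-- The three parameter families have the same product, so the balancing parameter and the
prefactors agree and the relations of the two sides can be subtracted. -/
lemma defect_three_term {q : ℂ} (hq : ‖q‖ < 1) (hq0 : q ≠ 0) {M : ℕ} {x : Fin (M + 1) → ℂ}
    (hx : GenericNodes q x) {α r s : ℂ} (hα : α ≠ 0) (hr : r ≠ 0) (hs : s ≠ 0)
    (hαx : ∀ i, NoZeroFactor q (α * x i)) (b : Fin M → ℂ) (b₁ b₂ b₃ : ℂ)
    (h : ‖q ^ 2 * (∏ j, cons₃ (q * b₁) b₂ b₃ b j) / (r * s * ∏ i, x i)‖ < 1) :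
    (b₂ - b₃) * ((1 - q * b₁ / r) * (1 - q * b₁ / s)) * defect q x α r s (cons₃ (q * b₁) b₂ b₃ b)
      + (b₃ - b₁) * ((1 - q * b₂ / r) * (1 - q * b₂ / s)) *
        defect q x α r s (cons₃ b₁ (q * b₂) b₃ b)
      + (b₁ - b₂) * ((1 - q * b₃ / r) * (1 - q * b₃ / s)) *
        defect q x α r s (cons₃ b₁ b₂ (q * b₃) b) = 0 := by
  have hk := tsum_kTerm_three_term hq hq0 hx hα hr hs hαx b b₁ b₂ b₃ h
  have e2 : b₁ * (q * b₂) * b₃ = q * b₁ * b₂ * b₃ := by ring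
  have e3 : b₁ * b₂ * (q * b₃) = q * b₁ * b₂ * b₃ := by ring
  simp only [defect, prod_cons₃, e2, e3]
  have hj := jDiff_three_term hq x α r s b
    (α * q * (q * b₁ * b₂ * b₃ * ∏ j, b j) / ∏ i, x i) b₁ b₂ b₃
  linear_combination (∏ i, qInf q (α * x i)) * hj - qInf q q * qInf q (r / s) * qInf q (s / r)
    / (s - r) * qInf q (q ^ 2 * (q * b₁ * b₂ * b₃ * ∏ j, b j) / (r * s * ∏ i, x i)) * hk

lemma shiftProd_mul_sub {q y : ℂ} (hy : y ≠ 0) (x : ℂ) (m : ℕ) :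
    shiftProd q y x m * (y - x * q ^ m) = (y - x) * (y ^ m * qPoch q (q * x / y) m) := by
  induction m with
  | zero => simp
  | succ m ih =>
    rw [shiftProd_succ, ih, qPoch_succ, pow_succ]
    field_simp
    ring

/-! ### Removal of a variable that coincides with a parameter. -/

section Cons

variable {q : ℂ} (hq : ‖q‖ < 1) {M N : ℕ} {y : ℂ} {x : Fin M → ℂ}

/-- In the integrand `(y t)_∞ / (y t)_∞` cancels; only the normalising values at the two endpoints
are left. -/
lemma jDiff_cons (hq : ‖q‖ < 1) (α r s p : ℂ) (b : Fin N → ℂ) :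
    jDiff q (Fin.cons y x : Fin (M + 1) → ℂ) α r s (Fin.cons y b : Fin (N + 1) → ℂ) p
      = qInf q (q * y / r) * qInf q (q * y / s) * jDiff q x α r s b p := by
  have key : ∀ r s n, jTerm q (Fin.cons y x : Fin (M + 1) → ℂ) α r s
      (Fin.cons y b : Fin (N + 1) → ℂ) p n
      = qInf q (q * y / r) * qInf q (q * y / s) * jTerm q x α r s b p n := fun r s n => by
    have h := qInf_eq_qPoch_mul hq (q * y / r) n
    rw [show q * y / r * q ^ n = y * q ^ (n + 1) / r by ring] at h
    simp only [jTerm, Fin.prod_univ_succ, Fin.cons_zero, Fin.cons_succ, h]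
    rw [jFactor]
    ring
  simp only [jDiff, key, tsum_mul_left]
  ring

/-- The Vandermonde factors of `y`, the products `(q x_i / y)_(m_i)`, the power of `y` and the
shifted products with parameter `y` cancel by `shiftProd_mul_sub`. -/
lemma kTerm_cons (hq : ‖q‖ < 1) (hx : GenericNodes q (Fin.cons y x : Fin (M + 1) → ℂ))
    (α r s : ℂ) (b : Fin N → ℂ) (m : Fin M → ℕ) :
    kTerm q (Fin.cons y x : Fin (M + 1) → ℂ) α r s (Fin.cons y b : Fin (N + 1) → ℂ)
        (Fin.cons 0 m : Fin (M + 1) → ℕ)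
      = qInf q (α * y) * (qInf q (q * y / r) * qInf q (q * y / s)) * kTerm q x α r s b m := by
  have hy : y ≠ 0 := hx.ne_zero 0
  have hV : (fun i => (Fin.cons y x : Fin (M + 1) → ℂ) i * q ^ (Fin.cons 0 m : Fin (M + 1) → ℕ) i)
      = (Fin.cons y fun i => x i * q ^ m i : Fin (M + 1) → ℂ) := by
    funext i
    refine Fin.cases ?_ (fun i => ?_) i <;> simp
  have hα := qInf_eq_qPoch_mul hq (α * y) (∑ i, m i)
  rw [qInf_eq_mul hq (α * y * q ^ (∑ i, m i)),
    show α * y * q ^ (∑ i, m i) * q = α * q * y * q ^ (∑ i, m i) by ring] at hα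
  have hP : (∏ i, shiftProd q y (x i) (m i)) * ∏ i, (y - x i * q ^ m i)
      = (∏ i, (y - x i)) * (y ^ (∑ i, m i) * ∏ i, qPoch q (q * x i / y) (m i)) := by
    rw [← Finset.prod_mul_distrib, ← Finset.prod_pow_eq_pow_sum, ← Finset.prod_mul_distrib,
      ← Finset.prod_mul_distrib]
    exact Finset.prod_congr rfl fun i _ => shiftProd_mul_sub hy _ _
  have hne1 : ∏ i, (y - x i) ≠ 0 := Finset.prod_ne_zero_iff.2 fun i _ => sub_ne_zero.2 fun h =>
    (Fin.succ_ne_zero i).symm (hx.injective (by simpa using h))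
  have hne2 : ∏ i, qPoch q (q * x i / y) (m i) ≠ 0 := Finset.prod_ne_zero_iff.2 fun i _ =>
    qPoch_ne_zero (by simpa using hx.noZero i.succ 0) _
  have hF : (∏ i, ∏ j, qPoch q (q * (Fin.cons y x : Fin (M + 1) → ℂ) i /
        (Fin.cons y x : Fin (M + 1) → ℂ) j) ((Fin.cons 0 m : Fin (M + 1) → ℕ) i))
      = (∏ i, qPoch q (q * x i / y) (m i)) * ∏ i, ∏ j, qPoch q (q * x i / x j) (m i) := by
    simp only [Fin.prod_univ_succ (n := M), Fin.cons_zero, Fin.cons_succ, qPoch_zero,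
      Finset.prod_const_one, one_mul, Finset.prod_mul_distrib]
  have hk : ∀ c, kFactor q (Fin.cons y x : Fin (M + 1) → ℂ) α c (Fin.cons 0 m : Fin (M + 1) → ℕ)
      = kFactor q x α c m := fun c => by
    simp only [kFactor, Fin.prod_univ_succ (n := M), Fin.sum_univ_succ (n := M), Fin.cons_zero,
      Fin.cons_succ, shiftProd_zero, one_mul, zero_add]
  rw [kTerm, kTerm, kWeight, kWeight, hV, hF, vandermondeProd_cons, vandermondeProd_cons]
  simp only [hk, Fin.prod_univ_succ (n := M), Fin.prod_univ_succ (n := N),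
    Fin.sum_univ_succ (n := M), Fin.cons_zero, Fin.cons_succ, zero_add, pow_zero, mul_one, add_zero]
  rw [kFactor, hα, show q ^ 2 / (r * s * (y * ∏ i, x i)) = q ^ 2 / (r * s * ∏ i, x i) / y by
    rw [div_div]; ring, div_pow]
  have hyμ : y ^ (∑ i, m i) ≠ 0 := pow_ne_zero _ hy
  have hP' : ((∏ i, (y - x i * q ^ m i)) / ∏ i, (y - x i)) * (∏ i, shiftProd q y (x i) (m i))
      / (∏ i, qPoch q (q * x i / y) (m i)) / y ^ (∑ i, m i) = 1 := by
    rw [div_mul_eq_mul_div, mul_comm (∏ i, (y - x i * q ^ m i)), hP]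
    field_simp
  rw [mul_div_mul_comm (∏ i, (y - x i * q ^ m i))]
  generalize (∏ i, (y - x i * q ^ m i)) / ∏ i, (y - x i) = A at *
  generalize ∏ i, shiftProd q y (x i) (m i) = B at *
  generalize ∏ i, qPoch q (q * x i / y) (m i) = C at *
  generalize ∏ i, ∏ j, qPoch q (q * x i / x j) (m i) = D
  generalize ∏ j, kFactor q x α (b j) m = E
  generalize ∏ i, (1 - α * x i * q ^ (∑ k, m k + m i)) = F
  generalize ∏ i, qPoch q (α * x i) (∑ k, m k) = G
  generalize ∏ i, (qInf q (q * (x i * q ^ m i) / r) * qInf q (q * (x i * q ^ m i) / s)) = I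
  generalize vandermondeProd (fun i => x i * q ^ m i) / vandermondeProd x = V
  generalize (q ^ 2 / (r * s * ∏ i, x i)) ^ (∑ i, m i) = Z
  generalize y ^ (∑ i, m i) = Y at *
  linear_combination Z * V / D * (1 - α * y * q ^ (∑ i, m i)) * F * qPoch q (α * y) (∑ i, m i) * G
    * (qPoch q (α * s) (∑ i, m i) * qPoch q (α * r) (∑ i, m i)) * (qInf q (q * y / r) *
      qInf q (q * y / s)) * I * qInf q (α * q * y * q ^ (∑ i, m i)) * E * hP'

lemma tsum_kTerm_cons (hq : ‖q‖ < 1) (hx : GenericNodes q (Fin.cons y x : Fin (M + 1) → ℂ))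
    (α r s : ℂ) (b : Fin N → ℂ) :
    ∑' l, kTerm q (Fin.cons y x : Fin (M + 1) → ℂ) α r s (Fin.cons y b : Fin (N + 1) → ℂ) l
      = qInf q (α * y) * (qInf q (q * y / r) * qInf q (q * y / s)) *
        ∑' m, kTerm q x α r s b m := by
  rw [← tsum_mul_left, ← Function.Injective.tsum_eq (g := fun m : Fin M → ℕ =>
    (Fin.cons 0 m : Fin (M + 1) → ℕ)) fun m m' h => (Fin.cons_inj.1 h).2]
  · exact tsum_congr fun m => kTerm_cons hq hx α r s b m
  · intro l hl
    by_contra hl'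
    apply hl
    have h0 : l 0 ≠ 0 := fun h => hl' ⟨Fin.tail l, by
      simp only [← h]; exact Fin.cons_self_tail l⟩
    -- The factor with `k = 0` is `y - y`, so only `l 0 = 0` contributes.
    have h1 : shiftProd q y y (l 0) = 0 :=
      Finset.prod_eq_zero (Finset.mem_range.2 (Nat.pos_of_ne_zero h0)) (by simp)
    simp [kTerm, kFactor, Fin.prod_univ_succ, h1]

lemma defect_cons (hq : ‖q‖ < 1) (hx : GenericNodes q (Fin.cons y x : Fin (M + 1) → ℂ))
    (α r s : ℂ) (b : Fin N → ℂ) :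
    defect q (Fin.cons y x : Fin (M + 1) → ℂ) α r s (Fin.cons y b : Fin (N + 1) → ℂ)
      = qInf q (α * y) * (qInf q (q * y / r) * qInf q (q * y / s)) * defect q x α r s b := by
  have hy : y ≠ 0 := hx.ne_zero 0
  have e1 : ∏ i, (Fin.cons y x : Fin (M + 1) → ℂ) i = y * ∏ i, x i := by
    simp [Fin.prod_univ_succ]
  have e2 : ∏ i, (Fin.cons y b : Fin (N + 1) → ℂ) i = y * ∏ i, b i := by
    simp [Fin.prod_univ_succ]
  have e3 : ∏ i, qInf q (α * (Fin.cons y x : Fin (M + 1) → ℂ) i)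
      = qInf q (α * y) * ∏ i, qInf q (α * x i) := by
    simp [Fin.prod_univ_succ]
  have e4 : α * q * (y * ∏ i, b i) / (y * ∏ i, x i) = α * q * (∏ i, b i) / ∏ i, x i := by
    rw [mul_left_comm, mul_div_mul_left _ _ hy]
  have e5 : q ^ 2 * (y * ∏ i, b i) / (r * s * (y * ∏ i, x i))
      = q ^ 2 * (∏ i, b i) / (r * s * ∏ i, x i) := by
    rw [mul_left_comm, mul_left_comm (r * s), mul_div_mul_left _ _ hy]
  rw [defect, defect, tsum_kTerm_cons hq hx, e1, e2, e3, e4, e5, jDiff_cons hq]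
  ring

end Cons

/-! ### Vanishing of the defect. -/

lemma GenericNodes.tail {q : ℂ} {M : ℕ} {x : Fin (M + 1) → ℂ} (hx : GenericNodes q x) :
    GenericNodes q (Fin.tail x) :=
  ⟨fun i => hx.ne_zero i.succ, hx.injective.comp (Fin.succ_injective _),
    fun i j => hx.noZero i.succ j.succ⟩

lemma defect_eq_zero_of_isEmpty {q : ℂ} (hq : ‖q‖ < 1) (hq0 : q ≠ 0) (x : Fin 0 → ℂ) {α r s : ℂ}
    (hr : r ≠ 0) (hs : s ≠ 0) (hrs : r ≠ s) (b : Fin 2 → ℂ) : defect q x α r s b = 0 := by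
  -- The third parameter is the one whose `jFactor` is the `α`-factor of `jTerm`.
  have h := jDiff₃_eq_prod hq hq0 hr hs hrs (b 0) (b 1) (α * r * s / q)
  have hb : ![b 0, b 1] = b := by
    funext i
    fin_cases i <;> rfl
  have e1 : q * (α * r * s / q) / (r * s) = α := by field_simp
  have e2 : q ^ 2 * b 0 * b 1 * (α * r * s / q) / (r * s) = α * q * (b 0 * b 1) := by field_simp
  have e3 : q ^ 2 * b 0 * (α * r * s / q) / (r * s) = α * q * b 0 := by field_simp
  have e4 : q ^ 2 * b 1 * (α * r * s / q) / (r * s) = α * q * b 1 := by field_simp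
  rw [jDiff₃, hb, e1, e2, e3, e4] at h
  have hk : ∑' l, kTerm q x α r s b l = qInf q (α * q * b 0) * qInf q (α * q * b 1) := by
    rw [tsum_fintype, Fintype.sum_unique]
    simp [kTerm, kWeight, kFactor, vandermondeProd]
  rw [defect, hk]
  simp only [Finset.univ_eq_empty, Finset.prod_empty, Fin.prod_univ_two, div_one, one_mul, mul_one]
  rw [Subsingleton.elim x fun i => i.elim0, h, mul_assoc (q ^ 2)]
  ring

lemma eq_cons₃ {N : ℕ} (b : Fin (N + 3) → ℂ) :
    b = cons₃ (b 0) (b 1) (b 2) fun j => b j.succ.succ.succ := by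
  funext i
  refine Fin.cases rfl (fun i => ?_) i
  refine Fin.cases rfl (fun i => ?_) i
  exact Fin.cases rfl (fun i => rfl) i

lemma eq_zero_of_eventually {f : ℂ → ℂ} {w₀ : ℂ} (hf : ContinuousAt f w₀)
    (h : ∀ᶠ w in 𝓝[≠] w₀, f w = 0) : f w₀ = 0 :=
  tendsto_nhds_unique (hf.tendsto.mono_left nhdsWithin_le_nhds)
    ((tendsto_congr' h).2 tendsto_const_nhds)

theorem defect_eq_zero_of_generic {q : ℂ} (hq : ‖q‖ < 1) (hq0 : q ≠ 0) {r s : ℂ} (hr : r ≠ 0)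
    (hs : s ≠ 0) (hrs : r ≠ s) {α : ℂ} (hα : α ≠ 0) (M : ℕ) :
    ∀ (x : Fin M → ℂ) (b : Fin (M + 2) → ℂ), GenericNodes q x →
      (∀ i, NoZeroFactor q (q * x i / r)) → (∀ i, NoZeroFactor q (q * x i / s)) →
      (∀ i, NoZeroFactor q (α * x i)) → ‖q ^ 2 * (∏ j, b j) / (r * s * ∏ i, x i)‖ < 1 →
      defect q x α r s b = 0 := by
  induction M with
  | zero => exact fun x b _ _ _ _ _ => defect_eq_zero_of_isEmpty hq hq0 x hr hs hrs b
  | succ M ih =>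
    intro x b hx hxr hxs hαx hz
    have hx0 := hx.ne_zero 0
    -- the case of a terminating sum in the first direction
    have hterm : ∀ (n : ℕ) (b : Fin (M + 3) → ℂ), b 0 = x 0 * q ^ n →
        ‖q ^ 2 * (∏ j, b j) / (r * s * ∏ i, x i)‖ < 1 → defect q x α r s b = 0 := by
      intro n
      induction n with
      | zero =>
        intro b hb hz
        rw [pow_zero, mul_one] at hb
        have hxc := Fin.cons_self_tail x
        have hbc := Fin.cons_self_tail b
        rw [hb] at hbc
        rw [← hxc, ← hbc] at hz
        rw [← hxc, ← hbc, defect_cons hq (by rwa [hxc]), ih (Fin.tail x) (Fin.tail b) hx.tail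
          (fun i => hxr i.succ) (fun i => hxs i.succ) (fun i => hαx i.succ), mul_zero]
        simp only [Fin.prod_univ_succ (n := M), Fin.prod_univ_succ (n := M + 2), Fin.cons_zero,
          Fin.cons_succ] at hz
        rwa [mul_left_comm, mul_left_comm (r * s), mul_div_mul_left _ _ hx0] at hz
      | succ n ihn =>
        -- In the three-term relation with first parameter `x 0 * q ^ n`, two members keep that
        -- value and vanish by induction. The coefficient of the third is nonzero when `b₂ ≠ b₃`.
        have hne : ∀ (b₂ b₃ : ℂ) (b : Fin M → ℂ), b₂ ≠ b₃ →
            ‖q ^ 2 * (∏ j, cons₃ (x 0 * q ^ (n + 1)) b₂ b₃ b j) / (r * s * ∏ i, x i)‖ < 1 →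
            defect q x α r s (cons₃ (x 0 * q ^ (n + 1)) b₂ b₃ b) = 0 := by
          intro b₂ b₃ b hb hz
          have e : x 0 * q ^ (n + 1) = q * (x 0 * q ^ n) := by ring
          rw [e] at hz ⊢
          have h := defect_three_term hq hq0 hx hα hr hs hαx b (x 0 * q ^ n) b₂ b₃ hz
          rw [prod_cons₃] at hz
          rw [ihn (cons₃ (x 0 * q ^ n) (q * b₂) b₃ b) rfl
              (by rw [prod_cons₃]; convert hz using 3; ring),
            ihn (cons₃ (x 0 * q ^ n) b₂ (q * b₃) b) rfl
              (by rw [prod_cons₃]; convert hz using 3; ring), mul_zero, mul_zero, add_zero,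
            add_zero] at h
          have h1 : 1 - q * (x 0 * q ^ n) / r ≠ 0 := sub_ne_zero.2 fun h =>
            hxr 0 n (by rw [h]; ring)
          have h2 : 1 - q * (x 0 * q ^ n) / s ≠ 0 := sub_ne_zero.2 fun h =>
            hxs 0 n (by rw [h]; ring)
          exact (mul_eq_zero.1 h).resolve_left
            (mul_ne_zero (sub_ne_zero.2 hb) (mul_ne_zero h1 h2))
        intro b hb hz
        rw [eq_cons₃ b, hb] at hz ⊢
        set b' : Fin M → ℂ := fun j => b j.succ.succ.succ
        -- The excluded coincidence is reached by moving `b 1` slightly and using continuity.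
        by_cases h12 : b 1 = b 2
        · rw [h12] at hz ⊢
          have hd : ∀ j, Differentiable ℂ fun w =>
              cons₃ (x 0 * q ^ (n + 1)) w (b 2) b' j := by
            refine Fin.cases ?_ (Fin.cases ?_ (Fin.cases ?_ fun j => ?_)) <;>
            simp only [cons₃, Fin.cons_zero, Fin.cons_succ] <;> fun_prop
          refine eq_zero_of_eventually (w₀ := b 2)
            (f := fun w => defect q x α r s (cons₃ (x 0 * q ^ (n + 1)) w (b 2) b'))
            (differentiableAt_defect hq hx r s (by fun_prop) hd hz).continuousAt ?_
          have hc : ContinuousAt (fun w => ‖q ^ 2 *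
              (∏ j, cons₃ (x 0 * q ^ (n + 1)) w (b 2) b' j) / (r * s * ∏ i, x i)‖) (b 2) := by
            have : Continuous fun w => ∏ j, cons₃ (x 0 * q ^ (n + 1)) w (b 2) b' j :=
              continuous_finsetProd _ fun j _ => (hd j).continuous
            fun_prop
          filter_upwards [(hc.eventually_lt_const hz).filter_mono nhdsWithin_le_nhds,
            self_mem_nhdsWithin] with w hw hw'
          exact hne w (b 2) b' hw' hw
        · exact hne _ _ _ h12 hz
    -- analytic continuation in the first parameter
    have hbc := Fin.cons_self_tail b
    set c : ℂ := q ^ 2 * (∏ j, Fin.tail b j) / (r * s * ∏ i, x i) with hc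
    have hcw : ∀ w, q ^ 2 * (∏ j, (Fin.cons w (Fin.tail b) : Fin (M + 3) → ℂ) j)
        / (r * s * ∏ i, x i) = c * w := fun w => by
      simp only [Fin.prod_univ_succ (n := M + 2), Fin.cons_zero, Fin.cons_succ, hc]
      ring
    -- The values of `b 0` for which the series converges: a disc, or the whole plane when `c = 0`.
    let U : Set ℂ := {w | ‖c * w‖ < 1}
    have hU : IsOpen U := isOpen_lt (by fun_prop) continuous_const
    have hUc : IsPreconnected U := by
      have h : U = (fun w => c * w) ⁻¹' Metric.ball 0 1 := by
        ext w
        simp [U]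
      rw [h]
      exact ((convex_ball (0 : ℂ) 1).is_linear_preimage
        (IsLinearMap.mk (mul_add c) fun t w => mul_smul_comm t c w)).isPreconnected
    have h0U : (0 : ℂ) ∈ U := by simp [U]
    have han : AnalyticOnNhd ℂ
        (fun w => defect q x α r s (Fin.cons w (Fin.tail b) : Fin (M + 3) → ℂ)) U := by
      refine DifferentiableOn.analyticOnNhd (fun w hw => ?_) hU
      refine (differentiableAt_defect hq hx r s (by fun_prop) (fun j => ?_)
        (by rw [hcw]; exact hw)).differentiableWithinAt
      refine Fin.cases ?_ (fun j => ?_) j <;> simp only [Fin.cons_zero, Fin.cons_succ] <;> fun_prop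
    have ht : Tendsto (fun n : ℕ => x 0 * q ^ n) atTop (𝓝[≠] 0) := by
      refine tendsto_nhdsWithin_iff.2 ⟨?_, Eventually.of_forall fun n =>
        mul_ne_zero hx0 (pow_ne_zero n hq0)⟩
      simpa using (tendsto_pow_atTop_zero hq).const_mul (x 0)
    have hfreq : ∃ᶠ w in 𝓝[≠] (0 : ℂ),
        defect q x α r s (Fin.cons w (Fin.tail b) : Fin (M + 3) → ℂ) = 0 := by
      refine ht.frequently (Eventually.frequently ?_)
      have hmem : ∀ᶠ n : ℕ in atTop, x 0 * q ^ n ∈ U :=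
        (tendsto_nhds_of_tendsto_nhdsWithin ht).eventually (hU.mem_nhds h0U)
      filter_upwards [hmem] with n hn
      exact hterm n _ (Fin.cons_zero _ _) (by rw [hcw]; exact hn)
    have := han.eqOn_zero_of_preconnected_of_frequently_eq_zero hUc h0U hfreq
      (show b 0 ∈ U by
        have := hcw (b 0)
        rw [hbc] at this
        change ‖c * b 0‖ < 1
        rwa [← this])
    simpa only [hbc, Pi.zero_apply] using this

theorem defect_eq_zero {q : ℂ} (hq : ‖q‖ < 1) (hq0 : q ≠ 0) {r s : ℂ} (hr : r ≠ 0)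
    (hs : s ≠ 0) (hrs : r ≠ s) (α : ℂ) {M : ℕ} {x : Fin M → ℂ} (b : Fin (M + 2) → ℂ)
    (hx : GenericNodes q x) (hxr : ∀ i, NoZeroFactor q (q * x i / r))
    (hxs : ∀ i, NoZeroFactor q (q * x i / s))
    (hz : ‖q ^ 2 * (∏ j, b j) / (r * s * ∏ i, x i)‖ < 1) :
    defect q x α r s b = 0 := by
  have hd : Differentiable ℂ fun α => defect q x α r s b := fun α =>
    differentiableAt_defect hq hx r s (by fun_prop) (fun j => by fun_prop) hz
  -- The values of `α` excluded in the generic case; they are countably many, so the others are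
  -- dense.
  let B : Set ℂ := {0} ∪ ⋃ i, ⋃ n : ℕ, {(x i * q ^ n)⁻¹}
  have hB : B.Countable := (Set.countable_singleton 0).union
    (Set.countable_iUnion fun i => Set.countable_iUnion fun n => Set.countable_singleton _)
  have hdense : Dense Bᶜ := hB.dense_compl ℝ
  have := Continuous.ext_on hdense hd.continuous (continuous_const (y := (0 : ℂ))) fun w hw => by
    have hw0 : w ≠ 0 := fun h => hw (Or.inl h)
    refine defect_eq_zero_of_generic hq hq0 hr hs hrs hw0 M x b hx hxr hxs (fun i n h => ?_) hz
    refine hw (Or.inr (Set.mem_iUnion.2 ⟨i, Set.mem_iUnion.2 ⟨n, ?_⟩⟩))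
    rw [mul_assoc] at h
    exact eq_inv_of_mul_eq_one_left h
  exact congrFun this α

/-! ### Return to the original parameters. -/

lemma vandermondeProd_smul_div {M : ℕ} {a : ℂ} (ha : a ≠ 0) (x y : Fin M → ℂ) :
    vandermondeProd (fun i => a * y i) / vandermondeProd (fun i => a * x i)
      = vandermondeProd y / vandermondeProd x := by
  have h : ∀ y : Fin M → ℂ, vandermondeProd (fun i => a * y i)
      = (∏ i : Fin M, ∏ _j ∈ Finset.Ioi i, a) * vandermondeProd y := fun y => by
    simp only [vandermondeProd, ← mul_sub, Finset.prod_mul_distrib]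
  rw [h, h, mul_div_mul_left]
  exact Finset.prod_ne_zero_iff.2 fun _ _ => Finset.prod_ne_zero_iff.2 fun _ _ => ha

section Kajihara

variable {q : ℂ} {M : ℕ} {x : Fin M → ℂ} {a : ℂ} {u : Fin (M + 2) → ℂ}
  {c₁ c₂ d : ℂ}

/-- The dictionary is `x_i ↦ a x_i`, `b_j = a / u_j`, `α = 1`, `r = c₂`, `s = c₁`. Powers of `a /
u_j` coming from `shiftProd_eq` combine with the base of `kWeight` to give `d`. -/
lemma kajiharaTerm_eq (hq : ‖q‖ < 1) (ha : a ≠ 0) (hu : ∀ j, u j ≠ 0)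
    (hd : d = a ^ 2 * q ^ 2 / (c₁ * c₂ * (∏ j, u j) * ∏ i, x i))
    (hax : ∀ i, a * x i ≠ 1) (h₁ : ∀ i, NoZeroFactor q (a * q * x i / c₁))
    (h₂ : ∀ i, NoZeroFactor q (a * q * x i / c₂)) (hau : ∀ j, NoZeroFactor q (a * q / u j))
    (l : Fin M → ℕ) :
    kTerm q (fun i => a * x i) 1 c₂ c₁ (fun j => a / u j) l
      = (∏ i, (1 - a * x i)) * (∏ j, qInf q (a * q / u j))
        * (∏ i, qInf q (a * q * x i / c₁) * qInf q (a * q * x i / c₂))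
        * kajiharaTerm q x a u ![c₁, c₂] d l := by
  have hshift : ∀ j i, shiftProd q (a / u j) (a * x i) (l i)
      = (a / u j) ^ l i * qPoch q (x i * u j) (l i) := fun j i => by
    rw [shiftProd_eq (div_ne_zero ha (hu j)), show a * x i / (a / u j) = x i * u j by
      have := hu j; field_simp]
  have hP : ∏ j, qPoch q (a * q / u j) (∑ i, l i) ≠ 0 :=
    Finset.prod_ne_zero_iff.2 fun j _ => qPoch_ne_zero (hau j) _
  have hk : ∏ j, kFactor q (fun i => a * x i) 1 (a / u j) l
      = (∏ j, qInf q (a * q / u j)) / (∏ j, qPoch q (a * q / u j) (∑ i, l i))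
        * ((∏ j, a / u j) ^ (∑ i, l i) * ∏ i, ∏ j, qPoch q (x i * u j) (l i)) := by
    have h1 : ∏ j, qInf q (a * q / u j) = (∏ j, qPoch q (a * q / u j) (∑ i, l i))
        * ∏ j, qInf q (1 * q * (a / u j) * q ^ (∑ i, l i)) := by
      rw [← Finset.prod_mul_distrib]
      refine Finset.prod_congr rfl fun j _ => ?_
      rw [qInf_eq_qPoch_mul hq _ (∑ i, l i), show a * q / u j = 1 * q * (a / u j) by ring]
    simp only [kFactor, hshift, Finset.prod_mul_distrib, Finset.prod_pow_eq_pow_sum]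
    rw [h1, mul_div_cancel_left₀ _ hP, Finset.prod_comm (f := fun j i => qPoch q (x i * u j) (l i)),
      Finset.prod_pow]
  have hc : ∀ c, (∀ i, NoZeroFactor q (a * q * x i / c)) →
      ∏ i, qInf q (q * (a * x i * q ^ l i) / c)
        = (∏ i, qInf q (a * q * x i / c)) / ∏ i, qPoch q (a * q * x i / c) (l i) := fun c h => by
    rw [← Finset.prod_div_distrib]
    refine Finset.prod_congr rfl fun i _ => ?_
    rw [eq_div_iff (qPoch_ne_zero (h i) _), qInf_eq_qPoch_mul hq (a * q * x i / c) (l i),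
      mul_comm]
    congr 2
    ring
  have hz : (q ^ 2 / (c₂ * c₁ * ∏ i, a * x i)) ^ (∑ i, l i) * (∏ j, a / u j) ^ (∑ i, l i)
      = d ^ (∑ i, l i) := by
    rw [← mul_pow, hd, Finset.prod_mul_distrib, Finset.prod_div_distrib, Finset.prod_const,
      Finset.prod_const, Finset.card_univ, Finset.card_univ, Fintype.card_fin, Fintype.card_fin]
    congr 1
    have : a ^ M ≠ 0 := pow_ne_zero _ ha
    rw [pow_add, div_mul_div_comm, show c₂ * c₁ * (a ^ M * ∏ i, x i) * ∏ j, u j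
      = a ^ M * (c₁ * c₂ * (∏ j, u j) * ∏ i, x i) by ring,
      show q ^ 2 * (a ^ M * a ^ 2) = a ^ M * (a ^ 2 * q ^ 2) by ring, mul_div_mul_left _ _ this]
  have hV : vandermondeProd (fun i => a * x i * q ^ l i) / vandermondeProd (fun i => a * x i)
      = vandermondeProd (fun i => x i * q ^ l i) / vandermondeProd x := by
    simp only [mul_assoc a]
    exact vandermondeProd_smul_div ha x _
  have hx : ∏ i, (1 - a * x i) ≠ 0 :=
    Finset.prod_ne_zero_iff.2 fun i _ => sub_ne_zero.2 (hax i).symm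
  have hxx : ∀ i j, q * (a * x i) / (a * x j) = q * x i / x j := fun i j => by
    rw [mul_left_comm, mul_div_mul_left _ _ ha]
  rw [kTerm, hk, kWeight, hV, kajiharaTerm, ← hz]
  simp only [Finset.prod_mul_distrib, Finset.prod_div_distrib, hc _ h₁, hc _ h₂, hxx,
    Fin.prod_univ_two, Matrix.cons_val_zero, Matrix.cons_val_one, one_mul]
  have hXX : (∏ i, (1 - a * x i)) * (∏ i, (1 - a * x i))⁻¹ = 1 := mul_inv_cancel₀ hx
  simp only [div_eq_mul_inv _ (∏ i, (1 - a * x i))]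
  clear hk hc hV hz hP hx
  generalize ∏ i, (1 - a * x i) = X at *
  generalize X⁻¹ = X' at *
  generalize ∏ i, (1 - a * x i * q ^ (∑ i, l i + l _)) = A
  generalize (∏ i, qPoch q (a * x i) _) = B
  generalize ∏ i, ∏ j, qPoch q (x i * u j) (l i) = C
  generalize ∏ i, ∏ j, qPoch q (q * x i / x j) (l i) = D
  generalize vandermondeProd (fun i => x i * q ^ l i) / vandermondeProd x = V
  generalize ∏ i, qPoch q (a * q * x i / c₁) (l i) = P₁
  generalize ∏ i, qPoch q (a * q * x i / c₂) (l i) = P₂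
  generalize ∏ j, qPoch q (a * q / u j) _ = P
  generalize ∏ j, qInf q (a * q / u j) = U
  generalize ∏ i, qInf q (a * q * x i / c₁) = Q₁
  generalize ∏ i, qInf q (a * q * x i / c₂) = Q₂
  generalize (q ^ 2 / _) ^ (∑ i, l i) = Y
  generalize ((∏ _i : Fin (M + 2), a) / ∏ j, u j) ^ (∑ i, l i) = Z
  linear_combination (-(U * Q₁ * Q₂ * (Y * Z * V * (A * (B * C / (D * (P₁ * P₂)))) *
    (qPoch q c₁ (∑ i, l i) * qPoch q c₂ (∑ i, l i) / P)))) * hXX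

/-- The theorem, with the basic hypergeometric series written as `jTerm`s. -/
lemma jDiff_eq_kajiharaW (hq : ‖q‖ < 1) (hq0 : q ≠ 0) (hx : GenericNodes q x) (hu : ∀ j, u j ≠ 0)
    (hc₁ : c₁ ≠ 0) (hc₂ : c₂ ≠ 0) (hc : c₁ ≠ c₂)
    (hd : d = a ^ 2 * q ^ 2 / (c₁ * c₂ * (∏ j, u j) * ∏ i, x i)) (hd1 : ‖d‖ < 1)
    (hax : ∀ i, a * x i ≠ 1) (h₁ : ∀ i, NoZeroFactor q (a * q * x i / c₁))
    (h₂ : ∀ i, NoZeroFactor q (a * q * x i / c₂)) (hau : ∀ j, NoZeroFactor q (a * q / u j)) :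
    Summable (kajiharaTerm q x a u ![c₁, c₂] d) ∧
    (∏ i, qInf q (a * q * x i)) *
        jDiff q (fun i => a * x i) 1 c₂ c₁ (fun j => a / u j) (c₁ * c₂ * d / q)
      = qInf q q * qInf q (c₂ / c₁) * qInf q (c₁ / c₂) / (c₁ - c₂) * qInf q d
        * ((∏ j, qInf q (a * q / u j))
          * ∏ i, qInf q (a * q * x i / c₁) * qInf q (a * q * x i / c₂))
        * kajiharaW q x a u ![c₁, c₂] d := by
  -- The rescaling by `a` degenerates. Then `d = 0`, the Kajihara series is `1`, and the integral is
  -- the evaluation `jDiff₃_zero_zero`.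
  by_cases ha : a = 0
  · subst ha
    obtain rfl : d = 0 := by simpa using hd
    have hW : ∀ l : Fin M → ℕ, l ≠ 0 → kajiharaTerm q x 0 u ![c₁, c₂] 0 l = 0 := fun l hl => by
      have : ∑ i, l i ≠ 0 := fun h => hl (funext fun i => by
        simpa using (Finset.sum_eq_zero_iff.1 h) i (Finset.mem_univ i))
      rw [kajiharaTerm, zero_pow this]
      simp
    have h0 : kajiharaTerm q x 0 u ![c₁, c₂] 0 0 = 1 := by
      simp [kajiharaTerm, div_self (vandermondeProd_ne_zero hx.injective)]
    refine ⟨summable_of_ne_finset_zero (s := {0}) fun l hl => hW l (by simpa using hl), ?_⟩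
    rw [kajiharaW, tsum_eq_single 0 hW, h0]
    -- This third parameter corresponds to `α = 1`.
    have h := jDiff₃_zero_zero hq hq0 hc₂ hc₁ hc.symm (c₁ * c₂ / q)
    have e : q * (c₁ * c₂ / q) / (c₂ * c₁) = 1 := by field_simp
    rw [jDiff₃, e] at h
    simp only [zero_mul, zero_div, mul_zero, qInf_zero, Finset.prod_const_one, one_mul, mul_one]
    rw [← h]
    simp [jDiff, jTerm, jFactor]
  have hx' : GenericNodes q fun i => a * x i := by
    refine ⟨fun i => mul_ne_zero ha (hx.ne_zero i),
      fun i j h => hx.injective (mul_left_cancel₀ ha h), fun i j => ?_⟩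
    rw [mul_left_comm, mul_div_mul_left _ _ ha]
    exact hx.noZero i j
  have he : (∏ j, a / u j) / ∏ i, a * x i = a ^ 2 / ((∏ j, u j) * ∏ i, x i) := by
    rw [Finset.prod_mul_distrib, Finset.prod_div_distrib, Finset.prod_const, Finset.prod_const,
      Finset.card_univ, Finset.card_univ, Fintype.card_fin, Fintype.card_fin, div_div, pow_add,
      mul_left_comm, mul_div_mul_left _ _ (pow_ne_zero _ ha)]
  have hz : q ^ 2 * (∏ j, a / u j) / (c₂ * c₁ * ∏ i, a * x i) = d := by
    rw [mul_div_mul_comm, he, hd]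
    ring
  have hp : 1 * q * (∏ j, a / u j) / (∏ i, a * x i) = c₁ * c₂ * d / q := by
    rw [mul_div_assoc, he, hd]
    field_simp
  have hsum := summable_kTerm hq hx' 1 c₂ c₁ (fun j => a / u j) (by rw [hz]; exact hd1)
  have hdef := defect_eq_zero hq hq0 hc₂ hc₁ hc.symm 1 (fun j => a / u j) hx'
    (fun i => by convert h₂ i using 1; ring) (fun i => by convert h₁ i using 1; ring)
    (by rw [hz]; exact hd1)
  have hk := kajiharaTerm_eq hq ha hu hd hax h₁ h₂ hau
  have hX : ∏ i, (1 - a * x i) ≠ 0 :=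
    Finset.prod_ne_zero_iff.2 fun i _ => sub_ne_zero.2 (hax i).symm
  have hU : ∏ j, qInf q (a * q / u j) ≠ 0 :=
    Finset.prod_ne_zero_iff.2 fun j _ => qInf_ne_zero hq (hau j)
  have hC : ∏ i, qInf q (a * q * x i / c₁) * qInf q (a * q * x i / c₂) ≠ 0 :=
    Finset.prod_ne_zero_iff.2 fun i _ =>
      mul_ne_zero (qInf_ne_zero hq (h₁ i)) (qInf_ne_zero hq (h₂ i))
  refine ⟨?_, ?_⟩
  · rw [funext hk, summable_mul_left_iff (mul_ne_zero (mul_ne_zero hX hU) hC)] at hsum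
    exact hsum
  · have hXi : ∏ i, qInf q (1 * (a * x i)) = (∏ i, (1 - a * x i)) * ∏ i, qInf q (a * q * x i) := by
      rw [← Finset.prod_mul_distrib]
      refine Finset.prod_congr rfl fun i _ => ?_
      rw [one_mul, qInf_eq_mul hq, show a * x i * q = a * q * x i by ring]
    rw [defect, hp, hz, hXi, funext hk, tsum_mul_left, ← kajiharaW] at hdef
    apply mul_left_cancel₀ hX
    linear_combination hdef

lemma jTerm_eq_phiTerm (hq : ‖q‖ < 1) (hq0 : q ≠ 0) (hc₁ : c₁ ≠ 0) (hc₂ : c₂ ≠ 0)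
    (h₂ : ∀ i, NoZeroFactor q (a * q * x i / c₂)) (hc : NoZeroFactor q (c₁ / c₂))
    (hcd : NoZeroFactor q (c₁ * d)) (n : ℕ) :
    jTerm q (fun i => a * x i) 1 c₂ c₁ (fun j => a / u j) (c₁ * c₂ * d / q) n
      = (∏ i, qInf q (a * q * x i / c₂)) * qInf q (c₁ * d) * qInf q q * qInf q (q * c₁ / c₂)
        * qInf q c₂ * (∏ j, qInf q (a * q / (c₁ * u j)))
        * phiTerm q (r := M + 3) (s := M + 2)
          (Fin.cons c₁ (fun j : Fin (M + 2) => a * q / (c₂ * u j)))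
          (Fin.cons (q * c₁ / c₂) (Fin.cons (c₁ * d) (fun i : Fin M => a * q * x i / c₂))) q n := by
  have hqc : NoZeroFactor q (q * c₁ / c₂) := by
    convert hc.mul_q using 1; ring
  have n1 := qPoch_ne_zero hqc n
  have n2 := qPoch_ne_zero hcd n
  have n3 := qPoch_ne_zero (noZeroFactor_of_norm_lt_one hq hq) n
  have n4 : ∏ i, qPoch q (a * q * x i / c₂) n ≠ 0 :=
    Finset.prod_ne_zero_iff.2 fun i _ => qPoch_ne_zero (h₂ i) n
  have e4 : ∏ i, qInf q (a * q * x i / c₂) = (∏ i, qPoch q (a * q * x i / c₂) n)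
      * ∏ i, qInf q (a * x i * q ^ (n + 1) / c₂) := by
    rw [← Finset.prod_mul_distrib]
    refine Finset.prod_congr rfl fun i _ => ?_
    rw [qInf_eq_qPoch_mul hq _ n]
    congr 2
    ring
  have e2 : qInf q (c₁ * c₂ * d / q * q ^ (n + 1) / c₂) = qInf q (c₁ * d * q ^ n) := by
    congr 1
    field_simp
    ring
  have e1 : c₁ * q ^ (n + 1) / c₂ = q * c₁ / c₂ * q ^ n := by ring
  have e5 : ∀ j, jFactor q c₂ c₁ (a / u j) n
      = qPoch q (a * q / (c₂ * u j)) n * qInf q (a * q / (c₁ * u j)) := fun j => by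
    rw [jFactor]
    congr 2 <;> ring
  rw [phiTerm, e4, qInf_eq_qPoch_mul hq (c₁ * d) n, qInf_eq_qPoch_mul hq q n,
    qInf_eq_qPoch_mul hq (q * c₁ / c₂) n, jTerm, e2, e1, ← pow_succ' q n]
  simp only [e5, one_mul, Finset.prod_mul_distrib, Fin.prod_univ_succ (n := M + 2),
    Fin.prod_univ_succ (n := M + 1), Fin.prod_univ_succ (n := M), Fin.cons_zero, Fin.cons_succ]
  have e6 : (1 + ((M + 2 : ℕ) : ℤ) - ((M + 3 : ℕ) : ℤ)) = 0 := by push_cast; ring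
  rw [e6, zpow_zero]
  clear e1 e2 e4 e5 e6 hqc hcd hc h₂
  generalize ∏ i, qPoch q (a * q * x i / c₂) n = A at *
  generalize qPoch q (c₁ * d) n = B at *
  generalize qPoch q q n = C at *
  generalize qPoch q (q * c₁ / c₂) n = D at *
  generalize ∏ i, qInf q (a * x i * q ^ (n + 1) / c₂) = E
  generalize ∏ i, qPoch q (a * q / (c₂ * u (Fin.succ (Fin.succ i)))) n = F
  generalize ∏ i, qInf q (a * q / (c₁ * u (Fin.succ (Fin.succ i)))) = G
  generalize qPoch q (a * q / (c₂ * u 0)) n = H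
  generalize qPoch q (a * q / (c₂ * u (Fin.succ 0))) n = H'
  generalize qInf q _ = I₁
  generalize qInf q _ = I₂
  generalize qInf q _ = I₃
  generalize qInf q _ = I₄
  generalize qInf q _ = I₅
  generalize qInf q _ = I₆
  have h := mul_inv_cancel₀ (mul_ne_zero n3 (mul_ne_zero n1 (mul_ne_zero n2 n4)))
  rw [div_eq_mul_inv]
  generalize (C * (D * (B * A)))⁻¹ = W at *
  linear_combination (-(q ^ n * E * I₁ * I₂ * I₃ * qPoch q c₁ n * I₄ * H * I₅ * H' * I₆ * F
    * G)) * h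

lemma tsum_jTerm_eq_phiPart (hq : ‖q‖ < 1) (hq0 : q ≠ 0) (hc₁ : c₁ ≠ 0) (hc₂ : c₂ ≠ 0)
    (hd : ‖d‖ < 1) (h₁ : ∀ i, NoZeroFactor q (a * q * x i / c₁))
    (h₂ : ∀ i, NoZeroFactor q (a * q * x i / c₂)) (hau : ∀ j, NoZeroFactor q (a * q / u j))
    (hc : NoZeroFactor q (c₁ / c₂)) (hc' : NoZeroFactor q (c₂ / c₁))
    (hcd : NoZeroFactor q (c₁ * d)) :
    (∏ i, qInf q (a * q * x i)) *
        ((∑' n, jTerm q (fun i => a * x i) 1 c₂ c₁ (fun j => a / u j) (c₁ * c₂ * d / q) n) / c₂)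
      = -(qInf q q * qInf q (c₂ / c₁) * qInf q (c₁ / c₂) / (c₁ - c₂) * qInf q d
        * ((∏ j, qInf q (a * q / u j))
          * ∏ i, qInf q (a * q * x i / c₁) * qInf q (a * q * x i / c₂))
        * phiPart q x a u c₁ c₂ d) := by
  have n1 := qInf_ne_zero hq (noZeroFactor_of_norm_lt_one hq hd)
  have n2 := qInf_ne_zero hq hc'
  have n3 : ∏ j, qInf q (a * q / u j) ≠ 0 :=
    Finset.prod_ne_zero_iff.2 fun j _ => qInf_ne_zero hq (hau j)
  have n4 : ∏ i, qInf q (a * q * x i / c₁) ≠ 0 :=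
    Finset.prod_ne_zero_iff.2 fun i _ => qInf_ne_zero hq (h₁ i)
  have hne : c₁ ≠ c₂ := by
    rintro rfl
    exact hc 0 (by simp [div_self hc₁])
  -- The factor `1 - c₁ / c₂` absorbs the denominator and is the source of the minus sign.
  have e : qInf q (c₁ / c₂) / (c₁ - c₂) = -(qInf q (q * c₁ / c₂) / c₂) := by
    rw [qInf_eq_mul hq, show c₁ / c₂ * q = q * c₁ / c₂ by ring]
    have := sub_ne_zero.2 hne
    field_simp
    ring
  simp only [jTerm_eq_phiTerm hq hq0 hc₁ hc₂ h₂ hc hcd, tsum_mul_left]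
  rw [← phi, mul_div_assoc _ (qInf q (c₁ / c₂)), e, phiPart]
  simp only [Finset.prod_mul_distrib, Finset.prod_div_distrib]
  field_simp

end Kajihara

/-- At `t = q^(n+1)/r` the factor `(r t)_∞` is `(q^(n+1))_∞`, and `(q b_k / r)_∞ / (b_k t)_∞` is `(q
b_k / r)_n`. The last parameter `β` supplies the `α`-factor, with `α = 1`; the others become the
`b_j` of `jTerm`. -/
lemma jacksonTerm_mul {q : ℂ} (hq : ‖q‖ < 1) {M : ℕ} {a b : Fin (M + 3) → ℂ} {x : Fin M → ℂ}
    {p r s β : ℂ} (hq0 : q ≠ 0) (hr : r ≠ 0) (hs : s ≠ 0) (hβ : β = b (Fin.last (M + 2)))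
    (hβ0 : β ≠ 0)
    (ha : ∀ t, ∏ k, qInf q (a k * t)
      = (∏ i, qInf q (x i * t)) * qInf q (p * t) * qInf q (r * t) * qInf q (s * t))
    (hbr : ∀ k, NoZeroFactor q (q * b k / r)) (n : ℕ) :
    (∏ k, qInf q (q * b k / r) * qInf q (q * b k / s)) *
        jacksonTerm q (q / r) (fun t => ∏ k, qInf q (a k * t) / qInf q (b k * t)) n
      = q / r * jTerm q (fun i => q * β / (r * s) * x i) 1 (q * β / s) (q * β / r)
        (fun j : Fin (M + 2) => q * β / (r * s) / (1 / b (Fin.castSucc j))) (q * β * p / (r * s))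
        n := by
  have hden : ∏ k, qInf q (q * b k / r) = (∏ k, qPoch q (q * b k / r) n) *
      ∏ k, qInf q (b k * (q / r * q ^ n)) := by
    rw [← Finset.prod_mul_distrib]
    refine Finset.prod_congr rfl fun k _ => ?_
    rw [qInf_eq_qPoch_mul hq _ n]
    congr 2
    ring
  have hne : ∏ k, qInf q (b k * (q / r * q ^ n)) ≠ 0 := Finset.prod_ne_zero_iff.2 fun k _ =>
    qInf_ne_zero hq (by convert (hbr k).mul_pow n using 1; ring)
  have e1 : ∀ i, q * β / (r * s) * x i * q ^ (n + 1) / (q * β / s) = x i * (q / r * q ^ n) :=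
    fun i => by field_simp; ring
  have e2 : q * β * p / (r * s) * q ^ (n + 1) / (q * β / s) = p * (q / r * q ^ n) := by
    field_simp
    ring
  have e3 : q * β / r * q ^ (n + 1) / (q * β / s) = s * (q / r * q ^ n) := by
    field_simp
    ring
  have e4 : q ^ (n + 1) = r * (q / r * q ^ n) := by field_simp; ring
  have e5 : ∀ j, jFactor q (q * β / s) (q * β / r) (q * β / (r * s) / (1 / b (Fin.castSucc j))) n
      = qPoch q (q * b (Fin.castSucc j) / r) n * qInf q (q * b (Fin.castSucc j) / s) := fun j => by
    rw [jFactor]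
    congr 2 <;> field_simp
  rw [jacksonTerm, jTerm, e2, e3]
  simp only [e1, e5]
  rw [Finset.prod_mul_distrib, Finset.prod_mul_distrib, Finset.prod_div_distrib, ha, hden, ← e4,
    Fin.prod_univ_castSucc (fun k => qPoch q (q * b k / r) n),
    Fin.prod_univ_castSucc (fun k => qInf q (q * b k / s)), ← hβ, one_mul, one_mul]
  have h := mul_inv_cancel₀ hne
  rw [div_eq_mul_inv _ (∏ k, qInf q (b k * _))]
  linear_combination (((∏ j : Fin (M + 2), qPoch q (q * b (Fin.castSucc j) / r) n) *
    qPoch q (q * β / r) n * ((∏ j : Fin (M + 2), qInf q (q * b (Fin.castSucc j) / s))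
      * qInf q (q * β / s)) * (∏ i, qInf q (x i * (q / r * q ^ n))) * qInf q (p * (q / r * q ^ n))
      * qInf q (q ^ (n + 1)) * qInf q (s * (q / r * q ^ n))) * (q / r * q ^ n)) * h

lemma prod_eq_of_natAdd {M : ℕ} {a : Fin (M + 3) → ℂ} {p r s : ℂ} (hp : p = a (Fin.natAdd M 0))
    (hr : r = a (Fin.natAdd M 1)) (hs : s = a (Fin.natAdd M 2)) (f : ℂ → ℂ) :
    ∏ k, f (a k) = (∏ i : Fin M, f (a (Fin.castAdd 3 i))) * f p * f r * f s := by
  rw [Fin.prod_univ_add, Fin.prod_univ_three, hp, hr, hs]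
  ring

lemma summable_phiTerm {q : ℂ} (hq : ‖q‖ < 1) {s : ℕ} (A : Fin (s + 1) → ℂ) {B : Fin s → ℂ}
    (hB : ∀ j, NoZeroFactor q (B j)) : Summable (phiTerm q A B q) := by
  obtain ⟨K, hK⟩ := exists_norm_inv_qPoch_le hq (noZeroFactor_of_norm_lt_one hq hq)
  choose C hC using fun j => exists_norm_inv_qPoch_le hq (hB j)
  have hK0 : 0 ≤ K := (norm_nonneg _).trans (hK 0)
  refine Summable.of_norm_bounded ((summable_geometric_of_lt_one (norm_nonneg q) hq).mul_left
    ((∏ i, expBound q (A i)) * (K * ∏ j, C j))) fun n => ?_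
  have e : (1 + (s : ℤ) - ((s + 1 : ℕ) : ℤ)) = 0 := by push_cast; ring
  rw [phiTerm, e, zpow_zero, mul_one, div_eq_mul_inv, mul_inv, ← Finset.prod_inv_distrib]
  simp only [norm_mul, norm_prod, norm_pow]
  gcongr
  · exact Finset.prod_nonneg fun i _ => (expBound_pos q (A i)).le
  · exact norm_qPoch_le hq _ _
  · exact hK n
  · exact hC _ n

end QSeries

end

/-! ### The two forms of the transformation. -/

theorem mainTheorem1 (q : ℂ) (hq0 : q ≠ 0) (hq1 : ‖q‖ < 1) (M : ℕ) (hM : 1 ≤ M) :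
    -- the series form
    (∀ (x : Fin M → ℂ) (a : ℂ) (b : Fin (M + 2) → ℂ) (c₁ c₂ d : ℂ),
      d = a ^ 2 * q ^ 2 / (c₁ * c₂ * (∏ j, b j) * ∏ i, x i) →
      ‖d‖ < 1 →
      -- no denominator vanishes
      (∀ i, x i ≠ 0) → (∀ j, b j ≠ 0) → c₁ ≠ 0 → c₂ ≠ 0 →
      Function.Injective x →
      (∀ i j, NoZeroFactor q (q * x i / x j)) →
      (∀ i, a * x i ≠ 1) →
      (∀ i, NoZeroFactor q (a * q * x i / c₁)) →
      (∀ i, NoZeroFactor q (a * q * x i / c₂)) →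
      (∀ j, NoZeroFactor q (a * q / b j)) →
      NoZeroFactor q (c₁ / c₂) → NoZeroFactor q (c₂ / c₁) →
      NoZeroFactor q (c₁ * d) → NoZeroFactor q (c₂ * d) →
      Summable (kajiharaTerm q x a b ![c₁, c₂] d) ∧
      Summable (phiTerm q (r := M + 3) (s := M + 2)
        (Fin.cons c₁ (fun j : Fin (M + 2) => a * q / (c₂ * b j)))
        (Fin.cons (q * c₁ / c₂) (Fin.cons (c₁ * d) (fun i : Fin M => a * q * x i / c₂))) q) ∧
      Summable (phiTerm q (r := M + 3) (s := M + 2)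
        (Fin.cons c₂ (fun j : Fin (M + 2) => a * q / (c₁ * b j)))
        (Fin.cons (q * c₂ / c₁) (Fin.cons (c₂ * d) (fun i : Fin M => a * q * x i / c₁))) q) ∧
      kajiharaW q x a b ![c₁, c₂] d
        = phiPart q x a b c₁ c₂ d + phiPart q x a b c₂ c₁ d) ∧
    -- the integral form; `p`, `r`, `s` are `a_{M+1}`, `a_{M+2}`, `a_{M+3}` and `β` is `b_{M+3}`
    (∀ (a b : Fin (M + 3) → ℂ) (p r s β : ℂ),
      p = a (Fin.natAdd M 0) → r = a (Fin.natAdd M 1) → s = a (Fin.natAdd M 2) →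
      β = b (Fin.last (M + 2)) →
      ∏ k, a k = q ^ 2 * ∏ k, b k →
      ‖p / β‖ < 1 →
      -- no denominator vanishes
      (∀ k, a k ≠ 0) → (∀ k, b k ≠ 0) → r ≠ s →
      (∀ k, NoZeroFactor q (q * b k / r)) →
      (∀ k, NoZeroFactor q (q * b k / s)) →
      (∀ i j : Fin M, i ≠ j → a (Fin.castAdd 3 i) ≠ a (Fin.castAdd 3 j)) →
      (∀ i j : Fin M, NoZeroFactor q (q * a (Fin.castAdd 3 i) / a (Fin.castAdd 3 j))) →
      (∀ i : Fin M, NoZeroFactor q (q * a (Fin.castAdd 3 i) / r)) →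
      (∀ i : Fin M, NoZeroFactor q (q * a (Fin.castAdd 3 i) / s)) →
      (∀ i : Fin M, NoZeroFactor q (q * β / (r * s) * a (Fin.castAdd 3 i))) →
      (∀ j : Fin (M + 2), NoZeroFactor q (q ^ 2 * b (Fin.castSucc j) * β / (r * s))) →
      Summable (jacksonTerm q (q / r) (fun t => ∏ k, qInf q (a k * t) / qInf q (b k * t))) ∧
      Summable (jacksonTerm q (q / s) (fun t => ∏ k, qInf q (a k * t) / qInf q (b k * t))) ∧
      Summable (kajiharaTerm q (fun i : Fin M => a (Fin.castAdd 3 i)) (q * β / (r * s))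
        (fun j : Fin (M + 2) => 1 / b (Fin.castSucc j)) ![q * β / r, q * β / s] (p / β)) ∧
      jackson q (q / r) (q / s) (fun t => ∏ k, qInf q (a k * t) / qInf q (b k * t))
        = (∏ i : Fin M, qInf q (q * a (Fin.castAdd 3 i) / r) * qInf q (q * a (Fin.castAdd 3 i) / s)
              / qInf q (q ^ 2 * a (Fin.castAdd 3 i) * β / (r * s)))
          * (∏ j : Fin (M + 2), qInf q (q ^ 2 * b (Fin.castSucc j) * β / (r * s)))
          * (∏ k, 1 / (qInf q (q * b k / r) * qInf q (q * b k / s)))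
          * (qInf q q * qInf q (p / β) * qInf q (r / s) * qInf q (s / r))
          * ((1 - q) * q / (s - r))
          * kajiharaW q (fun i : Fin M => a (Fin.castAdd 3 i)) (q * β / (r * s))
              (fun j : Fin (M + 2) => 1 / b (Fin.castSucc j)) ![q * β / r, q * β / s] (p / β)) := by
  refine ⟨?_, ?_⟩
  · intro x a b c₁ c₂ d hd hd1 hx hb hc₁ hc₂ hinj hxx hax h₁ h₂ hab hc hc' hcd hcd'
    have hne : c₁ ≠ c₂ := by
      rintro rfl
      exact hc 0 (by simp [div_self hc₁])
    have hX : GenericNodes q x := ⟨hx, hinj, hxx⟩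
    obtain ⟨hW, h⟩ := jDiff_eq_kajiharaW hq1 hq0 hX hb hc₁ hc₂ hne hd hd1 hax h₁ h₂ hab
    have hq' := qInf_ne_zero hq1 (noZeroFactor_of_norm_lt_one hq1 hq1)
    have hd' := qInf_ne_zero hq1 (noZeroFactor_of_norm_lt_one hq1 hd1)
    have hU : ∏ j, qInf q (a * q / b j) ≠ 0 :=
      Finset.prod_ne_zero_iff.2 fun j _ => qInf_ne_zero hq1 (hab j)
    have hC : ∏ i, qInf q (a * q * x i / c₁) * qInf q (a * q * x i / c₂) ≠ 0 :=
      Finset.prod_ne_zero_iff.2 fun i _ =>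
        mul_ne_zero (qInf_ne_zero hq1 (h₁ i)) (qInf_ne_zero hq1 (h₂ i))
    refine ⟨hW, ?_, ?_, ?_⟩
    · refine summable_phiTerm hq1 _ (Fin.cases ?_ (Fin.cases hcd h₂))
      convert hc.mul_q using 1
      simp only [Fin.cons_zero]
      ring
    · refine summable_phiTerm hq1 _ (Fin.cases ?_ (Fin.cases hcd' h₁))
      convert hc'.mul_q using 1
      simp only [Fin.cons_zero]
      ring
    · have t₁ := tsum_jTerm_eq_phiPart (u := b) hq1 hq0 hc₁ hc₂ hd1 h₁ h₂ hab hc hc' hcd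
      -- The second series is the first with `c₁` and `c₂` exchanged; the prefactor is antisymmetric
      -- through `c₁ - c₂`, which matches the minus sign in `jDiff`.
      have t₂ := tsum_jTerm_eq_phiPart (u := b) hq1 hq0 hc₂ hc₁ hd1 h₂ h₁ hab hc' hc hcd'
      have hK : qInf q q * qInf q (c₂ / c₁) * qInf q (c₁ / c₂) / (c₁ - c₂) * qInf q d
          * ((∏ j, qInf q (a * q / b j))
            * ∏ i, qInf q (a * q * x i / c₁) * qInf q (a * q * x i / c₂)) ≠ 0 :=
        mul_ne_zero (mul_ne_zero (div_ne_zero (mul_ne_zero (mul_ne_zero hq' (qInf_ne_zero hq1 hc'))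
          (qInf_ne_zero hq1 hc)) (sub_ne_zero.2 hne)) hd') (mul_ne_zero hU hC)
      apply mul_left_cancel₀ hK
      rw [← h, jDiff]
      have hcomm : ∏ i, qInf q (a * q * x i / c₂) * qInf q (a * q * x i / c₁)
          = ∏ i, qInf q (a * q * x i / c₁) * qInf q (a * q * x i / c₂) :=
        Finset.prod_congr rfl fun i _ => mul_comm _ _
      rw [hcomm, mul_comm c₂ c₁, ← neg_sub c₁ c₂, div_neg] at t₂
      linear_combination t₂ - t₁
  · intro a b p r s β hp hr hs hβ hab hpβ ha hb hrs hbr hbs hinj hxx hxr hxs hax hbα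
    have hr0 : r ≠ 0 := hr ▸ ha _
    have hs0 : s ≠ 0 := hs ▸ ha _
    have hp0 : p ≠ 0 := hp ▸ ha _
    have hβ0 : β ≠ 0 := hβ ▸ hb _
    set x : Fin M → ℂ := fun i => a (Fin.castAdd 3 i) with hx
    have hX : GenericNodes q x :=
      ⟨fun i => ha _, fun i j h => by_contra fun hij => hinj i j hij h, hxx⟩
    have hc₁ : q * β / r ≠ 0 := div_ne_zero (mul_ne_zero hq0 hβ0) hr0
    have hc₂ : q * β / s ≠ 0 := div_ne_zero (mul_ne_zero hq0 hβ0) hs0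
    have hne : q * β / r ≠ q * β / s := fun h => hrs (by
      rw [div_eq_div_iff hr0 hs0] at h
      exact (mul_left_cancel₀ (mul_ne_zero hq0 hβ0) h).symm)
    have hB : ∏ j : Fin (M + 2), b (Fin.castSucc j) ≠ 0 :=
      Finset.prod_ne_zero_iff.2 fun j _ => hb _
    -- The balancing condition says exactly that `p / β` is the argument `d` of the series form, for
    -- `a = q β / (r s)`, `c₁ = q β / r` and `c₂ = q β / s`.
    have hd : p / β = (q * β / (r * s)) ^ 2 * q ^ 2 / (q * β / r * (q * β / s) *
        (∏ j : Fin (M + 2), 1 / b (Fin.castSucc j)) * ∏ i, x i) := by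
      have := hX.prod_ne_zero
      rw [prod_eq_of_natAdd hp hr hs fun t => t, Fin.prod_univ_castSucc, ← hβ] at hab
      rw [Finset.prod_div_distrib, Finset.prod_const_one]
      change (∏ i, x i) * p * r * s = _ at hab
      field_simp
      linear_combination hab
    have e₁ : ∀ i, q * β / (r * s) * q * x i / (q * β / r) = q * x i / s := fun i => by field_simp
    have e₂ : ∀ i, q * β / (r * s) * q * x i / (q * β / s) = q * x i / r := fun i => by field_simp
    have e₃ : ∀ j : Fin (M + 2), q * β / (r * s) * q / (1 / b (Fin.castSucc j))
        = q ^ 2 * b (Fin.castSucc j) * β / (r * s) := fun j => by field_simp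
    have e₄ : q * β / r * (q * β / s) * (p / β) / q = q * β * p / (r * s) := by field_simp
    obtain ⟨hW, h⟩ := jDiff_eq_kajiharaW (u := fun j : Fin (M + 2) => 1 / b (Fin.castSucc j)) hq1
      hq0 hX (fun j => one_div_ne_zero (hb _)) hc₁ hc₂ hne hd hpβ
      (fun i => by simpa using hax i 0) (fun i => by rw [e₁]; exact hxs i)
      (fun i => by rw [e₂]; exact hxr i) (fun j => by rw [e₃]; exact hbα j)
    have hA : ∀ t, ∏ k, qInf q (a k * t)
        = (∏ i, qInf q (x i * t)) * qInf q (p * t) * qInf q (r * t) * qInf q (s * t) :=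
      fun t => prod_eq_of_natAdd hp hr hs fun y => qInf q (y * t)
    have hK : ∏ k, qInf q (q * b k / r) * qInf q (q * b k / s) ≠ 0 :=
      Finset.prod_ne_zero_iff.2 fun k _ =>
        mul_ne_zero (qInf_ne_zero hq1 (hbr k)) (qInf_ne_zero hq1 (hbs k))
    have jr := jacksonTerm_mul hq1 hq0 hr0 hs0 hβ hβ0 hA hbr
    have js := jacksonTerm_mul hq1 (x := x) (p := p) hq0 hs0 hr0 hβ hβ0
      (fun t => by rw [hA, mul_right_comm]) hbs
    have hcomm : ∏ k, qInf q (q * b k / s) * qInf q (q * b k / r)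
        = ∏ k, qInf q (q * b k / r) * qInf q (q * b k / s) :=
      Finset.prod_congr rfl fun k _ => mul_comm _ _
    rw [hcomm, mul_comm s r] at js
    refine ⟨?_, ?_, hW, ?_⟩
    · rw [← summable_mul_left_iff hK, funext jr]
      exact (summable_jTerm hq1 _ _ _ _ _ _).mul_left _
    · rw [← summable_mul_left_iff hK, funext js]
      exact (summable_jTerm hq1 _ _ _ _ _ _).mul_left _
    · have hQ : ∏ i, qInf q (q * β / (r * s) * q * x i) ≠ 0 :=
        Finset.prod_ne_zero_iff.2 fun i _ => qInf_ne_zero hq1 (by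
          convert (hax i).mul_q using 1; ring)
      have e₅ : ∀ i, q ^ 2 * x i * β / (r * s) = q * β / (r * s) * q * x i := fun i => by ring
      have e₆ : q * β / s / (q * β / r) = r / s := by field_simp
      have e₇ : q * β / r / (q * β / s) = s / r := by field_simp
      have e₈ : q * β / r - q * β / s = q * β / (r * s) * (s - r) := by field_simp
      rw [e₄, e₆, e₇, e₈] at h
      simp only [e₁, e₂, e₃] at h
      have jr' := congrArg (fun f : ℕ → ℂ => ∑' n, f n) (funext jr)
      have js' := congrArg (fun f : ℕ → ℂ => ∑' n, f n) (funext js)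
      simp only [tsum_mul_left] at jr' js'
      change _ = (∏ i, qInf q (q * x i / r) * qInf q (q * x i / s)
        / qInf q (q ^ 2 * x i * β / (r * s))) * _ * _ * _ * _ * _
      rw [jackson, jacksonZero, jacksonZero]
      simp only [e₅]
      rw [Finset.prod_div_distrib, Finset.prod_div_distrib, Finset.prod_const_one]
      have hcx : ∏ i, qInf q (q * x i / s) * qInf q (q * x i / r)
          = ∏ i, qInf q (q * x i / r) * qInf q (q * x i / s) :=
        Finset.prod_congr rfl fun i _ => mul_comm _ _
      have hsr := sub_ne_zero.2 hrs.symm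
      rw [hcx, jDiff] at h
      clear hcx hcomm hax hbα hxx hxr hxs hbr hbs hinj hA hd hab hW hX hB jr js
        e₁ e₂ e₃ e₄ e₅ e₆ e₇ e₈
      generalize ∏ i, qInf q (q * β / (r * s) * q * x i) = Q at *
      generalize ∏ k, qInf q (q * b k / r) * qInf q (q * b k / s) = K at *
      generalize ∏ i, qInf q (q * x i / r) * qInf q (q * x i / s) = P at *
      generalize ∏ j : Fin (M + 2), qInf q (q ^ 2 * b (Fin.castSucc j) * β / (r * s)) = U at *
      generalize kajiharaW q x (q * β / (r * s)) (fun j : Fin (M + 2) => 1 / b (Fin.castSucc j))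
        ![q * β / r, q * β / s] (p / β) = W at *
      generalize ∑' n, jTerm q (fun i => q * β / (r * s) * x i) 1 (q * β / s) (q * β / r)
        (fun j : Fin (M + 2) => q * β / (r * s) / (1 / b (Fin.castSucc j)))
        (q * β * p / (r * s)) n = S at *
      generalize ∑' n, jTerm q (fun i => q * β / (r * s) * x i) 1 (q * β / r) (q * β / s)
        (fun j : Fin (M + 2) => q * β / (r * s) / (1 / b (Fin.castSucc j)))
        (q * β * p / (r * s)) n = S' at *
      generalize ∑' n, jacksonTerm q (q / r)
        (fun t => ∏ k, qInf q (a k * t) / qInf q (b k * t)) n = J at *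
      generalize ∑' n, jacksonTerm q (q / s)
        (fun t => ∏ k, qInf q (a k * t) / qInf q (b k * t)) n = J' at *
      -- The endpoints `q β / s`, `q β / r` of the normalised integral differ from `r`, `s` by the
      -- common scale `q β / (r s)`, which cancels from both sides.
      have h' : Q * (q / s * S' - q / r * S) = q * (qInf q q * qInf q (r / s) * qInf q (s / r))
          / (s - r) * qInf q (p / β) * (U * P) * W := by
        have e : S' / (q * β / r) - S / (q * β / s) = r * s / (q * β) * (S' / s - S / r) := by
          field_simp
        have e' : q / s * S' - q / r * S = q * (S' / s - S / r) := by ring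
        have e'' : ∀ Y : ℂ, Y / (q * β / (r * s) * (s - r)) = r * s / (q * β) * (Y / (s - r)) :=
          fun Y => by field_simp
        rw [e, e''] at h
        rw [e']
        have hne : r * s / (q * β) ≠ 0 :=
          div_ne_zero (mul_ne_zero hr0 hs0) (mul_ne_zero hq0 hβ0)
        apply mul_left_cancel₀ hne
        linear_combination q * h
      rw [← js', ← jr'] at h'
      have h'' : J' - J = q * (qInf q q * qInf q (r / s) * qInf q (s / r))
          / (s - r) * qInf q (p / β) * (U * P) * W / (Q * K) := by
        rw [eq_div_iff (mul_ne_zero hQ hK), ← h']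
        ring
      rw [← mul_sub, h'']
      ring
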